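/- A \emph{pointed convex algebra} (PCA) is a set $X$ with a point $\star\in X$ and operations $+_p\colon X\times X\to X$, $p\in(0,1)$, such that $(x_1+_qx_2)+_px_3=x_1+_{\tilde p}(x_2+_{\tilde q}x_3)$ with $\tilde p=pq$, $\tilde q=\frac{p(1-q)}{1-pq}$, $x_1+_px_2=x_2+_{1-p}x_1$ and $x+_px=x$. Put $x+_1y=x$, $x+_0y=y$ and $p\cdot x=x+_p\star$; for $p_i\in[0,1]$ with $\sum_i p_i\le 1$, the convex sum $\sum_{i=1}^n p_i\cdot x_i$ is $\star$ for $n=0$ and $x_1+_{p_1}\sum_{i=2}^{n}\frac{p_i}{1-p_1}\cdot x_i$ for $n\ge1$ (with weights $0$ in place of $\frac{p_i}{1-p_1}$ if $p_1=1$). A category is \emph{PCA-enriched} if its hom-sets are PCAs and composition (written $;$ in diagrammatic order) preserves $\star$ and $+_p$ in each argument. A \emph{convex biproduct category} is a PCA-enriched category with an object that is both initial and final and, for all objects $X_1,X_2$, a coproduct $\iota_i\colon X_i\to X_1\oplus X_2$ and arrows $\pi_i\colon X_1\oplus X_2\to X_i$ such that $\iota_i;\pi_i=\mathrm{id}_{X_i}$,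 $\iota_i;\pi_j=\star$ for $i\ne j$, and such that for all $p_1,p_2\in[0,1]$ with $p_1+p_2\le1$ and all $f_i\colon A\to X_i$ there is a unique $h\colon A\to X_1\oplus X_2$ with $h;\pi_i=p_i\cdot f_i$ for $i=1,2$. Convex biproduct categories form a category $\mathbf{CBCat}$ whose morphisms are the functors that preserve $\star$, all $+_p$, and finite coproducts. Let $\mathbf C$ be a category. \emph{The category $\mathbf C^+$.} It has the objects of $\mathbf C$; its arrows $X\to Y$ are the finitely supported functions $d\colon\mathbf C[X,Y]\to[0,1]$ with $\sum_f d(f)\le1$, with $\star=0$, $(d+_pe)(f)=p\,d(f)+(1-p)\,e(f)$ and composition $(d;e)(h)=\sum_{f;g=h}d(f)e(g)$; identities are Dirac distributions. \emph{The category $\mathrm{StMat}(\mathbf C^+)$.} Its objects are finite words of objects of $\mathbf C$. An arrow $U_1\cdots U_n\to V_1\cdots V_m$ is an $m\times n$ matrix of pairs $(p_{ji},f_{ji})$ with $f_{ji}\in\mathbf C^+[U_i,V_j]$, $p_{ji}\in[0,1]$ and $\sum_jp_{ji}\le1$ for every $i$, where two matrices are identified if $p_{ji}\cdot f_{ji}=p'_{ji}\cdot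 f'_{ji}$ for all $i,j$. Composition of $(p_{ji},f_{ji})$ with $(p'_{kj},f'_{kj})$ is matrix multiplication: the $(k,i)$-entry is $\big(r_{ki},\ \sum_j\frac{p'_{kj}p_{ji}}{r_{ki}}\cdot(f_{ji};f'_{kj})\big)$ with $r_{ki}=\sum_jp'_{kj}p_{ji}$ (weights $0$ if $r_{ki}=0$). Identities are the matrices with $(1,\mathrm{id})$ on the diagonal and $(0,\star)$ elsewhere, and $\star$ and $+_p$ are entrywise. \emph{The category $T(\mathbf C)$ of probabilistic tapes.} Its objects are finite words of objects of $\mathbf C$; $\oplus$ denotes concatenation and $0$ the empty word. Terms are generated, with the evident types, from $\lhd^p_U\colon U\to U\oplus U$ ($p\in(0,1)$), $!_U\colon U\to0$, $\rhd_U\colon U\oplus U\to U$, $?_U\colon0\to U$, $\sigma_{U,V}\colon U\oplus V\to V\oplus U$, $\mathrm{id}_U$, $\mathrm{id}_0$ (for $U,V$ objects of $\mathbf C$) and $\overline c\colon U\to V$ (for $c\colon U\to V$ in $\mathbf C$) by composition $;$ and sum $\oplus$. For words, $\mathrm{id}_{U\oplus P}=\mathrm{id}_U\oplus\mathrm{id}_P$,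 $!_0=?_0=\lhd^p_0=\rhd_0=\mathrm{id}_0$, $!_{U\oplus P}={!_U}\oplus{!_P}$, $?_{U\oplus P}={?_U}\oplus{?_P}$, $\sigma_{U,0}=\mathrm{id}_U$, $\sigma_{U,V\oplus Q}=(\sigma_{U,V}\oplus\mathrm{id}_Q);(\mathrm{id}_V\oplus\sigma_{U,Q})$, $\sigma_{0,Q}=\mathrm{id}_Q$, $\sigma_{U\oplus P,Q}=(\mathrm{id}_U\oplus\sigma_{P,Q});(\sigma_{U,Q}\oplus\mathrm{id}_P)$, $\lhd^p_{U\oplus P}=(\lhd^p_U\oplus\lhd^p_P);(\mathrm{id}_U\oplus\sigma_{U,P}\oplus\mathrm{id}_P)$ and $\rhd_{U\oplus P}=(\mathrm{id}_U\oplus\sigma_{P,U}\oplus\mathrm{id}_P);(\rhd_U\oplus\rhd_P)$. Arrows of $T(\mathbf C)$ are typed terms modulo the least congruence containing \begin{itemize} \item the axioms of strict symmetric monoidal categories for $(\oplus,0,\sigma)$: associativity and unit laws of $;$ and of $\oplus$, interchange, $\sigma_{P,Q};\sigma_{Q,P}=\mathrm{id}$ and $(s\oplus\mathrm{id}_R);\sigma_{Q,R}=\sigma_{P,R};(\mathrm{id}_R\oplus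 s)$; \item $\overline{\mathrm{id}_U}=\mathrm{id}_U$ and $\overline{c;d}=\overline c;\overline d$; \item natural and coherent monoids: $(\mathrm{id}_P\oplus\rhd_P);\rhd_P=(\rhd_P\oplus\mathrm{id}_P);\rhd_P$, $(?_P\oplus\mathrm{id}_P);\rhd_P=\mathrm{id}_P$, $\sigma_{P,P};\rhd_P=\rhd_P$, $?_{P\oplus Q}={?_P}\oplus{?_Q}$, $\rhd_{P\oplus Q}=(\mathrm{id}_P\oplus\sigma_{Q,P}\oplus\mathrm{id}_Q);(\rhd_P\oplus\rhd_Q)$, and, for $f\colon P\to Q$, $?_P;f={?_Q}$ and $\rhd_P;f=(f\oplus f);\rhd_Q$; \item natural and coherent co-PCAs: $\lhd^p_P;(\lhd^q_P\oplus\mathrm{id}_P)=\lhd^{\tilde p}_P;(\mathrm{id}_P\oplus\lhd^{\tilde q}_P)$ (with $\tilde p,\tilde q$ as above), $\lhd^p_P;\rhd_P=\mathrm{id}_P$, $\lhd^p_P;\sigma_{P,P}=\lhd^{1-p}_P$, $!_{P\oplus Q}={!_P}\oplus{!_Q}$, $\lhd^p_{P\oplus Q}=(\lhd^p_P\oplus\lhd^p_Q);(\mathrm{id}_P\oplus\sigma_{P,Q}\oplus\mathrm{id}_Q)$,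 and, for $f\colon P\to Q$, $f;{!_Q}={!_P}$ and $f;\lhd^p_Q=\lhd^p_P;(f\oplus f)$. \end{itemize} $T(\mathbf C)$ is PCA-enriched by $f+_pg=\lhd^p_P;(f\oplus g);\rhd_Q$ and $\star_{P,Q}={!_P};{?_Q}$. \textbf{Statement.} For every category $\mathbf C$, both $T(\mathbf C)$ and $\mathrm{StMat}(\mathbf C^+)$ are convex biproduct categories, and they are isomorphic in $\mathbf{CBCat}$: there are morphisms of convex biproduct categories $T(\mathbf C)\to\mathrm{StMat}(\mathbf C^+)$ and $\mathrm{StMat}(\mathbf C^+)\to T(\mathbf C)$ whose composites are the identity functors. -/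

import Mathlib

open CategoryTheory

universe v v' u u' w

noncomputable section

namespace ProbTape

/-! ### Pointed convex algebras -/

/-- The open real interval `(0,1)`. -/
abbrev OI : Type := Set.Ioo (0 : ℝ) 1

/-- `1 - p`. -/
def OI.compl (p : OI) : OI :=
  ⟨1 - p.1, by have := p.2.1; have := p.2.2; constructor <;> linarith⟩

/-- `p̃ = p q`. -/
def OI.tildeFst (p q : OI) : OI :=
  ⟨p.1 * q.1, mul_pos p.2.1 q.2.1, by have := p.2; have := q.2; nlinarith [p.2.1, p.2.2, q.2.1, q.2.2]⟩

/-- `q̃ = p (1 - q) / (1 - p q)`. -/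
def OI.tildeSnd (p q : OI) : OI :=
  ⟨p.1 * (1 - q.1) / (1 - p.1 * q.1), by
    have h1 := p.2.1
    have h2 := p.2.2
    have h3 := q.2.1
    have h4 := q.2.2
    have h5 : p.1 * q.1 < 1 := (OI.tildeFst p q).2.2
    constructor
    · exact div_pos (mul_pos h1 (by linarith)) (by linarith)
    · rw [div_lt_one (by linarith)]
      nlinarith⟩

/-- A pointed convex algebra: a point `star` and operations `+_p` for `p` in `(0,1)`. -/
class PCA (X : Type w) where
  star : X
  add : OI → X → X → X
  add_assoc : ∀ (p q : OI) (x₁ x₂ x₃ : X),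
    add p (add q x₁ x₂) x₃ = add (OI.tildeFst p q) x₁ (add (OI.tildeSnd p q) x₂ x₃)
  add_comm : ∀ (p : OI) (x₁ x₂ : X), add p x₁ x₂ = add p.compl x₂ x₁
  add_idem : ∀ (p : OI) (x : X), add p x x = x

section PCAOps

variable {X : Type w} [PCA X]

open Classical in
/-- `x +_p y` for `p` in the closed interval `[0,1]`, with `x +_1 y = x` and `x +_0 y = y`.
(Only used for `p ∈ [0,1]`; other reals are clamped.) -/
def PCA.addI (p : ℝ) (x y : X) : X :=
  if h : p ∈ Set.Ioo (0 : ℝ) 1 then PCA.add ⟨p, h⟩ x y else if p ≤ 0 then y else x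

/-- Multiplication by a scalar: `p · x = x +_p star`. -/
def PCA.smul (p : ℝ) (x : X) : X := PCA.addI p x PCA.star

open Classical in
/-- The `n`-ary convex sum `∑ᵢ pᵢ · xᵢ`, for `pᵢ ∈ [0,1]` with `∑ᵢ pᵢ ≤ 1`. -/
def PCA.sum : (n : ℕ) → (Fin n → ℝ) → (Fin n → X) → X
  | 0, _, _ => PCA.star
  | n + 1, p, x => PCA.addI (p 0) (x 0)
      (PCA.sum n (fun j => if p 0 = 1 then 0 else p j.succ / (1 - p 0)) (fun j => x j.succ))

end PCAOps

/-! ### PCA-enriched categories and convex biproduct categories -/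

/-- A PCA-enrichment of a category. -/
class PCAEnriched (C : Type u) [Category.{v} C] where
  pca : ∀ X Y : C, PCA (X ⟶ Y)
  comp_add : ∀ {X Y Z : C} (p : OI) (e : X ⟶ Y) (f g : Y ⟶ Z),
    e ≫ PCA.add p f g = PCA.add p (e ≫ f) (e ≫ g)
  add_comp : ∀ {X Y Z : C} (p : OI) (f g : X ⟶ Y) (h : Y ⟶ Z),
    PCA.add p f g ≫ h = PCA.add p (f ≫ h) (g ≫ h)
  comp_star : ∀ {X Y Z : C} (f : X ⟶ Y), f ≫ (PCA.star : Y ⟶ Z) = PCA.star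
  star_comp : ∀ {X Y Z : C} (f : Y ⟶ Z), (PCA.star : X ⟶ Y) ≫ f = PCA.star

attribute [instance, reducible] PCAEnriched.pca

section Convex

variable (C : Type u) [Category.{v} C] [PCAEnriched C]

/-- `Z` with `π₁`, `π₂` is a convex product of `X₁` and `X₂`. -/
def IsConvexProduct {C : Type u} [Category.{v} C] [PCAEnriched C] {X₁ X₂ Z : C}
    (π₁ : Z ⟶ X₁) (π₂ : Z ⟶ X₂) : Prop :=
  ∀ p₁ p₂ : ℝ, 0 ≤ p₁ → 0 ≤ p₂ → p₁ + p₂ ≤ 1 → ∀ (A : C) (f : A ⟶ X₁) (g : A ⟶ X₂),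
    ∃! h : A ⟶ Z, h ≫ π₁ = PCA.smul p₁ f ∧ h ≫ π₂ = PCA.smul p₂ g

/-- Convex biproduct categories: PCA-enriched categories with a zero object and, for all
`X₁`, `X₂`, an object that is both a coproduct and a convex product, compatibly.
(These objects are determined up to isomorphism by the coproduct property, and the `πⱼ` by the
equations `ιᵢ ≫ πⱼ = δᵢⱼ`; morphisms do not depend on a choice of them.) -/
class IsConvexBiproductCategory : Prop where
  exists_zero : ∃ Z : C, Limits.IsZero Z
  exists_convexBiproduct : ∀ X₁ X₂ : C,
    ∃ (Z : C) (ι₁ : X₁ ⟶ Z) (ι₂ : X₂ ⟶ Z) (π₁ : Z ⟶ X₁) (π₂ : Z ⟶ X₂),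
      Nonempty (Limits.IsColimit (Limits.BinaryCofan.mk ι₁ ι₂)) ∧
      IsConvexProduct π₁ π₂ ∧
      ι₁ ≫ π₁ = 𝟙 X₁ ∧ ι₁ ≫ π₂ = PCA.star ∧ ι₂ ≫ π₁ = PCA.star ∧ ι₂ ≫ π₂ = 𝟙 X₂

end Convex

/-- Morphisms of convex biproduct categories: PCA-enriched functors that preserve finite
coproducts. -/
structure CBFunctor (C : Type u) [Category.{v} C] [PCAEnriched C] [IsConvexBiproductCategory C]
    (D : Type u') [Category.{v'} D] [PCAEnriched D] [IsConvexBiproductCategory D] where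
  functor : C ⥤ D
  map_star : ∀ X Y : C, functor.map (PCA.star : X ⟶ Y) = PCA.star
  map_add : ∀ {X Y : C} (p : OI) (f g : X ⟶ Y),
    functor.map (PCA.add p f g) = PCA.add p (functor.map f) (functor.map g)
  preservesFiniteCoproducts : Limits.PreservesFiniteCoproducts functor

/-- An isomorphism in the category of convex biproduct categories: two morphisms whose
composites are equal to the identity functors. -/
structure CBIso (C : Type u) [Category.{v} C] [PCAEnriched C] [IsConvexBiproductCategory C]
    (D : Type u') [Category.{v'} D] [PCAEnriched D] [IsConvexBiproductCategory D] where
  hom : CBFunctor C D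
  inv : CBFunctor D C
  hom_inv_id : hom.functor ⋙ inv.functor = 𝟭 C
  inv_hom_id : inv.functor ⋙ hom.functor = 𝟭 D

/-! ### Subdistributions -/

/-- Finitely supported probability subdistributions on `X`. -/
@[ext]
structure SubDist (X : Type w) where
  val : X →₀ ℝ
  nonneg : ∀ x, 0 ≤ val x
  sum_le : (val.sum fun _ a => a) ≤ 1

/-- The total mass, as a linear map. -/
def mass (X : Type w) : (X →₀ ℝ) →ₗ[ℝ] ℝ := Finsupp.linearCombination ℝ (fun _ => (1 : ℝ))

theorem mass_apply {X : Type w} (d : X →₀ ℝ) : mass X d = d.sum fun _ a => a := by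
  simp [mass, Finsupp.linearCombination_apply]

theorem SubDist.mass_le {X : Type w} (d : SubDist X) : mass X d.val ≤ 1 := by
  rw [mass_apply]; exact d.sum_le

theorem SubDist.mass_nonneg {X : Type w} (d : SubDist X) : 0 ≤ mass X d.val := by
  rw [mass_apply]; exact Finset.sum_nonneg fun x _ => d.nonneg x

instance SubDist.instPCA (X : Type w) : PCA (SubDist X) where
  star := ⟨0, fun _ => le_rfl, by simp⟩
  add p d₁ d₂ :=
    { val := p.1 • d₁.val + (1 - p.1) • d₂.val
      nonneg := fun x => by
        have h1 := mul_nonneg p.2.1.le (d₁.nonneg x)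
        have h2 := mul_nonneg (sub_nonneg.2 p.2.2.le) (d₂.nonneg x)
        simpa using add_nonneg h1 h2
      sum_le := by
        rw [← mass_apply, map_add, map_smul, map_smul, smul_eq_mul, smul_eq_mul]
        have h1 := mul_le_mul_of_nonneg_left d₁.mass_le p.2.1.le
        have h2 := mul_le_mul_of_nonneg_left d₂.mass_le (sub_nonneg.2 p.2.2.le)
        linarith }
  add_assoc p q x₁ x₂ x₃ := by
    have h : (1 : ℝ) - p.1 * q.1 ≠ 0 := by
      have : p.1 * q.1 < 1 := (OI.tildeFst p q).2.2
      linarith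
    ext x
    simp only [OI.tildeFst, OI.tildeSnd, Finsupp.add_apply, Finsupp.smul_apply, smul_eq_mul]
    field_simp
    ring
  add_comm p x₁ x₂ := by
    ext x
    simp only [OI.compl, Finsupp.add_apply, Finsupp.smul_apply, smul_eq_mul]
    ring
  add_idem p x₁ := by
    ext x
    simp only [Finsupp.add_apply, Finsupp.smul_apply, smul_eq_mul]
    ring

theorem SubDist.star_val {X : Type w} : (PCA.star : SubDist X).val = 0 := rfl

theorem SubDist.add_val {X : Type w} (p : OI) (d e : SubDist X) :
    (PCA.add p d e).val = p.1 • d.val + (1 - p.1) • e.val := rfl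

theorem SubDist.addI_val {X : Type w} (p : ℝ) (h0 : 0 ≤ p) (h1 : p ≤ 1) (d e : SubDist X) :
    (PCA.addI p d e).val = p • d.val + (1 - p) • e.val := by
  unfold PCA.addI
  split_ifs with h h'
  · rfl
  · obtain rfl : p = 0 := le_antisymm h' h0
    simp
  · obtain rfl : p = 1 := by
      by_contra hne
      exact h ⟨not_le.1 h', lt_of_le_of_ne h1 hne⟩
    simp

theorem SubDist.smul_val {X : Type w} (p : ℝ) (h0 : 0 ≤ p) (h1 : p ≤ 1) (d : SubDist X) :
    (PCA.smul p d).val = p • d.val := by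
  simp [PCA.smul, SubDist.addI_val p h0 h1, SubDist.star_val]

theorem SubDist.sum_val {X : Type w} (n : ℕ) (p : Fin n → ℝ) (h0 : ∀ i, 0 ≤ p i)
    (h1 : ∑ i, p i ≤ 1) (x : Fin n → SubDist X) :
    (PCA.sum n p x).val = ∑ i, p i • (x i).val := by
  induction n with
  | zero => simp [PCA.sum, SubDist.star_val]
  | succ n ih =>
    rw [Fin.sum_univ_succ] at h1 ⊢
    have hs : 0 ≤ ∑ i : Fin n, p i.succ := Finset.sum_nonneg fun i _ => h0 _
    have hp : p 0 ≤ 1 := by linarith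
    rw [PCA.sum, SubDist.addI_val _ (h0 0) hp]
    by_cases h : p 0 = 1
    · have hz : ∀ i ∈ Finset.univ, p (Fin.succ i : Fin (n + 1)) = 0 := by
        rw [← Finset.sum_eq_zero_iff_of_nonneg (fun i _ => h0 _)]
        linarith
      rw [Finset.sum_eq_zero (s := Finset.univ) (f := fun i : Fin n => p i.succ • (x i.succ).val)
        (fun i hi => by simp [hz i hi])]
      simp [h]
    · have hlt : 0 < 1 - p 0 := by
        have := lt_of_le_of_ne hp h
        linarith
      rw [ih _ (fun i => by simpa [h] using div_nonneg (h0 i.succ) hlt.le) (by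
        simp only [h, if_false]
        rw [← Finset.sum_div, div_le_one hlt]
        linarith)]
      simp only [h, if_false, Finset.smul_sum, smul_smul]
      congr 1
      refine Finset.sum_congr rfl fun i _ => ?_
      rw [mul_div_cancel₀ _ hlt.ne']

/-! ### The free PCA-enriched category `C⁺` -/

/-- Objects of `C⁺` are those of `C`. -/
structure Plus (C : Type u) where
  obj : C

section PlusCat

variable {C : Type u} [Category.{v} C]

/-- `(d₁ ; d₂)(h) = ∑_{f ; g = h} d₁(f) d₂(g)`. -/
def convolve {X Y Z : C} (d : (X ⟶ Y) →₀ ℝ) (e : (Y ⟶ Z) →₀ ℝ) : (X ⟶ Z) →₀ ℝ :=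
  d.sum fun f a => e.sum fun g b => Finsupp.single (f ≫ g) (a * b)

/-- `convolve` as a bilinear map. -/
def convolveₗ (X Y Z : C) :
    ((X ⟶ Y) →₀ ℝ) →ₗ[ℝ] ((Y ⟶ Z) →₀ ℝ) →ₗ[ℝ] ((X ⟶ Z) →₀ ℝ) :=
  Finsupp.linearCombination ℝ fun f : X ⟶ Y =>
    Finsupp.linearCombination ℝ fun g : Y ⟶ Z => Finsupp.single (f ≫ g) (1 : ℝ)

theorem convolveₗ_apply {X Y Z : C} (d : (X ⟶ Y) →₀ ℝ) (e : (Y ⟶ Z) →₀ ℝ) :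
    convolveₗ X Y Z d e = convolve d e := by
  simp [convolveₗ, convolve, Finsupp.linearCombination_apply, Finsupp.sum, Finset.smul_sum,
    LinearMap.sum_apply]

theorem convolveₗ_single {X Y Z : C} (f : X ⟶ Y) (g : Y ⟶ Z) (a b : ℝ) :
    convolveₗ X Y Z (Finsupp.single f a) (Finsupp.single g b) =
      Finsupp.single (f ≫ g) (a * b) := by
  simp [convolveₗ]

theorem convolveₗ_assoc {W X Y Z : C} (d : (W ⟶ X) →₀ ℝ) (e : (X ⟶ Y) →₀ ℝ)
    (k : (Y ⟶ Z) →₀ ℝ) :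
    convolveₗ W Y Z (convolveₗ W X Y d e) k = convolveₗ W X Z d (convolveₗ X Y Z e k) := by
  induction d using Finsupp.induction_linear with
  | zero => simp
  | add d d' h h' => simp only [map_add, LinearMap.add_apply, h, h']
  | single f a =>
    induction e using Finsupp.induction_linear with
    | zero => simp
    | add d d' h h' => simp only [map_add, LinearMap.add_apply, h, h']
    | single g b =>
      induction k using Finsupp.induction_linear with
      | zero => simp
      | add d d' h h' => simp only [map_add, h, h']
      | single k c => simp only [convolveₗ_single, Category.assoc, mul_assoc]

theorem convolveₗ_id_left {X Y : C} (d : (X ⟶ Y) →₀ ℝ) :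
    convolveₗ X X Y (Finsupp.single (𝟙 X) 1) d = d := by
  induction d using Finsupp.induction_linear with
  | zero => simp
  | add d d' h h' => simp only [map_add, h, h']
  | single f a => simp [convolveₗ_single]

theorem convolveₗ_id_right {X Y : C} (d : (X ⟶ Y) →₀ ℝ) :
    convolveₗ X Y Y d (Finsupp.single (𝟙 Y) 1) = d := by
  induction d using Finsupp.induction_linear with
  | zero => simp
  | add d d' h h' => simp only [map_add, LinearMap.add_apply, h, h']
  | single f a => simp [convolveₗ_single]

theorem mass_convolveₗ {X Y Z : C} (d : (X ⟶ Y) →₀ ℝ) (e : (Y ⟶ Z) →₀ ℝ) :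
    mass _ (convolveₗ X Y Z d e) = mass _ d * mass _ e := by
  induction d using Finsupp.induction_linear with
  | zero => simp
  | add d d' h h' => simp only [map_add, LinearMap.add_apply, h, h', add_mul]
  | single f a =>
    induction e using Finsupp.induction_linear with
    | zero => simp
    | add d d' h h' => simp only [map_add, h, h', mul_add]
    | single g b => rw [convolveₗ_single]; simp [mass, -Finsupp.single_mul]

/-- Composition in `C⁺`. -/
def SubDist.comp {X Y Z : C} (d : SubDist (X ⟶ Y)) (e : SubDist (Y ⟶ Z)) :
    SubDist (X ⟶ Z) where
  val := convolve d.val e.val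
  nonneg h := by
    classical
    simp only [convolve, Finsupp.sum, Finsupp.finsetSum_apply]
    refine Finset.sum_nonneg fun f _ => Finset.sum_nonneg fun g _ => ?_
    rw [Finsupp.single_apply]
    split_ifs
    · exact mul_nonneg (d.nonneg f) (e.nonneg g)
    · exact le_rfl
  sum_le := by
    rw [← mass_apply, ← convolveₗ_apply, mass_convolveₗ]
    exact mul_le_one₀ d.mass_le e.mass_nonneg e.mass_le

/-- The Dirac distribution. -/
def SubDist.dirac {X : Type w} (x : X) : SubDist X where
  val := Finsupp.single x 1
  nonneg y := by
    classical
    rw [Finsupp.single_apply]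
    split_ifs <;> norm_num
  sum_le := by simp

theorem SubDist.comp_val {X Y Z : C} (d : SubDist (X ⟶ Y)) (e : SubDist (Y ⟶ Z)) :
    (d.comp e).val = convolveₗ X Y Z d.val e.val := (convolveₗ_apply _ _).symm

instance Plus.category : Category.{v} (Plus C) where
  Hom X Y := SubDist (X.obj ⟶ Y.obj)
  id X := SubDist.dirac (𝟙 X.obj)
  comp d e := SubDist.comp d e
  id_comp d := SubDist.ext (by
    rw [SubDist.comp_val]; exact convolveₗ_id_left d.val)
  comp_id d := SubDist.ext (by
    rw [SubDist.comp_val]; exact convolveₗ_id_right d.val)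
  assoc d e k := SubDist.ext (by
    simp only [SubDist.comp_val]; exact convolveₗ_assoc d.val e.val k.val)

instance Plus.pcaEnriched : PCAEnriched (Plus C) where
  pca X Y := SubDist.instPCA (X.obj ⟶ Y.obj)
  comp_add p e f g := SubDist.ext (by
    refine (SubDist.comp_val _ _).trans ?_
    refine Eq.trans ?_ (SubDist.add_val p (SubDist.comp e f) (SubDist.comp e g)).symm
    rw [SubDist.comp_val, SubDist.comp_val]
    exact ((convolveₗ _ _ _ e.val).map_add _ _).trans (by rw [map_smul, map_smul]))
  add_comp p f g h := SubDist.ext (by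
    refine (SubDist.comp_val _ _).trans ?_
    refine Eq.trans ?_ (SubDist.add_val p (SubDist.comp f h) (SubDist.comp g h)).symm
    rw [SubDist.comp_val, SubDist.comp_val, SubDist.add_val]
    simp only [map_add, map_smul, LinearMap.add_apply, LinearMap.smul_apply])
  comp_star f := SubDist.ext (by
    refine (SubDist.comp_val _ _).trans ?_
    rw [SubDist.star_val, map_zero]; rfl)
  star_comp f := SubDist.ext (by
    refine (SubDist.comp_val _ _).trans ?_
    rw [SubDist.star_val, map_zero]; rfl)

end PlusCat

/-! ### Stochastic matrices -/

section Matrices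

variable {D : Type u} [Category.{v} D]

/-- An `m × n` matrix of pairs `(p_{ji}, f_{ji})` from the word `P` of length `n` to the word `Q`
of length `m`, all of whose columns are substochastic (so that every `p_{ji}` is in `[0,1]`). -/
structure PreMat (P Q : List D) where
  p : Fin Q.length → Fin P.length → ℝ
  f : ∀ (j : Fin Q.length) (i : Fin P.length), P.get i ⟶ Q.get j
  nonneg : ∀ j i, 0 ≤ p j i
  sum_le : ∀ i, ∑ j, p j i ≤ 1

theorem PreMat.le_one {P Q : List D} (M : PreMat P Q) (j i) : M.p j i ≤ 1 :=
  (Finset.single_le_sum (f := fun j => M.p j i) (fun k _ => M.nonneg k i)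
    (Finset.mem_univ j)).trans (M.sum_le i)

/-- The weight `r_{ui} = ∑ⱼ p'_{uj} p_{ji}` of the product. -/
def PreMat.weight {P Q R : List D} (M : PreMat P Q) (N : PreMat Q R)
    (k : Fin R.length) (i : Fin P.length) : ℝ := ∑ j, N.p k j * M.p j i

theorem PreMat.mul_nonneg {P Q R : List D} (M : PreMat P Q) (N : PreMat Q R)
    (k : Fin R.length) (j : Fin Q.length) (i : Fin P.length) : 0 ≤ N.p k j * M.p j i :=
  _root_.mul_nonneg (N.nonneg k j) (M.nonneg j i)

variable [PCAEnriched D]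

/-- The arrow `M_{ji} = p_{ji} · f_{ji}`. -/
def PreMat.entry {P Q : List D} (M : PreMat P Q) (j : Fin Q.length) (i : Fin P.length) :
    P.get i ⟶ Q.get j := PCA.smul (M.p j i) (M.f j i)

/-- `M ≡ M'` if `p_{ji} · f_{ji} = p'_{ji} · f'_{ji}` for all `j`, `i`. -/
instance PreMat.setoid (P Q : List D) : Setoid (PreMat P Q) where
  r M N := ∀ j i, M.entry j i = N.entry j i
  iseqv := ⟨fun _ _ _ => rfl, fun h j i => (h j i).symm, fun h h' j i => (h j i).trans (h' j i)⟩

open Classical in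
/-- The identity matrix. -/
def PreMat.id (P : List D) : PreMat P P where
  p j i := if i = j then 1 else 0
  f j i := if h : i = j then eqToHom (congrArg P.get h) else PCA.star
  nonneg j i := by split_ifs <;> norm_num
  sum_le i := by simp

/-- The matrix product (in diagrammatic order, `M` followed by `N`): its `(k,i)`-entry is
`r_{ki} · ∑ⱼ (p'_{kj} p_{ji} / r_{ki}) · (f_{ji} ; f'_{kj})`. -/
def PreMat.comp {P Q R : List D} (M : PreMat P Q) (N : PreMat Q R) : PreMat P R where
  p k i := M.weight N k i
  f k i := PCA.sum Q.length (fun j => N.p k j * M.p j i / M.weight N k i)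
    (fun j => M.f j i ≫ N.f k j)
  nonneg k i := Finset.sum_nonneg fun j _ => M.mul_nonneg N k j i
  sum_le i := by
    unfold PreMat.weight
    rw [Finset.sum_comm]
    refine le_trans (Finset.sum_le_sum (g := fun j => M.p j i) fun j _ => ?_) (M.sum_le i)
    rw [← Finset.sum_mul]
    exact mul_le_of_le_one_left (M.nonneg j i) (N.sum_le j)

/-- The null matrix. -/
def PreMat.star (P Q : List D) : PreMat P Q where
  p _ _ := 0
  f _ _ := PCA.star
  nonneg _ _ := le_rfl
  sum_le _ := by simp

/-- The matrix `M +_p N`, with `(j,i)`-entry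
`r · ((p p_{ji} / r) · f_{ji} + ((1-p) p'_{ji} / r) · f'_{ji})` for
`r = p p_{ji} + (1-p) p'_{ji}`; this arrow is `M_{ji} +_p N_{ji}`. -/
def PreMat.add {P Q : List D} (p : OI) (M N : PreMat P Q) : PreMat P Q where
  p j i := p.1 * M.p j i + (1 - p.1) * N.p j i
  f j i := PCA.addI (p.1 * M.p j i / (p.1 * M.p j i + (1 - p.1) * N.p j i)) (M.f j i) (N.f j i)
  nonneg j i := add_nonneg (_root_.mul_nonneg p.2.1.le (M.nonneg j i))
    (_root_.mul_nonneg (sub_nonneg.2 p.2.2.le) (N.nonneg j i))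
  sum_le i := by
    rw [Finset.sum_add_distrib, ← Finset.mul_sum, ← Finset.mul_sum]
    have h1 := mul_le_mul_of_nonneg_left (M.sum_le i) p.2.1.le
    have h2 := mul_le_mul_of_nonneg_left (N.sum_le i) (sub_nonneg.2 p.2.2.le)
    linarith

end Matrices

/-- Objects of `StMat(D)` are words of objects of `D`. -/
structure StMat (D : Type u) where
  word : List D

section StMatPlus

variable {C : Type u} [Category.{v} C]

/-- The subdistribution (as a function) at the place `(j,i)` of a matrix over `C⁺`. -/
def PreMat.val {P Q : List (Plus C)} (M : PreMat P Q) (j : Fin Q.length) (i : Fin P.length) :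
    ((P.get i).obj ⟶ (Q.get j).obj) →₀ ℝ := M.p j i • SubDist.val (M.f j i)

theorem PreMat.entry_val {P Q : List (Plus C)} (M : PreMat P Q) (j i) :
    SubDist.val (M.entry j i) = M.val j i :=
  SubDist.smul_val _ (M.nonneg j i) (M.le_one j i) _

theorem PreMat.equiv_iff {P Q : List (Plus C)} (M N : PreMat P Q) :
    M ≈ N ↔ ∀ j i, M.val j i = N.val j i := by
  refine forall_congr' fun j => forall_congr' fun i => ?_
  rw [← PreMat.entry_val, ← PreMat.entry_val]
  exact ⟨fun h => congrArg SubDist.val h, fun h => SubDist.ext h⟩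

theorem PreMat.comp_val {P Q R : List (Plus C)} (M : PreMat P Q) (N : PreMat Q R) (k i) :
    (M.comp N).val k i = ∑ j, convolveₗ _ _ _ (M.val j i) (N.val k j) := by
  have hr : 0 ≤ M.weight N k i := (M.comp N).nonneg k i
  have hsum : ∑ j, N.p k j * M.p j i / M.weight N k i ≤ 1 := by
    rw [← Finset.sum_div]
    exact div_self_le_one (M.weight N k i)
  have h := SubDist.sum_val Q.length (fun j => N.p k j * M.p j i / M.weight N k i)
    (fun j => div_nonneg (M.mul_nonneg N k j i) hr) hsum
    (fun j => SubDist.comp (M.f j i) (N.f k j))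
  have h' : (M.comp N).val k i = M.weight N k i • ∑ j,
      (N.p k j * M.p j i / M.weight N k i) • (SubDist.comp (M.f j i) (N.f k j)).val :=
    congrArg (fun z => M.weight N k i • z) h
  rw [h', Finset.smul_sum]
  refine Finset.sum_congr rfl fun j _ => ?_
  simp only [PreMat.val]
  rw [SubDist.comp_val, smul_smul]
  refine Eq.trans ?_ ((convolveₗ _ _ _ _).map_smul _ _).symm
  refine Eq.trans ?_ (congrArg (fun z => N.p k j • z) (LinearMap.map_smul₂ _ _ _ _).symm)
  rw [smul_smul]
  congr 1
  by_cases h0 : M.weight N k i = 0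
  · have := (Finset.sum_eq_zero_iff_of_nonneg (fun j _ => M.mul_nonneg N k j i)).1 h0 j
      (Finset.mem_univ j)
    rw [h0, zero_mul, this]
  · rw [mul_div_cancel₀ _ h0]

theorem PreMat.star_val {P Q : List (Plus C)} (j i) : (PreMat.star P Q).val j i = 0 := by
  simp [PreMat.val, PreMat.star]

theorem PreMat.add_val {P Q : List (Plus C)} (p : OI) (M N : PreMat P Q) (j i) :
    (PreMat.add p M N).val j i = p.1 • M.val j i + (1 - p.1) • N.val j i := by
  have ha : 0 ≤ p.1 * M.p j i := _root_.mul_nonneg p.2.1.le (M.nonneg j i)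
  have hb : 0 ≤ (1 - p.1) * N.p j i := _root_.mul_nonneg (sub_nonneg.2 p.2.2.le) (N.nonneg j i)
  have hr : 0 ≤ p.1 * M.p j i + (1 - p.1) * N.p j i := add_nonneg ha hb
  have h := SubDist.addI_val (p.1 * M.p j i / (p.1 * M.p j i + (1 - p.1) * N.p j i))
    (div_nonneg ha hr) (div_le_one_of_le₀ (by linarith) hr) (M.f j i) (N.f j i)
  have h' := congrArg (fun z => (p.1 * M.p j i + (1 - p.1) * N.p j i) • z) h
  refine Eq.trans h' ?_
  simp only [PreMat.val]
  rw [smul_add, smul_smul, smul_smul, smul_smul, smul_smul]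
  by_cases h0 : p.1 * M.p j i + (1 - p.1) * N.p j i = 0
  · have h1 : p.1 * M.p j i = 0 := by linarith
    have h2 : (1 - p.1) * N.p j i = 0 := by linarith
    simp [h1, h2]
  · congr 2
    · rw [mul_div_cancel₀ _ h0]
    · field_simp
      ring

theorem PreMat.id_val_self (P : List (Plus C)) (i : Fin P.length) :
    (PreMat.id P).val i i = Finsupp.single (𝟙 (P.get i).obj) 1 := by
  have h : (PreMat.id P).f i i = 𝟙 (P.get i) := by simp [PreMat.id]
  unfold PreMat.val
  rw [h]
  simp only [PreMat.id, if_true, one_smul]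
  rfl

theorem PreMat.id_val_ne (P : List (Plus C)) {j i : Fin P.length} (h : i ≠ j) :
    (PreMat.id P).val j i = 0 := by
  simp [PreMat.val, PreMat.id, h]

/-- The category `StMat(C⁺)`: arrows are matrices up to `≡`. -/
instance StMat.category : Category.{v} (StMat (Plus C)) where
  Hom P Q := Quotient (PreMat.setoid P.word Q.word)
  id P := Quotient.mk _ (PreMat.id P.word)
  comp := Quotient.map₂ PreMat.comp (by
    intro M M' hM N N' hN
    rw [PreMat.equiv_iff] at hM hN ⊢
    intro k i
    simp only [PreMat.comp_val, hM, hN])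
  id_comp := by
    rintro P Q ⟨M⟩
    refine Quotient.sound ((PreMat.equiv_iff _ _).2 fun k i => ?_)
    rw [PreMat.comp_val, Finset.sum_eq_single i]
    · rw [PreMat.id_val_self, convolveₗ_id_left]
    · intro j _ hj
      rw [PreMat.id_val_ne _ hj.symm, map_zero, LinearMap.zero_apply]
    · simp
  comp_id := by
    rintro P Q ⟨M⟩
    refine Quotient.sound ((PreMat.equiv_iff _ _).2 fun k i => ?_)
    rw [PreMat.comp_val, Finset.sum_eq_single k]
    · rw [PreMat.id_val_self, convolveₗ_id_right]
    · intro j _ hj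
      rw [PreMat.id_val_ne _ hj, map_zero]
    · simp
  assoc := by
    rintro P Q R S ⟨M⟩ ⟨N⟩ ⟨O⟩
    refine Quotient.sound ((PreMat.equiv_iff _ _).2 fun l i => ?_)
    simp only [PreMat.comp_val, map_sum, LinearMap.sum_apply, convolveₗ_assoc]
    rw [Finset.sum_comm]

/-- The entrywise PCA-enrichment of `StMat(C⁺)`. -/
instance StMat.pca (P Q : StMat (Plus C)) : PCA (P ⟶ Q) where
  star := Quotient.mk _ (PreMat.star P.word Q.word)
  add p := Quotient.map₂ (PreMat.add p) (by
    intro M M' hM N N' hN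
    rw [PreMat.equiv_iff] at hM hN ⊢
    intro k i
    simp only [PreMat.add_val, hM, hN])
  add_assoc := by
    rintro p q ⟨M⟩ ⟨N⟩ ⟨O⟩
    refine Quotient.sound ((PreMat.equiv_iff _ _).2 fun j i => ?_)
    have h : (1 : ℝ) - p.1 * q.1 ≠ 0 := by
      have : p.1 * q.1 < 1 := (OI.tildeFst p q).2.2
      linarith
    ext x
    simp only [PreMat.add_val, OI.tildeFst, OI.tildeSnd, Finsupp.add_apply, Finsupp.smul_apply,
      smul_eq_mul]
    field_simp
    ring
  add_comm := by
    rintro p ⟨M⟩ ⟨N⟩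
    refine Quotient.sound ((PreMat.equiv_iff _ _).2 fun j i => ?_)
    ext x
    simp only [PreMat.add_val, OI.compl, Finsupp.add_apply, Finsupp.smul_apply, smul_eq_mul]
    ring
  add_idem := by
    rintro p ⟨M⟩
    refine Quotient.sound ((PreMat.equiv_iff _ _).2 fun j i => ?_)
    ext x
    simp only [PreMat.add_val, Finsupp.add_apply, Finsupp.smul_apply, smul_eq_mul]
    ring

instance StMat.pcaEnriched : PCAEnriched (StMat (Plus C)) where
  pca := StMat.pca
  comp_add := by
    rintro P Q R p ⟨M⟩ ⟨N⟩ ⟨O⟩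
    refine Quotient.sound ((PreMat.equiv_iff _ _).2 fun j i => ?_)
    simp only [PreMat.add_val, PreMat.comp_val, map_add, map_smul, Finset.sum_add_distrib,
      Finset.smul_sum]
  add_comp := by
    rintro P Q R p ⟨M⟩ ⟨N⟩ ⟨O⟩
    refine Quotient.sound ((PreMat.equiv_iff _ _).2 fun j i => ?_)
    simp only [PreMat.add_val, PreMat.comp_val, map_add, map_smul, Finset.sum_add_distrib,
      Finset.smul_sum, LinearMap.add_apply, LinearMap.smul_apply]
  comp_star := by
    rintro P Q R ⟨M⟩
    refine Quotient.sound ((PreMat.equiv_iff _ _).2 fun j i => ?_)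
    simp only [PreMat.star_val, PreMat.comp_val, map_zero, Finset.sum_const_zero]
  star_comp := by
    rintro P Q R ⟨M⟩
    refine Quotient.sound ((PreMat.equiv_iff _ _).2 fun j i => ?_)
    simp only [PreMat.star_val, PreMat.comp_val, map_zero, LinearMap.zero_apply,
      Finset.sum_const_zero]

end StMatPlus

/-! ### Probabilistic tapes -/

section Tapes

variable (C : Type u) [Category.{v} C]

/-- Raw terms. -/
inductive Term : Type max u v where
  | split (p : OI) (U : C) : Term
  | discard (U : C) : Term
  | tape {U V : C} (c : U ⟶ V) : Term
  | cobang (U : C) : Term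
  | merge (U : C) : Term
  | idOne (U : C) : Term
  | idZero : Term
  | swap (U V : C) : Term
  | seq (s t : Term) : Term
  | par (s t : Term) : Term

variable {C}

namespace Term

/-- The typing rules: `HasType t P Q` means `t : P → Q`. -/
inductive HasType : Term C → List C → List C → Prop
  | split (p : OI) (U : C) : HasType (split p U) [U] [U, U]
  | discard (U : C) : HasType (discard U) [U] []
  | tape {U V : C} (c : U ⟶ V) : HasType (tape c) [U] [V]
  | cobang (U : C) : HasType (cobang U) [] [U]
  | merge (U : C) : HasType (merge U) [U, U] [U]
  | idOne (U : C) : HasType (idOne U) [U] [U]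
  | idZero : HasType idZero [] []
  | swap (U V : C) : HasType (swap U V) [U, V] [V, U]
  | seq {s t : Term C} {P Q R : List C} :
      HasType s P Q → HasType t Q R → HasType (seq s t) P R
  | par {s t : Term C} {P₁ Q₁ P₂ Q₂ : List C} :
      HasType s P₁ Q₁ → HasType t P₂ Q₂ → HasType (par s t) (P₁ ++ P₂) (Q₁ ++ Q₂)

/-- `id_P`. -/
def idW : List C → Term C
  | [] => idZero
  | U :: P => par (idOne U) (idW P)

/-- `!_P`. -/
def discardW : List C → Term C
  | [] => idZero
  | U :: P => par (discard U) (discardW P)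

/-- `?_P`. -/
def cobangW : List C → Term C
  | [] => idZero
  | U :: P => par (cobang U) (cobangW P)

/-- `σ_{U,Q} : U ⊕ Q → Q ⊕ U`. -/
def swapOne (U : C) : List C → Term C
  | [] => idOne U
  | V :: Q => seq (par (swap U V) (idW Q)) (par (idOne V) (swapOne U Q))

/-- `σ_{P,Q} : P ⊕ Q → Q ⊕ P`. -/
def swapW : List C → List C → Term C
  | [], Q => idW Q
  | U :: P, Q => seq (par (idOne U) (swapW P Q)) (par (swapOne U Q) (idW P))

/-- The `p`-split of a word,
with `split_{U ⊕ P} = (split_U ⊕ split_P) ; (id_U ⊕ σ_{U,P} ⊕ id_P)`. -/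
def splitW (p : OI) : List C → Term C
  | [] => idZero
  | U :: P => seq (par (split p U) (splitW p P)) (par (idOne U) (par (swapOne U P) (idW P)))

/-- The merge of a word,
with `merge_{U ⊕ P} = (id_U ⊕ σ_{P,U} ⊕ id_P) ; (merge_U ⊕ merge_P)`. -/
def mergeW : List C → Term C
  | [] => idZero
  | U :: P => seq (par (idOne U) (par (swapW P [U]) (idW P))) (par (merge U) (mergeW P))

/-- The congruence on typed terms generated by the axioms: `Eqv P Q s t` means `s = t : P → Q`.
The coherence axioms for the empty word (`?_0`, `merge_0`, `split_0` and `!_0` are `id_0`) hold by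
definition. -/
inductive Eqv : List C → List C → Term C → Term C → Prop
  | refl {P Q s} : HasType s P Q → Eqv P Q s s
  | symm {P Q s t} : Eqv P Q s t → Eqv P Q t s
  | trans {P Q s t r} : Eqv P Q s t → Eqv P Q t r → Eqv P Q s r
  | seq_congr {P Q R s s' t t'} :
      Eqv P Q s s' → Eqv Q R t t' → Eqv P R (seq s t) (seq s' t')
  | par_congr {P₁ Q₁ P₂ Q₂ s s' t t'} :
      Eqv P₁ Q₁ s s' → Eqv P₂ Q₂ t t' → Eqv (P₁ ++ P₂) (Q₁ ++ Q₂) (par s t) (par s' t')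
  -- strict symmetric monoidal categories
  | seq_assoc {P Q R S f g h} : HasType f P Q → HasType g Q R → HasType h R S →
      Eqv P S (seq (seq f g) h) (seq f (seq g h))
  | id_seq {P Q f} : HasType f P Q → Eqv P Q (seq (idW P) f) f
  | seq_id {P Q f} : HasType f P Q → Eqv P Q (seq f (idW Q)) f
  | interchange {P₁ Q₁ R₁ P₂ Q₂ R₂ f₁ g₁ f₂ g₂} :
      HasType f₁ P₁ Q₁ → HasType g₁ Q₁ R₁ → HasType f₂ P₂ Q₂ → HasType g₂ Q₂ R₂ →
      Eqv (P₁ ++ P₂) (R₁ ++ R₂) (seq (par f₁ f₂) (par g₁ g₂)) (par (seq f₁ g₁) (seq f₂ g₂))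
  | zero_par {P Q f} : HasType f P Q → Eqv P Q (par idZero f) f
  | par_zero {P Q f} : HasType f P Q → Eqv P Q (par f idZero) f
  | par_assoc {P₁ Q₁ P₂ Q₂ P₃ Q₃ f g h} :
      HasType f P₁ Q₁ → HasType g P₂ Q₂ → HasType h P₃ Q₃ →
      Eqv (P₁ ++ (P₂ ++ P₃)) (Q₁ ++ (Q₂ ++ Q₃)) (par (par f g) h) (par f (par g h))
  | swap_swap (P Q) : Eqv (P ++ Q) (P ++ Q) (seq (swapW P Q) (swapW Q P)) (idW (P ++ Q))
  | swap_nat {P Q s} (R) : HasType s P Q →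
      Eqv (P ++ R) (R ++ Q) (seq (par s (idW R)) (swapW Q R)) (seq (swapW P R) (par (idW R) s))
  -- functoriality of `tape`
  | tape_id (U : C) : Eqv [U] [U] (tape (𝟙 U)) (idOne U)
  | tape_comp {U V W : C} (c : U ⟶ V) (d : V ⟶ W) :
      Eqv [U] [W] (tape (c ≫ d)) (seq (tape c) (tape d))
  -- natural and coherent monoids
  | merge_assoc (P) : Eqv (P ++ (P ++ P)) P
      (seq (par (idW P) (mergeW P)) (mergeW P)) (seq (par (mergeW P) (idW P)) (mergeW P))
  | merge_unit (P) : Eqv P P (seq (par (cobangW P) (idW P)) (mergeW P)) (idW P)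
  | merge_comm (P) : Eqv (P ++ P) P (seq (swapW P P) (mergeW P)) (mergeW P)
  | cobang_coh (P Q) : Eqv [] (P ++ Q) (cobangW (P ++ Q)) (par (cobangW P) (cobangW Q))
  | merge_coh (P Q) : Eqv ((P ++ Q) ++ (P ++ Q)) (P ++ Q) (mergeW (P ++ Q))
      (seq (par (idW P) (par (swapW Q P) (idW Q))) (par (mergeW P) (mergeW Q)))
  | cobang_nat {P Q f} : HasType f P Q → Eqv [] Q (seq (cobangW P) f) (cobangW Q)
  | merge_nat {P Q f} : HasType f P Q →
      Eqv (P ++ P) Q (seq (mergeW P) f) (seq (par f f) (mergeW Q))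
  -- natural and coherent co-pcas
  | split_assoc (p q : OI) (P) : Eqv P (P ++ (P ++ P))
      (seq (splitW p P) (par (splitW q P) (idW P)))
      (seq (splitW (OI.tildeFst p q) P) (par (idW P) (splitW (OI.tildeSnd p q) P)))
  | split_idem (p : OI) (P) : Eqv P P (seq (splitW p P) (mergeW P)) (idW P)
  | split_comm (p : OI) (P) : Eqv P (P ++ P) (seq (splitW p P) (swapW P P)) (splitW p.compl P)
  | discard_coh (P Q) : Eqv (P ++ Q) [] (discardW (P ++ Q)) (par (discardW P) (discardW Q))
  | split_coh (p : OI) (P Q) : Eqv (P ++ Q) ((P ++ Q) ++ (P ++ Q)) (splitW p (P ++ Q))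
      (seq (par (splitW p P) (splitW p Q)) (par (idW P) (par (swapW P Q) (idW Q))))
  | discard_nat {P Q f} : HasType f P Q → Eqv P [] (seq f (discardW Q)) (discardW P)
  | split_nat {P Q f} (p : OI) : HasType f P Q →
      Eqv P (Q ++ Q) (seq f (splitW p Q)) (seq (splitW p P) (par f f))

theorem hasType_idW : ∀ P : List C, HasType (idW P) P P
  | [] => .idZero
  | U :: P => .par (.idOne U) (hasType_idW P)

theorem hasType_discardW : ∀ P : List C, HasType (discardW P) P []
  | [] => .idZero
  | U :: P => .par (.discard U) (hasType_discardW P)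

theorem hasType_cobangW : ∀ P : List C, HasType (cobangW P) [] P
  | [] => .idZero
  | U :: P => .par (.cobang U) (hasType_cobangW P)

theorem HasType.of_eq {t : Term C} {P Q P' Q' : List C} (h : HasType t P Q) (hP : P = P')
    (hQ : Q = Q') : HasType t P' Q' := by
  subst hP; subst hQ; exact h

theorem hasType_swapOne (U : C) : ∀ Q : List C, HasType (swapOne U Q) ([U] ++ Q) (Q ++ [U])
  | [] => .idOne U
  | V :: Q =>
    have h₁ : HasType (par (swap U V) (idW Q)) ([U, V] ++ Q) ([V, U] ++ Q) :=
      .par (.swap U V) (hasType_idW Q)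
    have h₂ : HasType (par (idOne V) (swapOne U Q)) ([V] ++ ([U] ++ Q)) ([V] ++ (Q ++ [U])) :=
      .par (.idOne V) (hasType_swapOne U Q)
    .seq h₁ h₂

theorem hasType_swapW : ∀ P Q : List C, HasType (swapW P Q) (P ++ Q) (Q ++ P)
  | [], Q => (hasType_idW Q).of_eq rfl (by simp)
  | U :: P, Q =>
    have h₁ : HasType (par (idOne U) (swapW P Q)) ([U] ++ (P ++ Q)) ([U] ++ (Q ++ P)) :=
      .par (.idOne U) (hasType_swapW P Q)
    .seq h₁ ((HasType.par (hasType_swapOne U Q) (hasType_idW P)).of_eq (by simp) (by simp))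

theorem hasType_splitW (p : OI) : ∀ P : List C, HasType (splitW p P) P (P ++ P)
  | [] => .idZero
  | U :: P => .seq (P := [U] ++ P) (Q := [U, U] ++ (P ++ P))
      (.par (.split p U) (hasType_splitW p P))
      ((HasType.par (.idOne U) (.par (hasType_swapOne U P) (hasType_idW P))).of_eq
        (by simp) (by simp))

theorem hasType_mergeW : ∀ P : List C, HasType (mergeW P) (P ++ P) P
  | [] => .idZero
  | U :: P => .seq (Q := [U, U] ++ (P ++ P)) (R := [U] ++ P)
      ((HasType.par (.idOne U) (.par (hasType_swapW P [U]) (hasType_idW P))).of_eq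
        (by simp) (by simp))
      (.par (.merge U) (hasType_mergeW P))

/-- Provably equal terms are typable with the given type. -/
theorem Eqv.hasType {P Q : List C} {s t : Term C} (h : Eqv P Q s t) :
    HasType s P Q ∧ HasType t P Q := by
  induction h with
  | refl h => exact ⟨h, h⟩
  | symm _ ih => exact ih.symm
  | trans _ _ ih₁ ih₂ => exact ⟨ih₁.1, ih₂.2⟩
  | seq_congr _ _ ih₁ ih₂ => exact ⟨.seq ih₁.1 ih₂.1, .seq ih₁.2 ih₂.2⟩
  | par_congr _ _ ih₁ ih₂ => exact ⟨.par ih₁.1 ih₂.1, .par ih₁.2 ih₂.2⟩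
  | seq_assoc hf hg hh => exact ⟨.seq (.seq hf hg) hh, .seq hf (.seq hg hh)⟩
  | id_seq h => exact ⟨.seq (hasType_idW _) h, h⟩
  | seq_id h => exact ⟨.seq h (hasType_idW _), h⟩
  | interchange h₁ k₁ h₂ k₂ =>
    exact ⟨.seq (.par h₁ h₂) (.par k₁ k₂), .par (.seq h₁ k₁) (.seq h₂ k₂)⟩
  | zero_par h => exact ⟨.par .idZero h, h⟩
  | par_zero h => exact ⟨(HasType.par h .idZero).of_eq (by simp) (by simp), h⟩
  | par_assoc hf hg hh =>
    exact ⟨(HasType.par (.par hf hg) hh).of_eq (by simp) (by simp), .par hf (.par hg hh)⟩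
  | swap_swap P Q => exact ⟨.seq (hasType_swapW P Q) (hasType_swapW Q P), hasType_idW _⟩
  | swap_nat R h =>
    exact ⟨.seq (.par h (hasType_idW R)) (hasType_swapW _ R),
      .seq (hasType_swapW _ R) (.par (hasType_idW R) h)⟩
  | tape_id U => exact ⟨.tape _, .idOne U⟩
  | tape_comp c d => exact ⟨.tape _, .seq (.tape c) (.tape d)⟩
  | merge_assoc P =>
    exact ⟨.seq (.par (hasType_idW P) (hasType_mergeW P)) (hasType_mergeW P),
      .seq ((HasType.par (hasType_mergeW P) (hasType_idW P)).of_eq (by simp) rfl)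
        (hasType_mergeW P)⟩
  | merge_unit P =>
    exact ⟨.seq (.par (hasType_cobangW P) (hasType_idW P)) (hasType_mergeW P), hasType_idW P⟩
  | merge_comm P => exact ⟨.seq (hasType_swapW P P) (hasType_mergeW P), hasType_mergeW P⟩
  | cobang_coh P Q =>
    exact ⟨hasType_cobangW _, .par (hasType_cobangW P) (hasType_cobangW Q)⟩
  | merge_coh P Q =>
    refine ⟨hasType_mergeW _, .seq (Q := (P ++ P) ++ (Q ++ Q)) ?_
      (.par (hasType_mergeW P) (hasType_mergeW Q))⟩
    exact (HasType.par (hasType_idW P) (.par (hasType_swapW Q P) (hasType_idW Q))).of_eq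
      (by simp) (by simp)
  | cobang_nat h => exact ⟨.seq (hasType_cobangW _) h, hasType_cobangW _⟩
  | merge_nat h =>
    exact ⟨.seq (hasType_mergeW _) h, .seq (.par h h) (hasType_mergeW _)⟩
  | split_assoc p q P =>
    exact ⟨.seq (hasType_splitW p P)
        ((HasType.par (hasType_splitW q P) (hasType_idW P)).of_eq rfl (by simp)),
      .seq (hasType_splitW _ P) (.par (hasType_idW P) (hasType_splitW _ P))⟩
  | split_idem p P => exact ⟨.seq (hasType_splitW p P) (hasType_mergeW P), hasType_idW P⟩
  | split_comm p P =>
    exact ⟨.seq (hasType_splitW p P) (hasType_swapW P P), hasType_splitW _ P⟩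
  | discard_coh P Q =>
    exact ⟨hasType_discardW _, .par (hasType_discardW P) (hasType_discardW Q)⟩
  | split_coh p P Q =>
    refine ⟨hasType_splitW p _, .seq (Q := (P ++ P) ++ (Q ++ Q))
      (.par (hasType_splitW p P) (hasType_splitW p Q)) ?_⟩
    exact (HasType.par (hasType_idW P) (.par (hasType_swapW P Q) (hasType_idW Q))).of_eq
      (by simp) (by simp)
  | discard_nat h => exact ⟨.seq h (hasType_discardW _), hasType_discardW _⟩
  | split_nat p h =>
    exact ⟨.seq h (hasType_splitW p _), .seq (hasType_splitW p _) (.par h h)⟩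

/-- Typed terms `P → Q` modulo the axioms. -/
instance setoid (P Q : List C) : Setoid {t : Term C // HasType t P Q} where
  r s t := Eqv P Q s.1 t.1
  iseqv := ⟨fun s => .refl s.2, fun h => h.symm, fun h k => h.trans k⟩

/-- `split_p ; (s ⊕ t) ; merge`. -/
def add (p : OI) (P Q : List C) (s t : Term C) : Term C :=
  seq (seq (splitW p P) (par s t)) (mergeW Q)

/-- `!_P ; ?_Q`. -/
def star (P Q : List C) : Term C := seq (discardW P) (cobangW Q)

theorem hasType_add (p : OI) {P Q : List C} {s t : Term C} (hs : HasType s P Q)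
    (ht : HasType t P Q) : HasType (add p P Q s t) P Q :=
  .seq (.seq (hasType_splitW p P) (.par hs ht)) (hasType_mergeW Q)

theorem hasType_star (P Q : List C) : HasType (star P Q) P Q :=
  .seq (hasType_discardW P) (hasType_cobangW Q)

theorem Eqv.of_eq {s t : Term C} {P Q P' Q' : List C} (h : Eqv P Q s t) (hP : P = P')
    (hQ : Q = Q') : Eqv P' Q' s t := by
  subst hP; subst hQ; exact h

/-- Naturality of symmetries in the second argument. -/
theorem swap_nat' {P Q s} (R : List C) (hs : HasType s P Q) :
    Eqv (R ++ P) (Q ++ R) (seq (par (idW R) s) (swapW R Q)) (seq (swapW R P) (par s (idW R))) := by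
  have hi := hasType_idW R
  have h1 := HasType.par hi hs
  have h2 := HasType.par hs hi
  have a := hasType_swapW R P
  have b := hasType_swapW P R
  have c := hasType_swapW R Q
  have d := hasType_swapW Q R
  -- insert `σ ; σ` in front, use naturality, and cancel `σ ; σ` at the end
  have e1 : Eqv (R ++ P) (Q ++ R) (seq (par (idW R) s) (swapW R Q))
      (seq (seq (swapW R P) (swapW P R)) (seq (par (idW R) s) (swapW R Q))) :=
    (Eqv.id_seq (.seq h1 c)).symm.trans
      (.seq_congr (Eqv.swap_swap R P).symm (.refl (.seq h1 c)))
  have e2 : Eqv (P ++ R) (Q ++ R) (seq (swapW P R) (seq (par (idW R) s) (swapW R Q)))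
      (par s (idW R)) :=
    (Eqv.seq_assoc b h1 c).symm.trans <|
      (Eqv.seq_congr (Eqv.swap_nat R hs).symm (.refl c)).trans <|
      (Eqv.seq_assoc h2 d c).trans <|
      (Eqv.seq_congr (.refl h2) (Eqv.swap_swap Q R)).trans (Eqv.seq_id h2)
  exact e1.trans ((Eqv.seq_assoc a b (.seq h1 c)).trans (.seq_congr (.refl a) e2))

theorem swap_nat₂ {P Q P' Q' s t} (hs : HasType s P Q) (ht : HasType t P' Q') :
    Eqv (P ++ P') (Q' ++ Q) (seq (par s t) (swapW Q Q'))
      (seq (swapW P P') (par (t : Term C) s)) := by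
  have hP := hasType_idW P
  have hQ := hasType_idW Q
  have hP' := hasType_idW P'
  have hQ' := hasType_idW Q'
  have e1 : Eqv (P ++ P') (Q ++ Q') (par s t) (seq (par s (idW P')) (par (idW Q) t)) :=
    (Eqv.par_congr (Eqv.seq_id hs).symm (Eqv.id_seq ht).symm).trans
      (Eqv.interchange hs hQ hP' ht).symm
  have e2 : Eqv (P' ++ P) (Q' ++ Q) (seq (par (idW P') s) (par t (idW Q))) (par t s) :=
    (Eqv.interchange hP' ht hs hQ).trans (Eqv.par_congr (Eqv.id_seq ht) (Eqv.seq_id hs))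
  have k1 := HasType.par hs hP'
  have k2 := HasType.par hQ ht
  have k3 := HasType.par hP' hs
  have k4 := HasType.par ht hQ
  have a := hasType_swapW Q Q'
  have b := hasType_swapW Q P'
  have c := hasType_swapW P P'
  exact (Eqv.seq_congr e1 (.refl a)).trans <|
    (Eqv.seq_assoc k1 k2 a).trans <|
    (Eqv.seq_congr (.refl k1) (swap_nat' Q ht)).trans <|
    (Eqv.seq_assoc k1 b k4).symm.trans <|
    (Eqv.seq_congr (Eqv.swap_nat P' hs) (.refl k4)).trans <|
    (Eqv.seq_assoc c k3 k4).trans (Eqv.seq_congr (.refl c) e2)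

theorem add_congr (p : OI) {P Q : List C} {s s' t t' : Term C} (h : Eqv P Q s s')
    (k : Eqv P Q t t') : Eqv P Q (add p P Q s t) (add p P Q s' t') :=
  .seq_congr (.seq_congr (.refl (hasType_splitW p P)) (.par_congr h k)) (.refl (hasType_mergeW Q))

theorem add_comm (p : OI) {P Q : List C} {s t : Term C} (hs : HasType s P Q)
    (ht : HasType t P Q) : Eqv P Q (add p P Q s t) (add p.compl P Q t s) := by
  have m := hasType_mergeW Q
  have d := hasType_splitW p P
  have w := hasType_swapW Q Q
  have w' := hasType_swapW P P
  have k := HasType.par hs ht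
  have k' := HasType.par ht hs
  exact (Eqv.seq_congr (.refl (.seq d k)) (Eqv.merge_comm Q).symm).trans <|
    (Eqv.seq_assoc (.seq d k) w m).symm.trans <|
    .seq_congr ((Eqv.seq_assoc d k w).trans <|
      (Eqv.seq_congr (.refl d) (swap_nat₂ hs ht)).trans <|
      (Eqv.seq_assoc d w' k').symm.trans (.seq_congr (.split_comm p P) (.refl k'))) (.refl m)

theorem add_idem (p : OI) {P Q : List C} {s : Term C} (hs : HasType s P Q) :
    Eqv P Q (add p P Q s s) s := by
  have m := hasType_mergeW P
  have m' := hasType_mergeW Q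
  have d := hasType_splitW p P
  have k := HasType.par hs hs
  exact (Eqv.seq_assoc d k m').trans <|
    (Eqv.seq_congr (.refl d) (Eqv.merge_nat hs).symm).trans <|
    (Eqv.seq_assoc d m hs).symm.trans <|
    (Eqv.seq_congr (.split_idem p P) (.refl hs)).trans (.id_seq hs)

theorem seq_add (p : OI) {P Q R : List C} {e s t : Term C} (he : HasType e P Q)
    (hs : HasType s Q R) (ht : HasType t Q R) :
    Eqv P R (seq e (add p Q R s t)) (add p P R (seq e s) (seq e t)) := by
  have m := hasType_mergeW R
  have d := hasType_splitW p Q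
  have d' := hasType_splitW p P
  have k := HasType.par hs ht
  have k' := HasType.par he he
  exact (Eqv.seq_assoc he (.seq d k) m).symm.trans <| .seq_congr
    ((Eqv.seq_assoc he d k).symm.trans <|
      (Eqv.seq_congr (.split_nat p he) (.refl k)).trans <|
      (Eqv.seq_assoc d' k' k).trans (.seq_congr (.refl d') (.interchange he hs he ht))) (.refl m)

theorem add_seq (p : OI) {P Q R : List C} {s t e : Term C} (hs : HasType s P Q)
    (ht : HasType t P Q) (he : HasType e Q R) :
    Eqv P R (seq (add p P Q s t) e) (add p P R (seq s e) (seq t e)) := by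
  have m := hasType_mergeW R
  have m' := hasType_mergeW Q
  have d := hasType_splitW p P
  have k := HasType.par hs ht
  have k' := HasType.par he he
  exact (Eqv.seq_assoc (.seq d k) m' he).trans <|
    (Eqv.seq_congr (.refl (.seq d k)) (.merge_nat he)).trans <|
    (Eqv.seq_assoc (.seq d k) k' m).symm.trans <| .seq_congr
      ((Eqv.seq_assoc d k k').trans (.seq_congr (.refl d) (.interchange hs he ht he))) (.refl m)

theorem seq_star {P Q : List C} (R : List C) {s : Term C} (hs : HasType s P Q) :
    Eqv P R (seq s (star Q R)) (star P R) :=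
  (Eqv.seq_assoc hs (hasType_discardW Q) (hasType_cobangW R)).symm.trans
    (.seq_congr (.discard_nat hs) (.refl (hasType_cobangW R)))

theorem star_seq (P : List C) {Q R : List C} {s : Term C} (hs : HasType s Q R) :
    Eqv P R (seq (star P Q) s) (star P R) :=
  (Eqv.seq_assoc (hasType_discardW P) (hasType_cobangW Q) hs).trans
    (.seq_congr (.refl (hasType_discardW P)) (.cobang_nat hs))

theorem add_assoc (p q : OI) {P Q : List C} {x y z : Term C} (hx : HasType x P Q)
    (hy : HasType y P Q) (hz : HasType z P Q) :
    Eqv P Q (add p P Q (add q P Q x y) z)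
      (add (OI.tildeFst p q) P Q x (add (OI.tildeSnd p q) P Q y z)) := by
  have iP := hasType_idW P
  have iQ := hasType_idW Q
  have m := hasType_mergeW Q
  have dp := hasType_splitW p P
  have dq := hasType_splitW q P
  have dp' := hasType_splitW (OI.tildeFst p q) P
  have dq' := hasType_splitW (OI.tildeSnd p q) P
  have kxy := HasType.par hx hy
  have kyz := HasType.par hy hz
  -- the common middle part
  have l1 : Eqv (P ++ P) (Q ++ Q) (par (add q P Q x y) z)
      (seq (seq (par (splitW q P) (idW P)) (par x (par y z))) (par (mergeW Q) (idW Q))) := by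
    refine (Eqv.par_congr (.refl (.seq (.seq dq kxy) m)) (Eqv.seq_id hz).symm).trans ?_
    refine (Eqv.interchange (.seq dq kxy) m hz iQ).symm.trans ?_
    refine .seq_congr ?_ (.refl (.par m iQ))
    refine (Eqv.par_congr (.refl (.seq dq kxy)) (Eqv.id_seq hz).symm).trans ?_
    refine (Eqv.interchange dq kxy iP hz).symm.trans ?_
    exact .seq_congr (.refl (.par dq iP)) ((Eqv.par_assoc hx hy hz).of_eq (by simp) (by simp))
  have l2 : Eqv (P ++ P) (Q ++ Q) (par x (add (OI.tildeSnd p q) P Q y z))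
      (seq (seq (par (idW P) (splitW (OI.tildeSnd p q) P)) (par x (par y z)))
        (par (idW Q) (mergeW Q))) := by
    refine (Eqv.par_congr (Eqv.seq_id hx).symm (.refl (.seq (.seq dq' kyz) m))).trans ?_
    refine (Eqv.interchange hx iQ (.seq dq' kyz) m).symm.trans ?_
    refine .seq_congr ?_ (.refl (.par iQ m))
    refine (Eqv.par_congr (Eqv.id_seq hx).symm (.refl (.seq dq' kyz))).trans ?_
    exact (Eqv.interchange iP hx dq' kyz).symm
  have K := HasType.par hx kyz
  have A := (HasType.par dq iP).of_eq (Q' := P ++ (P ++ P)) rfl (by simp)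
  have A' := HasType.par iP dq'
  have B := (HasType.par m iQ).of_eq (P' := Q ++ (Q ++ Q)) (by simp) rfl
  have B' := HasType.par iQ m
  -- `d ; ((a ; k) ; b) ; m` reassociates to `((d ; a) ; k) ; (b ; m)`
  have key : ∀ {d a b : Term C}, HasType d P (P ++ P) → HasType a (P ++ P) (P ++ (P ++ P)) →
      HasType b (Q ++ (Q ++ Q)) (Q ++ Q) →
      Eqv P Q (seq (seq d (seq (seq a (par x (par y z))) b)) (mergeW Q))
        (seq (seq (seq d a) (par x (par y z))) (seq b (mergeW Q))) := by
    intro d a b hd ha hb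
    refine (Eqv.seq_congr (Eqv.seq_assoc hd (.seq ha K) hb).symm (.refl m)).trans ?_
    refine (Eqv.seq_assoc (.seq hd (.seq ha K)) hb m).trans ?_
    exact .seq_congr (Eqv.seq_assoc hd ha K).symm (.refl (.seq hb m))
  refine (Eqv.seq_congr (.seq_congr (.refl dp) l1) (.refl m)).trans ?_
  refine Eqv.trans ?_ (Eqv.seq_congr (.seq_congr (.refl dp') l2) (.refl m)).symm
  refine (key dp A B).trans (Eqv.trans ?_ (key dp' A' B').symm)
  exact .seq_congr (.seq_congr (.split_assoc p q P) (.refl K)) (Eqv.merge_assoc Q).symm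

end Term

end Tapes

/-- Objects of the category of tapes `T(C)` are words of objects of `C`. -/
structure TapeCat (C : Type u) where
  word : List C

section TapeCategory

variable {C : Type u} [Category.{v} C]

/-- The category `T(C)`: arrows are typed terms modulo the axioms. -/
instance TapeCat.category : Category.{max u v} (TapeCat C) where
  Hom P Q := Quotient (Term.setoid P.word Q.word)
  id P := Quotient.mk _ ⟨Term.idW P.word, Term.hasType_idW _⟩
  comp := Quotient.map₂ (fun s t => ⟨Term.seq s.1 t.1, .seq s.2 t.2⟩)
    (fun _ _ h _ _ k => Term.Eqv.seq_congr h k)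
  id_comp := by
    rintro P Q ⟨s⟩
    exact Quotient.sound (Term.Eqv.id_seq s.2)
  comp_id := by
    rintro P Q ⟨s⟩
    exact Quotient.sound (Term.Eqv.seq_id s.2)
  assoc := by
    rintro P Q R S ⟨s⟩ ⟨t⟩ ⟨r⟩
    exact Quotient.sound (Term.Eqv.seq_assoc s.2 t.2 r.2)

/-- `f +_p g = split_p ; (f ⊕ g) ; merge` and `star = ! ; ?`. -/
instance TapeCat.pca (P Q : TapeCat C) : PCA (P ⟶ Q) where
  star := Quotient.mk _ ⟨Term.star P.word Q.word, Term.hasType_star _ _⟩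
  add p := Quotient.map₂ (fun s t => ⟨Term.add p P.word Q.word s.1 t.1, Term.hasType_add p s.2 t.2⟩)
    (fun _ _ h _ _ k => Term.add_congr p h k)
  add_assoc := by
    rintro p q ⟨s⟩ ⟨t⟩ ⟨r⟩
    exact Quotient.sound (Term.add_assoc p q s.2 t.2 r.2)
  add_comm := by
    rintro p ⟨s⟩ ⟨t⟩
    exact Quotient.sound (Term.add_comm p s.2 t.2)
  add_idem := by
    rintro p ⟨s⟩
    exact Quotient.sound (Term.add_idem p s.2)

instance TapeCat.pcaEnriched : PCAEnriched (TapeCat C) where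
  pca := TapeCat.pca
  comp_add := by
    rintro P Q R p ⟨e⟩ ⟨s⟩ ⟨t⟩
    exact Quotient.sound (Term.seq_add p e.2 s.2 t.2)
  add_comp := by
    rintro P Q R p ⟨s⟩ ⟨t⟩ ⟨e⟩
    exact Quotient.sound (Term.add_seq p s.2 t.2 e.2)
  comp_star := by
    rintro P Q R ⟨s⟩
    exact Quotient.sound (Term.seq_star R.word s.2)
  star_comp := by
    rintro P Q R ⟨s⟩
    exact Quotient.sound (Term.star_seq P.word s.2)

end TapeCategory

end ProbTape

end

/-!
Both categories are compared through random walks. A token enters a tape on one of the input wires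
and carries an arrow of `C` out of a fixed object `X`; splits choose a branch at random, discards
kill the token, and a tape `c` composes the accumulated arrow with `c`. The subdistribution of the
outgoing tokens is `Term.sem`, with linear extension `Term.semₗ`. Terms and tokens are untyped here,
so that wires are plain natural numbers and no transport along equalities of words is needed;
the typing `Tok.On` enters as a hypothesis.

* Soundness (`Term.Eqv.semₗ_eq`): every axiom of tapes holds for random walks.
* Normal forms: the natural monoids make `⊕` a coproduct of tapes (`Term.copair_eta`), so that a
  tape is determined by its restrictions to single wires (`Term.eqv_of_inj`). Such a restriction is
  a convex combination of arrows of `C` followed by injections (`Term.conv_of_hasType`), by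
  induction on the term.
* Completeness (`Term.eqv_of_sem`): a convex combination in any pointed convex algebra depends only
  on the subdistribution of its coefficients, because it can be computed as a sum in the commutative
  monoid `Cone X` generated by the algebra (`SubDist.Represents`). For a tape on a single wire this
  subdistribution is its random walk.

Hence `T(C)` is a convex biproduct category: the pairing of `p₁ · f` and `p₂ · g` is the convex sum
of `f ; ι₁` and `g ; ι₂`, and it is unique since the tokens on `P ⊕ Q` are determined by their
images under the projections (`TapeCat.isConvexProduct_sum`).

On the other side, a matrix over `C⁺` is the same as a family of subdistributions of tokens, one for
each input wire (`Agree`, `exists_preMat`, `exists_term`), and matrix multiplication is composition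
of random walks (`Agree.comp`). This gives a PCA-enriched functor from matrices to tapes that is
fully faithful and bijective on objects. Along such a functor the convex biproducts are reflected,
and its strict inverse, like itself, preserves coproducts because it is an equivalence.
-/

noncomputable section

namespace ProbTape

/-! ### The cone over a pointed convex algebra -/

/-- The convex cone generated by a convex algebra `X`: its elements are the vertex and the points
`a • x` with `a > 0` and `x` in `X`. -/
inductive Cone (X : Type w) : Type w
  | zero : Cone X
  | ray (a : ℝ) (ha : 0 < a) (x : X) : Cone X

namespace Cone

variable {X : Type w}

theorem ray_congr {a b : ℝ} {ha : 0 < a} {hb : 0 < b} {x y : X} (h : a = b) (hxy : x = y) :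
    ray a ha x = ray b hb y := by subst h; subst hxy; rfl

open Classical in
/-- The element `a • x` of the cone, for `a ≥ 0` (negative scalars count as zero). -/
def mk (a : ℝ) (x : X) : Cone X := if h : 0 < a then ray a h x else zero

theorem mk_of_pos {a : ℝ} (ha : 0 < a) (x : X) : mk a x = ray a ha x := dif_pos ha

theorem mk_one_injective {x y : X} (h : mk 1 x = mk 1 y) : x = y := by
  rw [mk_of_pos one_pos, mk_of_pos one_pos] at h
  cases h; rfl

variable [PCA X]

/-- The proportion `a / (a + b)`. -/
def ratio {a b : ℝ} (ha : 0 < a) (hb : 0 < b) : OI :=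
  ⟨a / (a + b), div_pos ha (add_pos ha hb), (div_lt_one (add_pos ha hb)).2 (by linarith)⟩

/-- Addition in the cone: `a • x + b • y = (a + b) • (x +_{a / (a + b)} y)`. -/
protected def add : Cone X → Cone X → Cone X
  | zero, z => z
  | ray a ha x, zero => ray a ha x
  | ray a ha x, ray b hb y => ray (a + b) (add_pos ha hb) (PCA.add (ratio ha hb) x y)

instance : AddCommMonoid (Cone X) where
  zero := zero
  add := Cone.add
  zero_add _ := rfl
  add_zero z := by cases z <;> rfl
  add_assoc := by
    rintro (_ | ⟨a, ha, x⟩) (_ | ⟨b, hb, y⟩) (_ | ⟨c, hc, z⟩) <;> try rfl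
    refine ray_congr (_root_.add_assoc a b c) ((PCA.add_assoc _ _ _ _ _).trans ?_)
    congr 1
    · refine Subtype.ext ?_
      simp only [OI.tildeFst, ratio]
      field_simp
      ring
    · congr 1
      refine Subtype.ext ?_
      have h1 : a + b + c - a ≠ 0 := by linarith
      simp only [OI.tildeSnd, ratio]
      field_simp
      ring
  add_comm := by
    rintro (_ | ⟨a, ha, x⟩) (_ | ⟨b, hb, y⟩) <;> try rfl
    refine ray_congr (_root_.add_comm a b) ((PCA.add_comm _ _ _).trans ?_)
    congr 1
    refine Subtype.ext ?_
    simp only [OI.compl, ratio]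
    field_simp
    ring
  nsmul := @nsmulRec _ ⟨zero⟩ ⟨Cone.add⟩

theorem ray_add_ray {a b : ℝ} (ha : 0 < a) (hb : 0 < b) (x y : X) :
    ray a ha x + ray b hb y = ray (a + b) (add_pos ha hb) (PCA.add (ratio ha hb) x y) := rfl

theorem mk_zero (x : X) : mk 0 x = 0 := dif_neg (lt_irrefl _)

theorem mk_add {a b : ℝ} (ha : 0 ≤ a) (hb : 0 ≤ b) (x : X) : mk (a + b) x = mk a x + mk b x := by
  rcases ha.eq_or_lt with rfl | ha
  · rw [mk_zero, _root_.zero_add, _root_.zero_add]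
  rcases hb.eq_or_lt with rfl | hb
  · rw [mk_zero, _root_.add_zero, _root_.add_zero]
  rw [mk_of_pos ha, mk_of_pos hb, mk_of_pos (add_pos ha hb), ray_add_ray, PCA.add_idem]

/-- Multiplication by a positive scalar. -/
def scale (c : ℝ) (hc : 0 < c) : Cone X →+ Cone X where
  toFun
    | zero => zero
    | ray a ha x => ray (c * a) (mul_pos hc ha) x
  map_zero' := rfl
  map_add' := by
    rintro (_ | ⟨a, ha, x⟩) (_ | ⟨b, hb, y⟩) <;> try rfl
    refine ray_congr (mul_add c a b) ?_
    congr 1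
    refine Subtype.ext ?_
    simp only [ratio]
    field_simp

theorem scale_mk (c : ℝ) (hc : 0 < c) (a : ℝ) (x : X) : scale c hc (mk a x) = mk (c * a) x := by
  by_cases ha : 0 < a
  · rw [mk_of_pos ha, mk_of_pos (mul_pos hc ha)]; rfl
  · rw [mk, mk, dif_neg ha, dif_neg (by rwa [mul_pos_iff_of_pos_left hc])]; rfl

/-- An affine map from a convex algebra to a vector space extends to an additive map on the
cone. -/
def lift {W : Type*} [AddCommGroup W] [Module ℝ W] (L : X → W)
    (hL : ∀ (p : OI) x y, L (PCA.add p x y) = p.1 • L x + (1 - p.1) • L y) : Cone X →+ W where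
  toFun
    | zero => 0
    | ray a _ x => a • L x
  map_zero' := rfl
  map_add' := by
    rintro (_ | ⟨a, ha, x⟩) (_ | ⟨b, hb, y⟩)
    · exact (_root_.add_zero _).symm
    · exact (_root_.zero_add _).symm
    · exact (_root_.add_zero _).symm
    · change (a + b) • L (PCA.add (ratio ha hb) x y) = a • L x + b • L y
      have h : a + b ≠ 0 := (add_pos ha hb).ne'
      rw [hL, smul_add, smul_smul, smul_smul]
      simp only [ratio]
      congr 2
      · field_simp
      · field_simp; ring

theorem lift_mk {W : Type*} [AddCommGroup W] [Module ℝ W] (L : X → W)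
    (hL : ∀ (p : OI) x y, L (PCA.add p x y) = p.1 • L x + (1 - p.1) • L y) {a : ℝ} (ha : 0 ≤ a)
    (x : X) : lift L hL (mk a x) = a • L x := by
  rcases ha.eq_or_lt with rfl | ha
  · rw [mk_zero, map_zero, zero_smul]
  · rw [mk_of_pos ha]; rfl

end Cone

/-! ### Subdistributions form the free pointed convex algebra -/

namespace SubDist

variable {S : Type v} {X : Type w} [PCA X]

/-- `d.Represents φ x` says that `x` is the convex combination `∑ₛ d(s) · φ(s)`, computed in the
cone, where the missing mass is given to the point. -/
def Represents (d : SubDist S) (φ : S → X) (x : X) : Prop :=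
  Cone.mk 1 x = ∑ s ∈ d.val.support, Cone.mk (d.val s) (φ s) + Cone.mk (1 - mass S d.val) PCA.star

theorem Represents.unique {d : SubDist S} {φ : S → X} {x y : X} (hx : d.Represents φ x)
    (hy : d.Represents φ y) : x = y :=
  Cone.mk_one_injective (hx.trans hy.symm)

theorem sum_support_subset (d : SubDist S) (φ : S → X) {T : Finset S} (hT : d.val.support ⊆ T) :
    ∑ s ∈ d.val.support, Cone.mk (d.val s) (φ s) = ∑ s ∈ T, Cone.mk (d.val s) (φ s) :=
  Finset.sum_subset hT fun s _ hs => by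
    rw [Finsupp.notMem_support_iff.1 hs, Cone.mk_zero]

theorem represents_star (φ : S → X) : (PCA.star : SubDist S).Represents φ PCA.star := by
  simp [Represents, SubDist.star_val]

theorem represents_dirac (φ : S → X) (s : S) : (SubDist.dirac s).Represents φ (φ s) := by
  classical
  simp [Represents, SubDist.dirac, mass, Cone.mk_zero]

theorem Represents.add {d e : SubDist S} {φ : S → X} {x y : X} (hx : d.Represents φ x)
    (hy : e.Represents φ y) (p : OI) : (PCA.add p d e).Represents φ (PCA.add p x y) := by
  classical
  have hp := p.2.1
  have hq : 0 < 1 - p.1 := sub_pos.2 p.2.2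
  have hxy : Cone.mk 1 (PCA.add p x y) =
      Cone.scale p.1 hp (Cone.mk 1 x) + Cone.scale (1 - p.1) hq (Cone.mk 1 y) := by
    rw [Cone.scale_mk, Cone.scale_mk, Cone.mk_of_pos one_pos, mul_one, mul_one, Cone.mk_of_pos hp,
      Cone.mk_of_pos hq, Cone.ray_add_ray]
    refine Cone.ray_congr (by ring) ?_
    congr 1
    exact Subtype.ext (by simp [Cone.ratio])
  unfold Represents at hx hy ⊢
  set T := d.val.support ∪ e.val.support with hT
  have hsup : (PCA.add p d e).val.support ⊆ T := by
    rw [SubDist.add_val]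
    exact Finsupp.support_add.trans
      (Finset.union_subset_union Finsupp.support_smul Finsupp.support_smul)
  rw [hxy, hx, hy, sum_support_subset _ φ hsup, sum_support_subset d φ Finset.subset_union_left,
    sum_support_subset e φ Finset.subset_union_right]
  simp only [map_add, map_sum, Cone.scale_mk, SubDist.add_val, Finsupp.add_apply,
    Finsupp.smul_apply, smul_eq_mul, map_smul]
  rw [show (1 : ℝ) - (p.1 * mass S d.val + (1 - p.1) * mass S e.val) =
    p.1 * (1 - mass S d.val) + (1 - p.1) * (1 - mass S e.val) by ring,
    Cone.mk_add (mul_nonneg hp.le (sub_nonneg.2 d.mass_le))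
      (mul_nonneg hq.le (sub_nonneg.2 e.mass_le)),
    Finset.sum_congr rfl fun s _ => Cone.mk_add (mul_nonneg hp.le (d.nonneg s))
      (mul_nonneg hq.le (e.nonneg s)) (φ s), Finset.sum_add_distrib]
  abel

/-- An affine map that kills the point sends `∑ₛ d(s) · φ(s)` to the corresponding linear
combination. -/
theorem Represents.map {W : Type*} [AddCommGroup W] [Module ℝ W] {d : SubDist S} {φ : S → X}
    {x : X} (hx : d.Represents φ x) (L : X → W) (h0 : L PCA.star = 0)
    (hL : ∀ (p : OI) x y, L (PCA.add p x y) = p.1 • L x + (1 - p.1) • L y) :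
    L x = Finsupp.linearCombination ℝ (fun s => L (φ s)) d.val := by
  have h := congrArg (Cone.lift L hL) hx
  rw [map_add, map_sum, Cone.lift_mk _ _ zero_le_one, one_smul,
    Cone.lift_mk _ _ (sub_nonneg.2 d.mass_le), h0, smul_zero, _root_.add_zero] at h
  rw [h, Finsupp.linearCombination_apply, Finsupp.sum]
  exact Finset.sum_congr rfl fun s _ => Cone.lift_mk _ _ (d.nonneg s) _

theorem exists_represents (d : SubDist S) (φ : S → X) : ∃ x, d.Represents φ x := by
  -- the weight of the formal combination is one, so that it is not the vertex of the cone
  let one : X → ℝ := fun _ => 1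
  have hw : ∀ (p : OI) (x y : X), one (PCA.add p x y) = p.1 • one x + (1 - p.1) • one y :=
    fun p _ _ => by simp [one]
  set z := ∑ s ∈ d.val.support, Cone.mk (d.val s) (φ s) +
    Cone.mk (1 - mass S d.val) (PCA.star : X) with hz
  have h : Cone.lift one hw z = 1 := by
    rw [hz, map_add, map_sum, Cone.lift_mk _ _ (sub_nonneg.2 d.mass_le),
      Finset.sum_congr rfl fun s _ => Cone.lift_mk _ hw (d.nonneg s) (φ s), mass_apply]
    simp [Finsupp.sum, one]
  match z, hz, h with
  | .zero, _, h => exact absurd h zero_ne_one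
  | .ray a ha x, hz, h =>
    have h1 : a = 1 := by
      have : a • (1 : ℝ) = 1 := h
      simpa using this
    subst h1
    exact ⟨x, (Cone.mk_of_pos ha x).trans hz⟩

end SubDist

/-! ### Tapes as random walks -/

section Semantics

variable {C : Type u} [Category.{v} C]

/-- A token: the number of the wire on which it sits, and the arrow out of `X` that it has
accumulated on its way. -/
abbrev Tok (X : C) : Type max u v := ℕ × (Σ Y : C, X ⟶ Y)

/-- Formal linear combinations of tokens. -/
abbrev TokSpace (X : C) : Type max u v := Tok X →₀ ℝ

/-- The tokens that may sit on the wires of the word `P`. -/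
def Tok.On (X : C) (P : List C) : Set (Tok X) := {k | P[k.1]? = some k.2.1}

theorem Tok.lt_of_on {X : C} {P : List C} {k : Tok X} (h : k ∈ Tok.On X P) : k.1 < P.length :=
  (List.getElem?_eq_some_iff.1 h).1

theorem Tok.on_append {X : C} {P Q : List C} {k : Tok X} (h : k ∈ Tok.On X (P ++ Q)) :
    (k.1 < P.length ∧ k ∈ Tok.On X P) ∨
      (P.length ≤ k.1 ∧ ((k.1 - P.length, k.2) : Tok X) ∈ Tok.On X Q) := by
  rcases lt_or_ge k.1 P.length with hk | hk
  · exact .inl ⟨hk, by simpa [Tok.On, List.getElem?_append_left hk] using h⟩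
  · exact .inr ⟨hk, by simpa [Tok.On, List.getElem?_append_right hk] using h⟩

theorem Tok.on_append_left {X : C} {P : List C} (Q : List C) {k : Tok X} (h : k ∈ Tok.On X P) :
    k ∈ Tok.On X (P ++ Q) := by
  exact (List.getElem?_append_left (Tok.lt_of_on h)).trans h

theorem Tok.on_append_right {X : C} (P : List C) {Q : List C} {k : Tok X} (h : k ∈ Tok.On X Q) :
    ((k.1 + P.length, k.2) : Tok X) ∈ Tok.On X (P ++ Q) := by
  simpa [Tok.On, List.getElem?_append_right] using h

/-- Renumbering of the wires: all tokens move up by `m`. -/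
def shift (X : C) (m : ℕ) : TokSpace X →ₗ[ℝ] TokSpace X :=
  Finsupp.lmapDomain ℝ ℝ fun k => (k.1 + m, k.2)

@[simp]
theorem shift_single {X : C} (m : ℕ) (k : Tok X) (a : ℝ) :
    shift X m (Finsupp.single k a) = Finsupp.single (k.1 + m, k.2) a := by
  simp [shift, Finsupp.lmapDomain_apply]

namespace Term

/-- The number of input wires. -/
def arity : Term C → ℕ
  | split _ _ => 1
  | discard _ => 1
  | tape _ => 1
  | cobang _ => 0
  | merge _ => 2
  | idOne _ => 1
  | idZero => 0
  | swap _ _ => 2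
  | seq s _ => arity s
  | par s t => arity s + arity t

/-- The number of output wires. -/
def coarity : Term C → ℕ
  | split _ _ => 2
  | discard _ => 0
  | tape _ => 1
  | cobang _ => 1
  | merge _ => 1
  | idOne _ => 1
  | idZero => 0
  | swap _ _ => 2
  | seq _ t => coarity t
  | par s t => coarity s + coarity t

theorem HasType.arity_eq {s : Term C} {P Q : List C} (h : HasType s P Q) :
    s.arity = P.length ∧ s.coarity = Q.length := by
  induction h with
  | seq _ _ h k => exact ⟨h.1, k.2⟩
  | par _ _ h k => simp [arity, coarity, h, k]
  | _ => exact ⟨rfl, rfl⟩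

open Classical in
/-- The subdistribution of the tokens that come out of a tape when one token is put in. The value
is meaningful for a typed term and a token on its input wires only; in particular, the truncated
subtraction in the clause for `swap` exchanges the wires `0` and `1`. -/
def sem (X : C) : Term C → Tok X → TokSpace X
  | split p _, k => Finsupp.single (k.1, k.2) p.1 + Finsupp.single (k.1 + 1, k.2) (1 - p.1)
  | discard _, _ => 0
  | tape (U := U) (V := V) c, k =>
      if h : k.2.1 = U then Finsupp.single (k.1, ⟨V, k.2.2 ≫ eqToHom h ≫ c⟩) 1 else 0
  | cobang _, _ => 0
  | merge _, k => Finsupp.single (0, k.2) 1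
  | idOne _, k => Finsupp.single k 1
  | idZero, _ => 0
  | swap _ _, k => Finsupp.single (1 - k.1, k.2) 1
  | seq s t, k => Finsupp.linearCombination ℝ (sem X t) (sem X s k)
  | par s t, k => if k.1 < s.arity then sem X s k
      else shift X s.coarity (sem X t (k.1 - s.arity, k.2))

/-- The linear extension of `sem`. -/
def semₗ (X : C) (s : Term C) : TokSpace X →ₗ[ℝ] TokSpace X := Finsupp.linearCombination ℝ (sem X s)

@[simp]
theorem semₗ_single {X : C} (s : Term C) (k : Tok X) (a : ℝ) :
    semₗ X s (Finsupp.single k a) = a • sem X s k := by simp [semₗ]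

theorem sem_seq {X : C} (s t : Term C) (k : Tok X) : sem X (seq s t) k = semₗ X t (sem X s k) := rfl

theorem semₗ_seq {X : C} (s t : Term C) (v : TokSpace X) :
    semₗ X (seq s t) v = semₗ X t (semₗ X s v) := by
  induction v using Finsupp.induction_linear with
  | zero => simp
  | add v v' h h' => simp only [map_add, h, h']
  | single k a => simp [sem_seq]

/-- Linear maps that agree on the tokens of `P` agree on their combinations. -/
theorem eq_of_supported {X : C} {A : Set (Tok X)} {W : Type*} [AddCommGroup W] [Module ℝ W]
    {f g : TokSpace X →ₗ[ℝ] W} {v : TokSpace X} (hv : v ∈ Finsupp.supported ℝ ℝ A)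
    (h : ∀ k ∈ A, f (Finsupp.single k 1) = g (Finsupp.single k 1)) : f v = g v := by
  rw [Finsupp.supported_eq_span_single] at hv
  refine LinearMap.eqOn_span (f := f) (g := g) ?_ hv
  rintro _ ⟨k, hk, rfl⟩
  exact h k hk

theorem map_supported {X : C} {A B : Set (Tok X)} (f : TokSpace X →ₗ[ℝ] TokSpace X)
    {v : TokSpace X} (hv : v ∈ Finsupp.supported ℝ ℝ A)
    (h : ∀ k ∈ A, f (Finsupp.single k 1) ∈ Finsupp.supported ℝ ℝ B) :
    f v ∈ Finsupp.supported ℝ ℝ B := by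
  rw [Finsupp.supported_eq_span_single] at hv
  have : Submodule.span ℝ ((fun i => Finsupp.single i (1 : ℝ)) '' A) ≤
      (Finsupp.supported ℝ ℝ B).comap f := by
    rw [Submodule.span_le]
    rintro _ ⟨k, hk, rfl⟩
    exact h k hk
  exact this hv

theorem sem_par_left {X : C} (s t : Term C) {k : Tok X} (h : k.1 < s.arity) :
    sem X (par s t) k = sem X s k := if_pos h

theorem sem_par_right {X : C} (s t : Term C) {k : Tok X} (h : s.arity ≤ k.1) :
    sem X (par s t) k = shift X s.coarity (sem X t (k.1 - s.arity, k.2)) := if_neg h.not_gt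

theorem semₗ_par_left {X : C} {s t : Term C} {P Q : List C} (hs : HasType s P Q) {v : TokSpace X}
    (hv : v ∈ Finsupp.supported ℝ ℝ (Tok.On X P)) : semₗ X (par s t) v = semₗ X s v := by
  refine eq_of_supported hv fun k hk => ?_
  rw [semₗ_single, semₗ_single, sem_par_left]
  rw [hs.arity_eq.1]; exact Tok.lt_of_on hk

theorem semₗ_par_shift {X : C} {s t : Term C} {P Q : List C} (hs : HasType s P Q)
    (v : TokSpace X) :
    semₗ X (par s t) (shift X P.length v) = shift X Q.length (semₗ X t v) := by
  induction v using Finsupp.induction_linear with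
  | zero => simp
  | add v v' h h' => simp only [map_add, h, h']
  | single k a =>
    rw [shift_single, semₗ_single, semₗ_single, sem_par_right _ _ (by simp [hs.arity_eq]), map_smul]
    simp [hs.arity_eq]

theorem single_supported {X : C} {A : Set (Tok X)} {k : Tok X} (h : k ∈ A) (a : ℝ) :
    Finsupp.single k a ∈ Finsupp.supported ℝ ℝ A := Finsupp.single_mem_supported ℝ a h

theorem shift_supported {X : C} (P : List C) {Q : List C} {v : TokSpace X}
    (hv : v ∈ Finsupp.supported ℝ ℝ (Tok.On X Q)) :
    shift X P.length v ∈ Finsupp.supported ℝ ℝ (Tok.On X (P ++ Q)) :=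
  map_supported _ hv fun k hk => by
    rw [shift_single]
    exact single_supported (Tok.on_append_right P hk) 1

/-- Tokens on the input wires of a typed term come out on its output wires. -/
theorem HasType.sem_mem {X : C} {s : Term C} {P Q : List C} (h : HasType s P Q) {k : Tok X}
    (hk : k ∈ Tok.On X P) : sem X s k ∈ Finsupp.supported ℝ ℝ (Tok.On X Q) := by
  induction h generalizing k with
  | split p U =>
    obtain ⟨n, Y, f⟩ := k
    obtain rfl : n = 0 := by have := Tok.lt_of_on hk; simpa using this
    exact add_mem (single_supported (by simpa [Tok.On] using hk) _)
      (single_supported (by simpa [Tok.On] using hk) _)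
  | discard U => exact zero_mem _
  | tape c =>
    obtain ⟨n, Y, f⟩ := k
    obtain rfl : n = 0 := by have := Tok.lt_of_on hk; simpa using this
    simp only [sem]
    split_ifs
    · exact single_supported (by simp [Tok.On]) _
    · exact zero_mem _
  | cobang U => exact zero_mem _
  | merge U =>
    obtain ⟨n, Y, f⟩ := k
    have := Tok.lt_of_on hk
    refine single_supported ?_ _
    match n, hk with
    | 0, hk => exact hk
    | 1, hk => exact hk
  | idOne U => exact single_supported hk _
  | idZero => exact zero_mem _
  | swap U V =>
    obtain ⟨n, Y, f⟩ := k
    have := Tok.lt_of_on hk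
    refine single_supported ?_ _
    match n, hk with
    | 0, hk => exact hk
    | 1, hk => exact hk
  | seq hs ht ihs iht =>
    refine map_supported (semₗ X _) (ihs hk) fun k' hk' => ?_
    rw [semₗ_single, one_smul]
    exact iht hk'
  | @par s t P₁ Q₁ P₂ Q₂ hs ht ihs iht =>
    rcases Tok.on_append hk with ⟨h, hk⟩ | ⟨h, hk⟩
    · rw [sem_par_left _ _ (by rwa [hs.arity_eq.1])]
      exact Finsupp.supported_mono (fun _ => Tok.on_append_left _) (ihs hk)
    · rw [sem_par_right _ _ (by rwa [hs.arity_eq.1]), hs.arity_eq.1, hs.arity_eq.2]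
      exact shift_supported _ (iht hk)

@[simp] theorem arity_idW (P : List C) : (idW P).arity = P.length := (hasType_idW P).arity_eq.1
@[simp] theorem coarity_idW (P : List C) : (idW P).coarity = P.length :=
  (hasType_idW P).arity_eq.2
@[simp] theorem arity_idOne (U : C) : (idOne U).arity = 1 := rfl
@[simp] theorem coarity_idOne (U : C) : (idOne U).coarity = 1 := rfl

theorem sem_idW {X : C} (P : List C) {k : Tok X} (hk : k.1 < P.length) :
    sem X (idW P) k = Finsupp.single k 1 := by
  induction P generalizing k with
  | nil => simp at hk
  | cons U P ih =>
    obtain ⟨n, f⟩ := k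
    rcases n with _ | n
    · rw [idW, sem_par_left _ _ (by simp)]; rfl
    · rw [idW, sem_par_right _ _ (by simp), ih (by simpa using hk)]
      simp

theorem semₗ_idW {X : C} {P : List C} {v : TokSpace X}
    (hv : v ∈ Finsupp.supported ℝ ℝ (Tok.On X P)) : semₗ X (idW P) v = v :=
  eq_of_supported (g := LinearMap.id) hv fun k hk => by
    rw [semₗ_single, one_smul, sem_idW P (Tok.lt_of_on hk)]; rfl

theorem sem_discardW {X : C} (P : List C) (k : Tok X) : sem X (discardW P) k = 0 := by
  induction P generalizing k with
  | nil => rfl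
  | cons U P ih =>
    rw [discardW, sem, ih, map_zero, sem, ite_self]

theorem semₗ_discardW {X : C} (P : List C) (v : TokSpace X) : semₗ X (discardW P) v = 0 := by
  have : sem X (discardW P) = 0 := funext (sem_discardW P)
  simp [semₗ, this]

theorem sem_swapOne {X : C} (U : C) (Q : List C) {k : Tok X} (hk : k.1 < Q.length + 1) :
    sem X (swapOne U Q) k =
      Finsupp.single (if k.1 = 0 then Q.length else k.1 - 1, k.2) 1 := by
  induction Q generalizing k with
  | nil =>
    obtain ⟨n, f⟩ := k
    obtain rfl : n = 0 := by simpa using hk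
    rfl
  | cons V Q ih =>
    obtain ⟨n, f⟩ := k
    have h2 : (swap U V).arity = 2 := rfl
    have h2' : (swap U V).coarity = 2 := rfl
    rw [swapOne, sem_seq]
    match n, hk with
    | 0, _ =>
      rw [sem_par_left _ _ (by simp [h2]), sem, semₗ_single, one_smul,
        sem_par_right _ _ (by simp), ih (by simp)]
      simp
    | 1, _ =>
      rw [sem_par_left _ _ (by simp [h2]), sem, semₗ_single, one_smul,
        sem_par_left _ _ (by simp)]
      simp [sem]
    | n + 2, hk =>
      rw [sem_par_right _ _ (by simp [h2]), sem_idW _ (by simpa [h2] using hk), shift_single,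
        semₗ_single, one_smul, sem_par_right _ _ (by simp [h2']), ih (by simpa [h2, h2'] using hk)]
      simp [h2, h2']

theorem sem_swapW {X : C} (P Q : List C) {k : Tok X} (hk : k.1 < P.length + Q.length) :
    sem X (swapW P Q) k =
      Finsupp.single (if k.1 < P.length then k.1 + Q.length else k.1 - P.length, k.2) 1 := by
  induction P generalizing k with
  | nil => simpa [swapW] using sem_idW Q (by simpa using hk)
  | cons U P ih =>
    obtain ⟨n, f⟩ := k
    have ha : (swapOne U Q).arity = Q.length + 1 := by
      rw [(hasType_swapOne U Q).arity_eq.1]; simp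
    have ha' : (swapOne U Q).coarity = Q.length + 1 := by
      rw [(hasType_swapOne U Q).arity_eq.2]; simp
    rw [swapW, sem_seq]
    rcases n with _ | n
    · rw [sem_par_left _ _ (by simp), sem, semₗ_single, one_smul, sem_par_left _ _ (by simp [ha]),
        sem_swapOne _ _ (by simp)]
      simp
    · simp only [List.length_cons] at hk
      rw [sem_par_right _ _ (by simp), ih (by simp only [arity_idOne]; omega), shift_single,
        semₗ_single, one_smul]
      simp only [arity_idOne, coarity_idOne, Nat.add_sub_cancel, List.length_cons]
      by_cases h : n < P.length
      · rw [if_pos h, if_pos (by omega), sem_par_right _ _ (by simp only [ha]; omega),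
          sem_idW _ (by simp only [ha]; omega), shift_single, ha, ha']
        congr 2
        simp only
        omega
      · rw [if_neg h, if_neg (by omega), sem_par_left _ _ (by simp only [ha]; omega),
          sem_swapOne _ _ (by simp only; omega)]
        congr 2
        simp only [Nat.add_sub_cancel]
        rw [if_neg (by omega)]
        omega

theorem sem_splitW {X : C} (p : OI) (P : List C) {k : Tok X} (hk : k.1 < P.length) :
    sem X (splitW p P) k =
      Finsupp.single k p.1 + Finsupp.single (k.1 + P.length, k.2) (1 - p.1) := by
  induction P generalizing k with
  | nil => simp at hk
  | cons U P ih =>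
    obtain ⟨n, f⟩ := k
    have ha : (swapOne U P).arity = P.length + 1 := by
      rw [(hasType_swapOne U P).arity_eq.1]; simp
    have ha' : (swapOne U P).coarity = P.length + 1 := by
      rw [(hasType_swapOne U P).arity_eq.2]; simp
    have h1 : (split p U).arity = 1 := rfl
    have h1' : (split p U).coarity = 2 := rfl
    rw [splitW, sem_seq]
    rcases n with _ | n
    · rw [sem_par_left _ _ (by simp [h1]), sem, map_add, semₗ_single, semₗ_single,
        sem_par_left _ _ (by simp), sem_par_right _ _ (by simp), sem_par_left _ _ (by simp [ha]),
        sem_swapOne _ _ (by simp), sem, shift_single]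
      simp
    · have hn : n < P.length := by simpa using hk
      rw [sem_par_right _ _ (by simp [h1]), ih (by simpa [h1]), map_add, shift_single,
        shift_single, map_add, semₗ_single, semₗ_single]
      simp only [h1, h1', Nat.add_sub_cancel]
      have e1 : sem X (par (idOne U) (par (swapOne U P) (idW P))) (n + 2, f) =
          Finsupp.single (n + 1, f) 1 := by
        rw [sem_par_right _ _ (by simp), sem_par_left _ _ (by simp only [ha, arity_idOne]; omega),
          sem_swapOne _ _ (by simp only [arity_idOne]; omega), shift_single]
        simp
      have e2 : sem X (par (idOne U) (par (swapOne U P) (idW P))) (n + P.length + 2, f) =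
          Finsupp.single (n + P.length + 2, f) 1 := by
        rw [sem_par_right _ _ (by simp), sem_par_right _ _ (by simp only [ha, arity_idOne]; omega),
          sem_idW _ (by simp only [ha, arity_idOne]; omega), shift_single, shift_single]
        simp only [ha, ha', arity_idOne, coarity_idOne]
        congr 2
        omega
      rw [e1, e2]
      simp only [Finsupp.smul_single, smul_eq_mul, mul_one, List.length_cons]
      congr 3
      omega

theorem sem_mergeW {X : C} (P : List C) {k : Tok X} (hk : k.1 < P.length + P.length) :
    sem X (mergeW P) k =
      Finsupp.single (if k.1 < P.length then k.1 else k.1 - P.length, k.2) 1 := by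
  induction P generalizing k with
  | nil => simp at hk
  | cons U P ih =>
    obtain ⟨n, f⟩ := k
    have ha : (swapW P [U]).arity = P.length + 1 := by
      rw [(hasType_swapW P [U]).arity_eq.1]; simp
    have ha' : (swapW P [U]).coarity = P.length + 1 := by
      rw [(hasType_swapW P [U]).arity_eq.2]; simp
    have h1 : (merge U).arity = 2 := rfl
    have h1' : (merge U).coarity = 1 := rfl
    simp only [List.length_cons] at hk
    rw [mergeW, sem_seq]
    rcases n with _ | n
    · rw [sem_par_left _ _ (by simp), sem, semₗ_single, one_smul, sem_par_left _ _ (by simp [h1])]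
      simp [sem]
    rw [sem_par_right _ _ (by simp)]
    simp only [arity_idOne, coarity_idOne, Nat.add_sub_cancel, List.length_cons]
    rcases lt_trichotomy n P.length with h | h | h
    · rw [sem_par_left _ _ (by simp only [ha]; omega),
        sem_swapW _ _ (by simp only [List.length_singleton]; omega), shift_single, semₗ_single,
        one_smul]
      simp only [if_pos h, List.length_singleton]
      rw [sem_par_right _ _ (by simp only [h1]; omega),
        ih (by simp only [h1]; omega), shift_single]
      simp only [h1, h1']
      rw [if_pos (by omega), if_pos (by omega)]
      rfl
    · rw [sem_par_left _ _ (by simp only [ha]; omega),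
        sem_swapW _ _ (by simp only [List.length_singleton]; omega), shift_single, semₗ_single,
        one_smul]
      simp only [if_neg h.not_lt]
      rw [sem_par_left _ _ (by simp only [h1]; omega), sem, if_neg (by omega)]
      congr 2
      omega
    · rw [sem_par_right _ _ (by simp only [ha]; omega),
        sem_idW _ (by simp only [ha]; omega), shift_single, shift_single, semₗ_single, one_smul]
      simp only [ha, ha']
      rw [sem_par_right _ _ (by simp only [h1]; omega), ih (by simp only [h1]; omega),
        shift_single]
      simp only [h1, h1']
      rw [if_neg (by omega), if_neg (by omega)]
      congr 2
      omega

end Term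

end Semantics

/-! ### Soundness of the random walk semantics -/

section Soundness

variable {C : Type u} [Category.{v} C]

/-- The combinations of tokens on the wires of `P`. -/
abbrev wires (X : C) (P : List C) : Submodule ℝ (TokSpace X) :=
  Finsupp.supported ℝ ℝ (Tok.On X P)

theorem shift_shift {X : C} (m n : ℕ) (v : TokSpace X) :
    shift X m (shift X n v) = shift X (n + m) v := by
  induction v using Finsupp.induction_linear with
  | zero => simp
  | add v v' h h' => simp only [map_add, h, h']
  | single k a => simp [_root_.add_assoc]

theorem shift_zero {X : C} (v : TokSpace X) : shift X 0 v = v := by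
  induction v using Finsupp.induction_linear with
  | zero => simp
  | add v v' h h' => simp only [map_add, h, h']
  | single k a => simp

/-- Reassociation of a family of tokens on three words. -/
theorem wires_assoc {X : C} (P Q : List C) (a b c : TokSpace X) :
    a + shift X P.length (b + shift X Q.length c) =
      (a + shift X P.length b) + shift X (P ++ Q).length c := by
  rw [map_add, shift_shift, _root_.add_assoc, List.length_append, _root_.add_comm Q.length]

/-- The tokens on `P ⊕ Q` split into tokens on `P` and shifted tokens on `Q`. -/
theorem exists_wires_append {X : C} {P Q : List C} {v : TokSpace X} (hv : v ∈ wires X (P ++ Q)) :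
    ∃ a ∈ wires X P, ∃ b ∈ wires X Q, v = a + shift X P.length b := by
  have h : wires X (P ++ Q) ≤ wires X P ⊔ (wires X Q).map (shift X P.length) := by
    rw [wires, Finsupp.supported_eq_span_single, Submodule.span_le]
    rintro _ ⟨k, hk, rfl⟩
    rcases Tok.on_append hk with ⟨_, h⟩ | ⟨hP, h⟩
    · exact Submodule.mem_sup_left (Finsupp.single_mem_supported ℝ _ h)
    · refine Submodule.mem_sup_right ⟨_, Finsupp.single_mem_supported ℝ 1 h, ?_⟩
      simp [hP]
  obtain ⟨a, ha, _, ⟨b, hb, rfl⟩, rfl⟩ := Submodule.mem_sup.1 (h hv)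
  exact ⟨a, ha, b, hb, rfl⟩

theorem wires_append_left {X : C} {P : List C} (Q : List C) {v : TokSpace X} (h : v ∈ wires X P) :
    v ∈ wires X (P ++ Q) :=
  Finsupp.supported_mono (fun _ => Tok.on_append_left _) h

theorem eq_zero_of_wires_nil {X : C} {v : TokSpace X} (h : v ∈ wires X []) : v = 0 := by
  have : Tok.On X [] = ∅ := by ext; simp [Tok.On]
  simpa [wires, this] using h

namespace Term

theorem HasType.semₗ_mem {X : C} {s : Term C} {P Q : List C} (h : HasType s P Q) {v : TokSpace X}
    (hv : v ∈ wires X P) : semₗ X s v ∈ wires X Q :=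
  map_supported _ hv fun k hk => by
    rw [semₗ_single, one_smul]
    exact h.sem_mem hk

theorem semₗ_par {X : C} {s t : Term C} {P Q R S : List C} (hs : HasType s P Q)
    (_ : HasType t R S) {a : TokSpace X} (ha : a ∈ wires X P) (b : TokSpace X) :
    semₗ X (par s t) (a + shift X P.length b) = semₗ X s a + shift X Q.length (semₗ X t b) := by
  rw [map_add, semₗ_par_left hs ha, semₗ_par_shift hs]

theorem semₗ_swapW {X : C} {P Q : List C} {a b : TokSpace X} (ha : a ∈ wires X P)
    (hb : b ∈ wires X Q) :
    semₗ X (swapW P Q) (a + shift X P.length b) = b + shift X Q.length a := by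
  rw [map_add, _root_.add_comm]
  congr 1
  · refine eq_of_supported (f := semₗ X (swapW P Q) ∘ₗ shift X P.length) (g := LinearMap.id) hb
      fun k hk => ?_
    have := Tok.lt_of_on hk
    simp only [LinearMap.comp_apply, shift_single, semₗ_single, one_smul, LinearMap.id_apply]
    rw [sem_swapW _ _ (by simp only; omega)]
    simp
  · refine eq_of_supported ha fun k hk => ?_
    have := Tok.lt_of_on hk
    rw [semₗ_single, one_smul, sem_swapW _ _ (by omega), if_pos this, shift_single]

theorem semₗ_mergeW {X : C} {P : List C} {a b : TokSpace X} (ha : a ∈ wires X P)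
    (hb : b ∈ wires X P) : semₗ X (mergeW P) (a + shift X P.length b) = a + b := by
  rw [map_add]
  congr 1
  · refine eq_of_supported (g := LinearMap.id) ha fun k hk => ?_
    have := Tok.lt_of_on hk
    rw [semₗ_single, one_smul, sem_mergeW _ (by omega), if_pos this, LinearMap.id_apply]
  · refine eq_of_supported (f := semₗ X (mergeW P) ∘ₗ shift X P.length) (g := LinearMap.id) hb
      fun k hk => ?_
    have := Tok.lt_of_on hk
    simp only [LinearMap.comp_apply, shift_single, semₗ_single, one_smul, LinearMap.id_apply]
    rw [sem_mergeW _ (by simp only; omega)]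
    simp

theorem semₗ_splitW {X : C} (p : OI) {P : List C} {a : TokSpace X} (ha : a ∈ wires X P) :
    semₗ X (splitW p P) a = p.1 • a + shift X P.length ((1 - p.1) • a) := by
  refine eq_of_supported (g := p.1 • LinearMap.id + shift X P.length ∘ₗ
    ((1 - p.1) • LinearMap.id)) ha fun k hk => ?_
  rw [semₗ_single, one_smul, sem_splitW _ _ (Tok.lt_of_on hk)]
  simp

theorem semₗ_add {X : C} (p : OI) {P Q : List C} {s t : Term C} (hs : HasType s P Q)
    (ht : HasType t P Q) {v : TokSpace X} (hv : v ∈ wires X P) :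
    semₗ X (add p P Q s t) v = p.1 • semₗ X s v + (1 - p.1) • semₗ X t v := by
  rw [add, semₗ_seq, semₗ_seq, semₗ_splitW p hv,
    semₗ_par hs ht (Submodule.smul_mem _ _ hv), map_smul, map_smul,
    semₗ_mergeW (Submodule.smul_mem _ _ (hs.semₗ_mem hv)) (Submodule.smul_mem _ _ (ht.semₗ_mem hv))]

theorem semₗ_star {X : C} (P Q : List C) (v : TokSpace X) : semₗ X (star P Q) v = 0 := by
  rw [star, semₗ_seq, semₗ_discardW, map_zero]

/-- The axioms of tapes hold for random walks. -/
theorem Eqv.semₗ_eq {X : C} {P Q : List C} {s t : Term C} (h : Eqv P Q s t) {v : TokSpace X}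
    (hv : v ∈ wires X P) : semₗ X s v = semₗ X t v := by
  induction h generalizing v with
  | refl _ => rfl
  | symm _ ih => exact (ih hv).symm
  | trans _ _ ih₁ ih₂ => exact (ih₁ hv).trans (ih₂ hv)
  | seq_congr h _ ih₁ ih₂ =>
    rw [semₗ_seq, semₗ_seq, ih₁ hv, ih₂ (h.hasType.2.semₗ_mem hv)]
  | par_congr h k ih₁ ih₂ =>
    obtain ⟨a, ha, b, hb, rfl⟩ := exists_wires_append hv
    rw [semₗ_par h.hasType.1 k.hasType.1 ha, semₗ_par h.hasType.2 k.hasType.2 ha, ih₁ ha, ih₂ hb]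
  | seq_assoc _ _ _ => simp only [semₗ_seq]
  | id_seq _ => rw [semₗ_seq, semₗ_idW hv]
  | seq_id h => rw [semₗ_seq, semₗ_idW (h.semₗ_mem hv)]
  | interchange h₁ k₁ h₂ k₂ =>
    obtain ⟨a, ha, b, hb, rfl⟩ := exists_wires_append hv
    rw [semₗ_seq, semₗ_par h₁ h₂ ha, semₗ_par k₁ k₂ (h₁.semₗ_mem ha),
      semₗ_par (h₁.seq k₁) (h₂.seq k₂) ha, semₗ_seq, semₗ_seq]
  | zero_par h =>
    have := semₗ_par (X := X) .idZero h (zero_mem _) v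
    rwa [map_zero, _root_.zero_add, _root_.zero_add, List.length_nil, shift_zero, shift_zero]
      at this
  | par_zero h => exact semₗ_par_left h hv
  | par_assoc hf hg hh =>
    obtain ⟨a, ha, b, hb, rfl⟩ := exists_wires_append hv
    obtain ⟨b, hb', c, hc, rfl⟩ := exists_wires_append hb
    rw [semₗ_par hf (hg.par hh) ha, semₗ_par hg hh hb', wires_assoc, wires_assoc,
      semₗ_par (hf.par hg) hh (add_mem (wires_append_left _ ha) (shift_supported _ hb')),
      semₗ_par hf hg ha]
  | swap_swap P Q =>
    obtain ⟨a, ha, b, hb, rfl⟩ := exists_wires_append hv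
    rw [semₗ_seq, semₗ_swapW ha hb, semₗ_swapW hb ha, semₗ_idW hv]
  | swap_nat R h =>
    obtain ⟨a, ha, b, hb, rfl⟩ := exists_wires_append hv
    rw [semₗ_seq, semₗ_seq, semₗ_par h (hasType_idW R) ha, semₗ_swapW ha hb, semₗ_idW hb,
      semₗ_swapW (h.semₗ_mem ha) hb, semₗ_par (hasType_idW R) h hb, semₗ_idW hb]
  | tape_id U =>
    refine eq_of_supported hv fun k hk => ?_
    obtain ⟨n, Y, f⟩ := k
    obtain rfl : n = 0 := by have := Tok.lt_of_on hk; simpa using this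
    obtain rfl : U = Y := by simpa [Tok.On] using hk
    simp [sem]
  | tape_comp c d =>
    refine eq_of_supported hv fun k hk => ?_
    obtain ⟨n, Y, f⟩ := k
    obtain rfl : n = 0 := by have := Tok.lt_of_on hk; simpa using this
    obtain rfl : _ = Y := by simpa [Tok.On] using hk
    simp [sem]
  | merge_assoc P =>
    obtain ⟨a, ha, b, hb, rfl⟩ := exists_wires_append hv
    obtain ⟨b, hb', c, hc, rfl⟩ := exists_wires_append hb
    have i := hasType_idW P
    have m := hasType_mergeW P
    rw [semₗ_seq, semₗ_seq, semₗ_par i m ha, semₗ_mergeW hb' hc, semₗ_idW ha,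
      semₗ_mergeW ha (add_mem hb' hc), wires_assoc,
      semₗ_par m i (add_mem (wires_append_left _ ha) (shift_supported _ hb')), semₗ_mergeW ha hb',
      semₗ_idW hc, semₗ_mergeW (add_mem ha hb') hc, _root_.add_assoc]
  | merge_unit P =>
    have h := semₗ_par (X := X) (hasType_cobangW P) (hasType_idW P) (zero_mem _) v
    rw [map_zero, _root_.zero_add, _root_.zero_add, semₗ_idW hv, List.length_nil, shift_zero] at h
    rw [semₗ_seq, h, ← _root_.zero_add (shift X P.length v), semₗ_mergeW (zero_mem _) hv,
      _root_.zero_add, semₗ_idW hv]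
  | merge_comm P =>
    obtain ⟨a, ha, b, hb, rfl⟩ := exists_wires_append hv
    rw [semₗ_seq, semₗ_swapW ha hb, semₗ_mergeW ha hb, semₗ_mergeW hb ha, _root_.add_comm]
  | cobang_coh P Q =>
    rw [eq_zero_of_wires_nil hv, map_zero, map_zero]
  | merge_coh P Q =>
    obtain ⟨a, ha, b, hb, rfl⟩ := exists_wires_append hv
    rw [semₗ_mergeW ha hb, semₗ_seq]
    obtain ⟨a, ha', c, hc, rfl⟩ := exists_wires_append ha
    obtain ⟨b, hb', d, hd, rfl⟩ := exists_wires_append hb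
    have i := hasType_idW P
    have m1 := add_mem (wires_append_left P hc) (shift_supported Q hb')
    rw [← wires_assoc, semₗ_par i (.par (hasType_swapW Q P) (hasType_idW Q)) ha', wires_assoc Q P,
      semₗ_par (hasType_swapW Q P) (hasType_idW Q) m1, semₗ_swapW hc hb', semₗ_idW ha',
      semₗ_idW hd, ← wires_assoc, wires_assoc P P, semₗ_par (hasType_mergeW P) (hasType_mergeW Q)
      (add_mem (wires_append_left _ ha') (shift_supported _ hb')), semₗ_mergeW ha' hb',
      semₗ_mergeW hc hd]
    simp only [map_add]
    abel
  | cobang_nat h =>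
    rw [eq_zero_of_wires_nil hv, map_zero, map_zero]
  | merge_nat h =>
    obtain ⟨a, ha, b, hb, rfl⟩ := exists_wires_append hv
    rw [semₗ_seq, semₗ_seq, semₗ_mergeW ha hb, semₗ_par h h ha,
      semₗ_mergeW (h.semₗ_mem ha) (h.semₗ_mem hb), map_add]
  | split_assoc p q P =>
    have i := hasType_idW P
    rw [semₗ_seq, semₗ_seq, semₗ_splitW p hv, semₗ_splitW _ hv,
      semₗ_par (hasType_splitW q P) i (Submodule.smul_mem _ _ hv),
      semₗ_par i (hasType_splitW _ P) (Submodule.smul_mem _ _ hv)]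
    simp only [map_smul, semₗ_splitW _ hv, semₗ_idW hv, map_add, smul_add, smul_smul, shift_shift,
      List.length_append, OI.tildeFst, OI.tildeSnd]
    have h : (1 : ℝ) - p.1 * q.1 ≠ 0 := by
      have : p.1 * q.1 < 1 := (OI.tildeFst p q).2.2
      linarith
    rw [_root_.add_assoc]
    congr 3
    · field_simp
    · field_simp
      ring
  | split_idem p P =>
    rw [semₗ_seq, semₗ_splitW p hv,
      semₗ_mergeW (Submodule.smul_mem _ _ hv) (Submodule.smul_mem _ _ hv), semₗ_idW hv, ← add_smul]
    simp
  | split_comm p P =>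
    rw [semₗ_seq, semₗ_splitW p hv, semₗ_splitW _ hv,
      semₗ_swapW (Submodule.smul_mem _ _ hv) (Submodule.smul_mem _ _ hv)]
    simp [OI.compl]
  | discard_coh P Q =>
    obtain ⟨a, ha, b, hb, rfl⟩ := exists_wires_append hv
    rw [semₗ_discardW, semₗ_par (hasType_discardW P) (hasType_discardW Q) ha, semₗ_discardW,
      semₗ_discardW, map_zero, _root_.add_zero]
  | split_coh p P Q =>
    rw [semₗ_splitW p hv, semₗ_seq]
    obtain ⟨a, ha, b, hb, rfl⟩ := exists_wires_append hv
    have sm : ∀ {r : ℝ} {R : List C} {w : TokSpace X}, w ∈ wires X R → r • w ∈ wires X R :=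
      fun h => Submodule.smul_mem _ _ h
    rw [semₗ_par (hasType_splitW p P) (hasType_splitW p Q) ha, semₗ_splitW p ha, semₗ_splitW p hb]
    rw [← wires_assoc, wires_assoc P Q,
      semₗ_par (hasType_idW P) (.par (hasType_swapW P Q) (hasType_idW Q)) (sm ha),
      semₗ_par (hasType_swapW P Q) (hasType_idW Q)
        (add_mem (wires_append_left Q (sm ha)) (shift_supported P (sm hb))),
      semₗ_swapW (sm ha) (sm hb), semₗ_idW (sm ha), semₗ_idW (sm hb), ← wires_assoc Q P,
      wires_assoc P Q, smul_add, smul_add, map_smul, map_smul (shift X P.length)]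
  | discard_nat h => rw [semₗ_seq, semₗ_discardW, semₗ_discardW]
  | split_nat p h =>
    rw [semₗ_seq, semₗ_seq, semₗ_splitW p (h.semₗ_mem hv), semₗ_splitW p hv,
      semₗ_par h h (Submodule.smul_mem _ _ hv)]
    simp only [map_smul]

/-! ### Naturality in the source of the tokens -/

/-- Precomposition of the accumulated arrow of a token. -/
def precomp {X X' : C} (g : X' ⟶ X) : TokSpace X →ₗ[ℝ] TokSpace X' :=
  Finsupp.lmapDomain ℝ ℝ fun k => (k.1, ⟨k.2.1, g ≫ k.2.2⟩)

@[simp]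
theorem precomp_single {X X' : C} (g : X' ⟶ X) (k : Tok X) (a : ℝ) :
    precomp g (Finsupp.single k a) = Finsupp.single (k.1, ⟨k.2.1, g ≫ k.2.2⟩) a := by
  simp [precomp, Finsupp.lmapDomain_apply]

theorem precomp_shift {X X' : C} (g : X' ⟶ X) (m : ℕ) (v : TokSpace X) :
    precomp g (shift X m v) = shift X' m (precomp g v) := by
  induction v using Finsupp.induction_linear with
  | zero => simp
  | add v v' h h' => simp only [map_add, h, h']
  | single k a => simp

theorem semₗ_precomp_of {X X' : C} (g : X' ⟶ X) (s : Term C)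
    (h : ∀ k, sem X' s (k.1, ⟨k.2.1, g ≫ k.2.2⟩) = precomp g (sem X s k)) (v : TokSpace X) :
    semₗ X' s (precomp g v) = precomp g (semₗ X s v) := by
  induction v using Finsupp.induction_linear with
  | zero => simp
  | add v v' h h' => simp only [map_add, h, h']
  | single k a => rw [precomp_single, semₗ_single, semₗ_single, map_smul, h]

/-- A tape extends the arrow that a token carries on the right only. -/
theorem sem_precomp {X X' : C} (g : X' ⟶ X) (s : Term C) (k : Tok X) :
    sem X' s (k.1, ⟨k.2.1, g ≫ k.2.2⟩) = precomp g (sem X s k) := by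
  induction s generalizing k with
  | tape c =>
    simp only [sem]
    split_ifs <;> simp
  | seq s t ihs iht =>
    rw [sem_seq, sem_seq, ihs, semₗ_precomp_of g t iht]
  | par s t ihs iht =>
    simp only [sem]
    split_ifs
    · exact ihs k
    · rw [precomp_shift]
      exact congrArg _ (iht (_, k.2))
  | _ => simp [sem]

end Term

end Soundness

/-! ### Coproducts of tapes -/

section Coproducts

variable {C : Type u} [Category.{v} C]

namespace Term

theorem par_idW (P Q : List C) : Eqv (P ++ Q) (P ++ Q) (par (idW P) (idW Q)) (idW (P ++ Q)) := by
  induction P with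
  | nil => exact .zero_par (hasType_idW Q)
  | cons U P ih =>
    exact (Eqv.par_assoc (.idOne U) (hasType_idW P) (hasType_idW Q)).trans
      (.par_congr (.refl (.idOne U)) ih)

/-- The first injection `P → P ⊕ Q`. -/
def inl (P Q : List C) : Term C := par (idW P) (cobangW Q)

/-- The second injection `Q → P ⊕ Q`. -/
def inr (P Q : List C) : Term C := par (cobangW P) (idW Q)

/-- The copairing of two tapes into `R`. -/
def copair (R : List C) (s t : Term C) : Term C := seq (par s t) (mergeW R)

theorem hasType_inl (P Q : List C) : HasType (inl P Q) P (P ++ Q) :=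
  (HasType.par (hasType_idW P) (hasType_cobangW Q)).of_eq (List.append_nil P) rfl

theorem hasType_inr (P Q : List C) : HasType (inr P Q) Q (P ++ Q) :=
  .par (P₁ := []) (hasType_cobangW P) (hasType_idW Q)

theorem hasType_copair {P Q R : List C} {s t : Term C} (hs : HasType s P R) (ht : HasType t Q R) :
    HasType (copair R s t) (P ++ Q) R := .seq (.par hs ht) (hasType_mergeW R)

theorem swapW_nil (P : List C) : Eqv P P (swapW P []) (idW P) := by
  induction P with
  | nil => exact .refl .idZero
  | cons U P ih =>
    have h : Eqv ([U] ++ P) ([U] ++ P) (par (idOne U) (swapW P [])) (idW (U :: P)) :=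
      .par_congr (.refl (.idOne U)) ih
    exact (Eqv.seq_congr h (.refl (hasType_idW (U :: P)))).trans (.id_seq (hasType_idW (U :: P)))

theorem merge_unit_right (P : List C) :
    Eqv P P (seq (par (idW P) (cobangW P)) (mergeW P)) (idW P) := by
  have i := hasType_idW P
  have c := hasType_cobangW P
  have m := hasType_mergeW P
  have h1 : HasType (par (idW P) (cobangW P)) P (P ++ P) := hasType_inl P P
  have h2 : HasType (par (cobangW P) (idW P)) P (P ++ P) := hasType_inr P P
  have e : Eqv P (P ++ P) (seq (par (idW P) (cobangW P)) (swapW P P))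
      (par (cobangW P) (idW P)) :=
    ((swap_nat₂ i c).of_eq (List.append_nil P) rfl).trans <|
      (Eqv.seq_congr (swapW_nil P) (.refl h2)).trans (.id_seq h2)
  exact (Eqv.seq_congr (.refl h1) (Eqv.merge_comm P).symm).trans <|
    (Eqv.seq_assoc h1 (hasType_swapW P P) m).symm.trans <|
    (Eqv.seq_congr e (.refl m)).trans (.merge_unit P)

theorem inl_par {P Q P' Q' : List C} {s t : Term C} (hs : HasType s P P') (ht : HasType t Q Q') :
    Eqv P (P' ++ Q') (seq (inl P Q) (par s t)) (par s (cobangW Q')) :=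
  ((Eqv.interchange (hasType_idW P) hs (hasType_cobangW Q) ht).trans
    (.par_congr (.id_seq hs) (.cobang_nat ht))).of_eq (List.append_nil P) rfl

theorem inr_par {P Q P' Q' : List C} {s t : Term C} (hs : HasType s P P') (ht : HasType t Q Q') :
    Eqv Q (P' ++ Q') (seq (inr P Q) (par s t)) (par (cobangW P') t) :=
  (Eqv.interchange (hasType_cobangW P) hs (hasType_idW Q) ht).trans
    (.par_congr (.cobang_nat hs) (.id_seq ht))

theorem seq_inl {P P' : List C} (Q : List C) {s : Term C} (hs : HasType s P P') :
    Eqv P (P' ++ Q) (seq s (inl P' Q)) (par s (cobangW Q)) :=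
  (Eqv.seq_congr (Eqv.par_zero hs).symm (.refl (hasType_inl P' Q))).trans <|
    ((Eqv.interchange hs (hasType_idW P') .idZero (hasType_cobangW Q)).trans
      (.par_congr (.seq_id hs) (.id_seq (hasType_cobangW Q)))).of_eq (List.append_nil P) rfl

theorem seq_inr {Q Q' : List C} (P : List C) {s : Term C} (hs : HasType s Q Q') :
    Eqv Q (P ++ Q') (seq s (inr P Q')) (par (cobangW P) s) :=
  (Eqv.seq_congr (Eqv.zero_par hs).symm (.refl (hasType_inr P Q'))).trans <|
    (Eqv.interchange .idZero (hasType_cobangW P) hs (hasType_idW Q')).trans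
      (.par_congr (.id_seq (hasType_cobangW P)) (.seq_id hs))

theorem inl_copair {P Q R : List C} {s t : Term C} (hs : HasType s P R) (ht : HasType t Q R) :
    Eqv P R (seq (inl P Q) (copair R s t)) s := by
  have m := hasType_mergeW R
  refine (Eqv.seq_assoc (hasType_inl P Q) (.par hs ht) m).symm.trans ?_
  refine (Eqv.seq_congr ((inl_par hs ht).trans (seq_inl R hs).symm) (.refl m)).trans ?_
  refine (Eqv.seq_assoc hs (hasType_inl R R) m).trans ?_
  exact (Eqv.seq_congr (.refl hs) (merge_unit_right R)).trans (.seq_id hs)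

theorem inr_copair {P Q R : List C} {s t : Term C} (hs : HasType s P R) (ht : HasType t Q R) :
    Eqv Q R (seq (inr P Q) (copair R s t)) t := by
  have m := hasType_mergeW R
  refine (Eqv.seq_assoc (hasType_inr P Q) (.par hs ht) m).symm.trans ?_
  refine (Eqv.seq_congr ((inr_par hs ht).trans (seq_inr R ht).symm) (.refl m)).trans ?_
  refine (Eqv.seq_assoc ht (hasType_inr R R) m).trans ?_
  exact (Eqv.seq_congr (.refl ht) (Eqv.merge_unit R)).trans (.seq_id ht)

/-- The identity is the copairing of the injections. -/
theorem copair_inl_inr (P Q : List C) :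
    Eqv (P ++ Q) (P ++ Q) (copair (P ++ Q) (inl P Q) (inr P Q)) (idW (P ++ Q)) := by
  have iP := hasType_idW P
  have iQ := hasType_idW Q
  have cP := hasType_cobangW P
  have cQ := hasType_cobangW Q
  have mP := hasType_mergeW P
  have mQ := hasType_mergeW Q
  have mm := HasType.par mP mQ
  have sw := hasType_swapW Q P
  have w : HasType (par (idW P) (par (swapW Q P) (idW Q))) ((P ++ Q) ++ (P ++ Q))
      ((P ++ P) ++ (Q ++ Q)) := (HasType.par iP (.par sw iQ)).of_eq (by simp) (by simp)
  -- both injections together are `id ⊕ ((? ⊕ ?) ⊕ id)`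
  have a : Eqv (P ++ Q) ((P ++ Q) ++ (P ++ Q)) (par (inl P Q) (inr P Q))
      (par (idW P) (par (par (cobangW Q) (cobangW P)) (idW Q))) :=
    ((Eqv.par_assoc iP cQ (hasType_inr P Q)).of_eq rfl (by simp)).trans
      ((Eqv.par_congr (.refl iP) (Eqv.par_assoc cQ cP iQ).symm).of_eq rfl (by simp))
  have b : Eqv [] (P ++ Q) (seq (par (cobangW Q) (cobangW P)) (swapW Q P))
      (par (cobangW P) (cobangW Q)) :=
    (swap_nat₂ cQ cP).trans (.id_seq (.par cP cQ))
  have c : Eqv (P ++ Q) ((P ++ P) ++ (Q ++ Q))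
      (seq (par (inl P Q) (inr P Q)) (par (idW P) (par (swapW Q P) (idW Q))))
      (par (inl P P) (inr Q Q)) := by
    refine (Eqv.seq_congr a (.refl w)).trans ?_
    have h1 := Eqv.interchange iP iP (.par (.par cQ cP) iQ) (.par sw iQ)
    have h2 := (Eqv.interchange (.par cQ cP) sw iQ iQ).trans (.par_congr b (.id_seq iQ))
    have h3 := h1.trans (.par_congr (.id_seq iP) h2)
    refine (h3.of_eq rfl (by simp)).trans ?_
    refine ((Eqv.par_congr (.refl iP) (Eqv.par_assoc cP cQ iQ)).of_eq rfl (by simp)).trans ?_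
    exact ((Eqv.par_assoc iP cP (.par cQ iQ)).symm).of_eq rfl (by simp)
  refine (Eqv.seq_congr (.refl (.par (hasType_inl P Q) (hasType_inr P Q)))
    (Eqv.merge_coh P Q)).trans ?_
  refine (Eqv.seq_assoc (.par (hasType_inl P Q) (hasType_inr P Q)) w mm).symm.trans ?_
  refine (Eqv.seq_congr c (.refl mm)).trans ?_
  refine (Eqv.interchange (hasType_inl P P) mP (hasType_inr Q Q) mQ).trans ?_
  exact (Eqv.par_congr (merge_unit_right P) (.merge_unit Q)).trans (par_idW P Q)

/-- Every tape out of a sum is the copairing of its components. -/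
theorem copair_eta {P Q R : List C} {h : Term C} (hh : HasType h (P ++ Q) R) :
    Eqv (P ++ Q) R (copair R (seq (inl P Q) h) (seq (inr P Q) h)) h := by
  have l := hasType_inl P Q
  have r := hasType_inr P Q
  have m := hasType_mergeW R
  refine (Eqv.seq_congr (Eqv.interchange l hh r hh).symm (.refl m)).trans ?_
  refine (Eqv.seq_assoc (.par l r) (.par hh hh) m).trans ?_
  refine (Eqv.seq_congr (.refl (.par l r)) (Eqv.merge_nat hh).symm).trans ?_
  refine (Eqv.seq_assoc (.par l r) (hasType_mergeW (P ++ Q)) hh).symm.trans ?_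
  exact (Eqv.seq_congr (copair_inl_inr P Q) (.refl hh)).trans (.id_seq hh)

theorem copair_congr {P Q R : List C} {s s' t t' : Term C} (hs : Eqv P R s s')
    (ht : Eqv Q R t t') : Eqv (P ++ Q) R (copair R s t) (copair R s' t') :=
  .seq_congr (.par_congr hs ht) (.refl (hasType_mergeW R))

theorem eqv_of_inl_inr {P Q R : List C} {s t : Term C} (hs : HasType s (P ++ Q) R)
    (ht : HasType t (P ++ Q) R) (hl : Eqv P R (seq (inl P Q) s) (seq (inl P Q) t))
    (hr : Eqv Q R (seq (inr P Q) s) (seq (inr P Q) t)) : Eqv (P ++ Q) R s t :=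
  (copair_eta hs).symm.trans ((copair_congr hl hr).trans (copair_eta ht))

/-- The injection of the `n`-th letter of a word (a junk term if there is no such letter). -/
def inj : List C → ℕ → Term C
  | [], _ => idZero
  | U :: P, 0 => par (idOne U) (cobangW P)
  | U :: P, n + 1 => par (cobang U) (inj P n)

theorem hasType_inj {P : List C} {n : ℕ} {U : C} (h : P[n]? = some U) :
    HasType (inj P n) [U] P := by
  induction P generalizing n with
  | nil => simp at h
  | cons V P ih =>
    cases n with
    | zero =>
      obtain rfl : V = U := by simpa using h
      exact .par (.idOne V) (hasType_cobangW P)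
    | succ n => exact .par (P₁ := []) (.cobang V) (ih (by simpa using h))

theorem inj_append_left {P : List C} (Q : List C) {n : ℕ} {U : C} (h : P[n]? = some U) :
    Eqv [U] (P ++ Q) (inj (P ++ Q) n) (par (inj P n) (cobangW Q)) := by
  induction P generalizing n with
  | nil => simp at h
  | cons V P ih =>
    cases n with
    | zero =>
      obtain rfl : V = U := by simpa using h
      have c := hasType_cobangW P
      have c' := hasType_cobangW Q
      exact (Eqv.par_congr (.refl (.idOne V)) (.cobang_coh P Q)).trans
        (Eqv.par_assoc (.idOne V) c c').symm
    | succ n =>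
      have h' : P[n]? = some U := by simpa using h
      exact (Eqv.par_congr (P₁ := []) (.refl (.cobang V)) (ih h')).trans
        (Eqv.par_assoc (.cobang V) (hasType_inj h') (hasType_cobangW Q)).symm

theorem inj_append_right (P : List C) {Q : List C} {n : ℕ} {U : C} (h : Q[n]? = some U) :
    Eqv [U] (P ++ Q) (inj (P ++ Q) (P.length + n)) (par (cobangW P) (inj Q n)) := by
  induction P with
  | nil =>
    simp only [List.nil_append, List.length_nil, _root_.zero_add]
    exact (Eqv.zero_par (hasType_inj h)).symm
  | cons V P ih =>
    have e : inj (V :: P ++ Q) ((V :: P).length + n) =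
        par (cobang V) (inj (P ++ Q) (P.length + n)) := by
      rw [List.length_cons, Nat.add_right_comm]; rfl
    rw [e]
    exact (Eqv.par_congr (P₁ := []) (.refl (.cobang V)) ih).trans
      (Eqv.par_assoc (.cobang V) (hasType_cobangW P) (hasType_inj h)).symm

theorem inj_zero (U : C) (P : List C) : Eqv [U] (U :: P) (inj (U :: P) 0) (inl [U] P) :=
  (Eqv.par_congr (Eqv.par_zero (.idOne U)).symm (.refl (hasType_cobangW P))).of_eq (P := [U])
    rfl rfl

theorem inj_succ (V : C) {P : List C} {n : ℕ} {U : C} (h : P[n]? = some U) :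
    Eqv [U] (V :: P) (inj (V :: P) (n + 1)) (seq (inj P n) (inr [V] P)) := by
  refine Eqv.trans ?_ (seq_inr [V] (hasType_inj h)).symm
  exact Eqv.par_congr (P₁ := []) (Eqv.par_zero (.cobang V)).symm (.refl (hasType_inj h))

/-- Tapes out of a word are determined by their restrictions to its letters. -/
theorem eqv_of_inj {P Q : List C} {s t : Term C} (hs : HasType s P Q) (ht : HasType t P Q)
    (h : ∀ n U, P[n]? = some U → Eqv [U] Q (seq (inj P n) s) (seq (inj P n) t)) :
    Eqv P Q s t := by
  induction P generalizing s t with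
  | nil =>
    exact (Eqv.id_seq hs).symm.trans ((Eqv.cobang_nat hs).trans
      ((Eqv.cobang_nat ht).symm.trans (Eqv.id_seq ht)))
  | cons V P ih =>
    have l := hasType_inl [V] P
    have r := hasType_inr [V] P
    refine eqv_of_inl_inr (P := [V]) (Q := P) hs ht ?_ (ih (.seq r hs) (.seq r ht) ?_)
    · have e := inj_zero V P
      exact (Eqv.seq_congr e.symm (.refl hs)).trans
        ((h 0 V rfl).trans (.seq_congr e (.refl ht)))
    · intro n U hn
      have e := inj_succ V hn
      have j := hasType_inj hn
      exact (Eqv.seq_assoc j r hs).symm.trans <| (Eqv.seq_congr e.symm (.refl hs)).trans <|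
        (h (n + 1) U (by simpa using hn)).trans <| (Eqv.seq_congr e (.refl ht)).trans
        (Eqv.seq_assoc j r ht)

/-- A family of tapes out of the letters of a word is realised by a tape out of the word. -/
theorem exists_of_inj {P : List C} (Q : List C) (f : ℕ → Term C)
    (hf : ∀ n U, P[n]? = some U → HasType (f n) [U] Q) :
    ∃ s, HasType s P Q ∧ ∀ n U, P[n]? = some U → Eqv [U] Q (seq (inj P n) s) (f n) := by
  induction P generalizing f with
  | nil => exact ⟨cobangW Q, hasType_cobangW Q, by simp⟩
  | cons V P ih =>
    obtain ⟨s, hs, h⟩ := ih (fun n => f (n + 1)) fun n U hn => hf (n + 1) U (by simpa using hn)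
    have h0 : HasType (f 0) [V] Q := hf 0 V rfl
    have k := hasType_copair h0 hs
    refine ⟨copair Q (f 0) s, k, fun n U hn => ?_⟩
    cases n with
    | zero =>
      obtain rfl : V = U := by simpa using hn
      exact (Eqv.seq_congr (inj_zero V P) (.refl k)).trans (inl_copair h0 hs)
    | succ n =>
      have hn' : P[n]? = some U := by simpa using hn
      exact (Eqv.seq_congr (inj_succ V hn') (.refl k)).trans <|
        (Eqv.seq_assoc (hasType_inj hn') (hasType_inr [V] P) k).trans <|
        (Eqv.seq_congr (.refl (hasType_inj hn')) (inr_copair h0 hs)).trans (h n U hn')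

end Term

end Coproducts

/-! ### Convex normal forms of tapes -/

section NormalForm

variable {C : Type u} [Category.{v} C]

namespace Term

/-- The tapes `X → Q` on a single wire that are convex combinations of arrows of `C` followed by
injections. -/
inductive Conv (X : C) (Q : List C) : Term C → Prop
  | gen {s : Term C} {n : ℕ} {Y : C} (h : Q[n]? = some Y) (c : X ⟶ Y)
      (e : Eqv [X] Q s (seq (tape c) (inj Q n))) : Conv X Q s
  | star {s : Term C} (e : Eqv [X] Q s (star [X] Q)) : Conv X Q s
  | add {s t r : Term C} (p : OI) (hs : Conv X Q s) (ht : Conv X Q t)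
      (e : Eqv [X] Q r (add p [X] Q s t)) : Conv X Q r

theorem Conv.hasType {X : C} {Q : List C} {s : Term C} (h : Conv X Q s) : HasType s [X] Q := by
  cases h with
  | gen _ _ e => exact e.hasType.1
  | star e => exact e.hasType.1
  | add _ _ _ e => exact e.hasType.1

theorem Conv.of_eqv {X : C} {Q : List C} {s t : Term C} (h : Conv X Q s) (e : Eqv [X] Q t s) :
    Conv X Q t := by
  cases h with
  | gen h c e' => exact .gen h c (e.trans e')
  | star e' => exact .star (e.trans e')
  | add p hs ht e' => exact .add p hs ht (e.trans e')

/-- Postcomposition preserves convex combinations if it does so for the generating tapes. -/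
theorem conv_seq {X : C} {P Q : List C} {s t : Term C} (hs : Conv X P s) (ht : HasType t P Q)
    (h : ∀ n Y (c : X ⟶ Y), P[n]? = some Y → Conv X Q (seq (seq (tape c) (inj P n)) t)) :
    Conv X Q (.seq s t) := by
  induction hs with
  | gen hn c e => exact (h _ _ c hn).of_eqv (.seq_congr e (.refl ht))
  | star e => exact .star ((Eqv.seq_congr e (.refl ht)).trans (star_seq [X] ht))
  | add p hs hs' e ih ih' =>
    exact .add p ih ih' ((Eqv.seq_congr e (.refl ht)).trans (add_seq p hs.hasType hs'.hasType ht))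

theorem idOne_eqv (U : C) : Eqv [U] [U] (idOne U) (idW [U]) := (Eqv.par_zero (.idOne U)).symm

theorem inj_one (U V : C) : Eqv [V] [U, V] (inj [U, V] 1) (inr [U] [V]) :=
  Eqv.par_congr (P₁ := []) (Eqv.par_zero (.cobang U)).symm (.refl (hasType_idW [V]))

theorem splitW_singleton (p : OI) (U : C) : Eqv [U] [U, U] (split p U) (splitW p [U]) := by
  refine (Eqv.par_zero (.split p U)).symm.trans ?_
  exact (Eqv.seq_id (Q := [U, U]) (HasType.par (.split p U) .idZero)).symm

theorem mergeW_singleton (U : C) : Eqv [U, U] [U] (merge U) (mergeW [U]) := by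
  refine (Eqv.par_zero (.merge U)).symm.trans ?_
  have h : Eqv [U, U] [U, U] (idW [U, U])
      (par (idOne U) (par (swapW [] [U]) (idW []))) :=
    .par_congr (P₁ := [U]) (Q₁ := [U]) (.refl (.idOne U))
      (Eqv.par_zero (hasType_idW [U])).symm
  have m : HasType (par (merge U) idZero) [U, U] [U] := .par (.merge U) .idZero
  exact (Eqv.id_seq m).symm.trans (.seq_congr h (.refl m))

theorem swapW_singleton (U V : C) : Eqv [U, V] [V, U] (swap U V) (swapW [U] [V]) := by
  have s : HasType (par (swap U V) idZero) [U, V] [V, U] := .par (.swap U V) .idZero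
  have h : Eqv [V, U] [V, U] (idW [V, U]) (par (idOne V) (idOne U)) :=
    .par_congr (P₁ := [V]) (Q₁ := [V]) (.refl (.idOne V)) (Eqv.par_zero (.idOne U))
  have e : Eqv [U, V] [V, U] (swap U V) (swapOne U [V]) :=
    (Eqv.par_zero (.swap U V)).symm.trans <| (Eqv.seq_id s).symm.trans (.seq_congr (.refl s) h)
  have k := (hasType_swapOne U [V]).of_eq (P' := [U, V]) (Q' := [V, U]) rfl rfl
  have k' : Eqv [U, V] [V, U] (swapOne U [V]) (par (swapOne U [V]) (idW [])) :=
    (Eqv.par_zero k).symm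
  exact e.trans (k'.trans ((Eqv.id_seq k'.hasType.2).symm))

theorem conv_generator {X : C} {P Q : List C} {s t : Term C} (hs : HasType s P Q) {n : ℕ} {Y : C}
    (c : X ⟶ Y) (h : P[n]? = some Y) (e : Eqv [Y] Q (seq (inj P n) s) t)
    (ht : Conv X Q (.seq (tape c) t)) : Conv X Q (.seq (.seq (tape c) (inj P n)) s) :=
  ht.of_eqv ((Eqv.seq_assoc (.tape c) (hasType_inj h) hs).trans (.seq_congr (.refl (.tape c)) e))

theorem conv_tape_inj {X Y : C} {Q : List C} {n : ℕ} (h : Q[n]? = some Y) (c : X ⟶ Y) :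
    Conv X Q (.seq (tape c) (inj Q n)) :=
  .gen h c (.refl (.seq (.tape c) (hasType_inj h)))

/-- Every tape, restricted to an input wire, is a convex combination. -/
theorem conv_of_hasType {P Q : List C} {s : Term C} (hs : HasType s P Q) {X : C} {n : ℕ} {Y : C}
    (c : X ⟶ Y) (h : P[n]? = some Y) : Conv X Q (seq (seq (tape c) (inj P n)) s) := by
  induction hs generalizing n Y with
  | split p U =>
    obtain ⟨rfl, rfl⟩ : n = 0 ∧ U = Y := by
      rcases n with _ | n <;> simp at h ⊢; exact h
    have i0 : HasType (inj [U, U] 0) [U] [U, U] := hasType_inj rfl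
    have i1 : HasType (inj [U, U] 1) [U] [U, U] := hasType_inj rfl
    have d := hasType_splitW p [U]
    have e1 : Eqv [U, U] [U, U] (copair [U, U] (inj [U, U] 0) (inj [U, U] 1)) (idW [U, U]) :=
      (copair_congr (P := [U]) (Q := [U]) (inj_zero U [U]) (inj_one U U)).trans
        (copair_inl_inr [U] [U])
    have e : Eqv [U] [U, U] (seq (inj [U] 0) (split p U))
        (add p [U] [U, U] (inj [U, U] 0) (inj [U, U] 1)) := by
      refine (Eqv.id_seq (.split p U)).trans ((splitW_singleton p U).trans ?_)
      refine (Eqv.seq_id d).symm.trans ((Eqv.seq_congr (.refl d) e1.symm).trans ?_)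
      exact (Eqv.seq_assoc d (.par i0 i1) (hasType_mergeW [U, U])).symm
    exact conv_generator (.split p U) c rfl e
      (.add p (conv_tape_inj rfl c) (conv_tape_inj rfl c) (seq_add p (.tape c) i0 i1))
  | discard U =>
    obtain ⟨rfl, rfl⟩ : n = 0 ∧ U = Y := by
      rcases n with _ | n <;> simp at h ⊢; exact h
    have e : Eqv [U] [] (seq (inj [U] 0) (discard U)) (discardW [U]) :=
      (Eqv.id_seq (.discard U)).trans (Eqv.par_zero (.discard U)).symm
    refine conv_generator (.discard U) c rfl e (.star ((Eqv.discard_nat (.tape c)).trans ?_))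
    exact (Eqv.seq_id (hasType_discardW [X])).symm
  | @tape U V c' =>
    obtain ⟨rfl, rfl⟩ : n = 0 ∧ U = Y := by
      rcases n with _ | n <;> simp at h ⊢; exact h
    refine conv_generator (.tape c') c rfl (Eqv.id_seq (.tape c')) ?_
    refine .gen (n := 0) rfl (c ≫ c') ((Eqv.tape_comp c c').symm.trans ?_)
    exact (Eqv.seq_id (.tape (c ≫ c'))).symm
  | cobang U => simp at h
  | merge U =>
    have m := hasType_mergeW [U]
    have key : Y = U ∧ Eqv [U] [U] (seq (inj [U, U] n) (merge U)) (idW [U]) := by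
      match n, h with
      | 0, h =>
        refine ⟨by simpa using h.symm, ?_⟩
        exact (Eqv.seq_congr (inj_zero U [U]) (mergeW_singleton U)).trans (merge_unit_right [U])
      | 1, h =>
        refine ⟨by simpa using h.symm, ?_⟩
        exact (Eqv.seq_congr (inj_one U U) (mergeW_singleton U)).trans (Eqv.merge_unit [U])
    obtain ⟨rfl, e⟩ := key
    exact conv_generator (.merge _) c h e (conv_tape_inj (n := 0) rfl c)
  | idOne U =>
    obtain ⟨rfl, rfl⟩ : n = 0 ∧ U = Y := by
      rcases n with _ | n <;> simp at h ⊢; exact h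
    exact conv_generator (.idOne U) c rfl ((Eqv.id_seq (.idOne U)).trans (idOne_eqv U))
      (conv_tape_inj (n := 0) rfl c)
  | idZero => simp at h
  | swap U V =>
    match n, h with
    | 0, h =>
      obtain rfl : U = Y := by simpa using h
      have r : HasType (par (cobangW [V]) (idW [U])) [U] [V, U] := hasType_inr [V] [U]
      have e : Eqv [U] [V, U] (seq (inj [U, V] 0) (swap U V)) (inj [V, U] 1) :=
        (Eqv.seq_congr (inj_zero U [V]) (swapW_singleton U V)).trans <|
          (swap_nat₂ (hasType_idW [U]) (hasType_cobangW [V])).trans <|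
          (Eqv.seq_congr (swapW_nil [U]) (.refl r)).trans <| (Eqv.id_seq r).trans (inj_one V U).symm
      exact conv_generator (.swap U V) c rfl e (conv_tape_inj rfl c)
    | 1, h =>
      obtain rfl : V = Y := by simpa using h
      have l : HasType (par (idW [V]) (cobangW [U])) [V] [V, U] := hasType_inl [V] [U]
      have e : Eqv [V] [V, U] (seq (inj [U, V] 1) (swap U V)) (inj [V, U] 0) :=
        (Eqv.seq_congr (inj_one U V) (swapW_singleton U V)).trans <|
          (swap_nat₂ (hasType_cobangW [U]) (hasType_idW [V])).trans <|
          (Eqv.id_seq l).trans (inj_zero V [U]).symm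
      exact conv_generator (.swap U V) c rfl e (conv_tape_inj rfl c)
  | seq hs ht ihs iht =>
    exact (conv_seq (ihs c h) ht fun n Y c hn => iht c hn).of_eqv
      (Eqv.seq_assoc (.seq (.tape c) (hasType_inj h)) hs ht).symm
  | @par s t P₁ Q₁ P₂ Q₂ hs ht ihs iht =>
    rcases lt_or_ge n P₁.length with hn | hn
    · rw [List.getElem?_append_left hn] at h
      have j := hasType_inj h
      have l := hasType_inl Q₁ Q₂
      have e : Eqv [Y] (Q₁ ++ Q₂) (seq (inj (P₁ ++ P₂) n) (par s t))
          (seq (seq (inj P₁ n) s) (inl Q₁ Q₂)) :=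
        (Eqv.seq_congr ((inj_append_left P₂ h).trans (seq_inl P₂ j).symm)
          (.refl (.par hs ht))).trans <|
        (Eqv.seq_assoc j (hasType_inl P₁ P₂) (.par hs ht)).trans <|
        (Eqv.seq_congr (.refl j) ((inl_par hs ht).trans (seq_inl Q₂ hs).symm)).trans
        (Eqv.seq_assoc j hs l).symm
      refine conv_generator (.par hs ht) c (by rwa [List.getElem?_append_left hn]) e ?_
      refine (conv_seq (ihs c h) l fun m Z c' hm => ?_).of_eqv <|
        (Eqv.seq_assoc (.tape c) (.seq j hs) l).symm.trans
          (.seq_congr (Eqv.seq_assoc (.tape c) j hs).symm (.refl l))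
      exact conv_generator l c' hm
        ((seq_inl Q₂ (hasType_inj hm)).trans (inj_append_left Q₂ hm).symm)
        (conv_tape_inj (by rwa [List.getElem?_append_left (List.getElem?_eq_some_iff.1 hm).1]) c')
    · obtain ⟨n, rfl⟩ := Nat.exists_eq_add_of_le hn
      have h' := h
      rw [List.getElem?_append_right hn, Nat.add_sub_cancel_left] at h
      have j := hasType_inj h
      have r := hasType_inr Q₁ Q₂
      have e : Eqv [Y] (Q₁ ++ Q₂) (seq (inj (P₁ ++ P₂) (P₁.length + n)) (par s t))
          (seq (seq (inj P₂ n) t) (inr Q₁ Q₂)) :=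
        (Eqv.seq_congr ((inj_append_right P₁ h).trans (seq_inr P₁ j).symm)
          (.refl (.par hs ht))).trans <|
        (Eqv.seq_assoc j (hasType_inr P₁ P₂) (.par hs ht)).trans <|
        (Eqv.seq_congr (.refl j) ((inr_par hs ht).trans (seq_inr Q₁ ht).symm)).trans
        (Eqv.seq_assoc j ht r).symm
      refine conv_generator (.par hs ht) c h' e ?_
      refine (conv_seq (iht c h) r fun m Z c' hm => ?_).of_eqv <|
        (Eqv.seq_assoc (.tape c) (.seq j ht) r).symm.trans
          (.seq_congr (Eqv.seq_assoc (.tape c) j ht).symm (.refl r))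
      exact conv_generator r c' hm
        ((seq_inr Q₁ (hasType_inj hm)).trans (inj_append_right Q₁ hm).symm)
        (conv_tape_inj (by simpa [List.getElem?_append_right] using hm) c')

theorem conv_of_hasType_singleton {X : C} {Q : List C} {s : Term C} (hs : HasType s [X] Q) :
    Conv X Q s := by
  refine (conv_of_hasType hs (𝟙 X) (n := 0) rfl).of_eqv ?_
  have e : Eqv [X] [X] (Term.seq (tape (𝟙 X)) (inj [X] 0)) (idW [X]) :=
    (Eqv.seq_id (.tape (𝟙 X))).trans ((Eqv.tape_id X).trans (idOne_eqv X))
  exact (Eqv.id_seq hs).symm.trans (.seq_congr e.symm (.refl hs))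

theorem sem_inj {X : C} {Q : List C} {n : ℕ} {Y : C} (h : Q[n]? = some Y)
    (f : Σ Y : C, X ⟶ Y) : sem X (inj Q n) (0, f) = Finsupp.single (n, f) 1 := by
  induction Q generalizing n with
  | nil => simp at h
  | cons U Q ih =>
    cases n with
    | zero =>
      rw [inj, sem_par_left _ _ (by simp)]
      rfl
    | succ n =>
      have h0 : (cobang U).arity = 0 := rfl
      have h1 : (cobang U).coarity = 1 := rfl
      rw [inj, sem_par_right _ _ (by simp [h0]), h0, h1, Nat.sub_zero, ih (by simpa using h),
        shift_single]

end Term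

/-! ### Faithfulness of the random walk semantics -/

/-- The token that has just been put on the wire `n`, labelled `X`. -/
def Tok.start (X : C) (n : ℕ) : Tok X := (n, ⟨X, 𝟙 X⟩)

namespace TapeCat

/-- The arrow given by a typed term. -/
def arrow {P Q : TapeCat C} (s : Term C) (hs : Term.HasType s P.word Q.word) : P ⟶ Q :=
  Quotient.mk _ ⟨s, hs⟩

theorem exists_arrow {P Q : TapeCat C} (f : P ⟶ Q) : ∃ s hs, f = arrow s hs := by
  induction f using Quotient.inductionOn with | _ s
  exact ⟨s.1, s.2, rfl⟩

theorem arrow_eq {P Q : TapeCat C} {s t : Term C} {hs : Term.HasType s P.word Q.word}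
    {ht : Term.HasType t P.word Q.word} (h : Term.Eqv P.word Q.word s t) :
    arrow s hs = arrow t ht := Quotient.sound h

theorem eqv_of_arrow_eq {P Q : TapeCat C} {s t : Term C} {hs : Term.HasType s P.word Q.word}
    {ht : Term.HasType t P.word Q.word} (h : arrow s hs = arrow t ht) :
    Term.Eqv P.word Q.word s t := Quotient.exact h

/-- The random walk of an arrow `X → Q` on a single wire. -/
def column {X : C} {Q : TapeCat C} : ((⟨[X]⟩ : TapeCat C) ⟶ Q) → TokSpace X :=
  Quotient.lift (fun s => Term.semₗ X s.1 (Finsupp.single (Tok.start X 0) 1)) fun _ _ h =>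
    Term.Eqv.semₗ_eq h (Finsupp.single_mem_supported ℝ 1 rfl)

theorem start_mem (X : C) : Finsupp.single (Tok.start X 0) 1 ∈ wires X [X] :=
  Finsupp.single_mem_supported ℝ 1 rfl

theorem column_star {X : C} {Q : TapeCat C} :
    column (PCA.star : (⟨[X]⟩ : TapeCat C) ⟶ Q) = 0 := Term.semₗ_star _ _ _

theorem column_add {X : C} {Q : TapeCat C} (p : OI) (f g : (⟨[X]⟩ : TapeCat C) ⟶ Q) :
    column (PCA.add p f g) = p.1 • column f + (1 - p.1) • column g := by
  obtain ⟨s, hs, rfl⟩ := exists_arrow f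
  obtain ⟨t, ht, rfl⟩ := exists_arrow g
  exact Term.semₗ_add p hs ht (start_mem X)

open Classical in
/-- The arrow `X → Q` that sends the start token to the token `k` (the point if `k` is not a token
on `Q`). -/
def generator {X : C} (Q : TapeCat C) (k : Tok X) : (⟨[X]⟩ : TapeCat C) ⟶ Q :=
  if h : Q.word[k.1]? = some k.2.1 then
    arrow (.seq (.tape k.2.2) (Term.inj Q.word k.1)) (.seq (.tape _) (Term.hasType_inj h))
  else PCA.star

theorem column_generator {X : C} (Q : TapeCat C) {k : Tok X} (hk : k ∈ Tok.On X Q.word) :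
    column (generator Q k) = Finsupp.single k 1 := by
  have h : Q.word[k.1]? = some k.2.1 := hk
  rw [generator, dif_pos h]
  change Term.semₗ X (.seq (.tape k.2.2) (Term.inj Q.word k.1)) _ = _
  rw [Term.semₗ_seq, Term.semₗ_single]
  simp [Term.sem, Tok.start, Term.sem_inj h]

theorem column_represents {X : C} {Q : TapeCat C} {d : SubDist (Tok X)}
    (hd : d.val ∈ wires X Q.word) {f : (⟨[X]⟩ : TapeCat C) ⟶ Q}
    (h : d.Represents (generator Q) f) : column f = d.val := by
  rw [h.map column column_star column_add]
  exact Term.eq_of_supported (g := LinearMap.id) hd fun k hk => by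
    simp [column_generator Q hk]

/-- Convex normal form: an arrow on a single wire is a convex combination of generators. -/
theorem exists_represents {X : C} {Q : TapeCat C} (f : (⟨[X]⟩ : TapeCat C) ⟶ Q) :
    ∃ d : SubDist (Tok X), d.val ∈ wires X Q.word ∧ d.Represents (generator Q) f := by
  obtain ⟨s, hs, rfl⟩ := exists_arrow f
  induction Term.conv_of_hasType_singleton hs with
  | @gen s n Y h c e =>
    refine ⟨SubDist.dirac (n, ⟨Y, c⟩), Finsupp.single_mem_supported ℝ 1 h, ?_⟩
    have : (arrow s hs : (⟨[X]⟩ : TapeCat C) ⟶ Q) = generator Q (n, ⟨Y, c⟩) := by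
      rw [generator, dif_pos h]
      exact arrow_eq e
    rw [this]
    exact SubDist.represents_dirac _ _
  | @star s e =>
    refine ⟨PCA.star, zero_mem _, ?_⟩
    have : (arrow s hs : (⟨[X]⟩ : TapeCat C) ⟶ Q) = PCA.star := arrow_eq e
    rw [this]
    exact SubDist.represents_star _
  | @add s t r p hs' ht' e ihs iht =>
    obtain ⟨d, hd, h⟩ := ihs hs'.hasType
    obtain ⟨d', hd', h'⟩ := iht ht'.hasType
    refine ⟨PCA.add p d d', ?_, ?_⟩
    · rw [SubDist.add_val]
      exact add_mem (Submodule.smul_mem _ _ hd) (Submodule.smul_mem _ _ hd')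
    have : (arrow r hs : (⟨[X]⟩ : TapeCat C) ⟶ Q) =
        PCA.add p (arrow s hs'.hasType) (arrow t ht'.hasType) :=
      arrow_eq e
    rw [this]
    exact h.add h' p

theorem column_injective {X : C} {Q : TapeCat C} :
    Function.Injective (column : ((⟨[X]⟩ : TapeCat C) ⟶ Q) → TokSpace X) := by
  intro f g h
  obtain ⟨d, hd, hf⟩ := exists_represents f
  obtain ⟨e, he, hg⟩ := exists_represents g
  rw [column_represents hd hf, column_represents he hg] at h
  obtain rfl : d = e := SubDist.ext h
  exact hf.unique hg

end TapeCat

namespace Term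

/-- Tapes with the same random walk are provably equal. -/
theorem eqv_of_sem {P Q : List C} {s t : Term C} (hs : HasType s P Q) (ht : HasType t P Q)
    (h : ∀ n U, P[n]? = some U → sem U s (Tok.start U n) = sem U t (Tok.start U n)) :
    Eqv P Q s t := by
  refine eqv_of_inj hs ht fun n U hn => ?_
  have j := hasType_inj hn
  have e : TapeCat.column (Q := ⟨Q⟩) (TapeCat.arrow (seq (inj P n) s) (.seq j hs)) =
      TapeCat.column (Q := ⟨Q⟩) (TapeCat.arrow (seq (inj P n) t) (.seq j ht)) := by
    change semₗ U (seq (inj P n) s) _ = semₗ U (seq (inj P n) t) _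
    rw [semₗ_seq, semₗ_seq, semₗ_single, Tok.start, sem_inj hn, one_smul, semₗ_single, semₗ_single,
      one_smul, one_smul]
    exact h n U hn
  exact TapeCat.eqv_of_arrow_eq (TapeCat.column_injective e)

/-- The random walk of a tape is a subdistribution. -/
theorem exists_subDist {P Q : List C} {s : Term C} (hs : HasType s P Q) {n : ℕ} {U : C}
    (hn : P[n]? = some U) : ∃ d : SubDist (Tok U), d.val = sem U s (Tok.start U n) := by
  have j := hasType_inj hn
  obtain ⟨d, hd, h⟩ := TapeCat.exists_represents (Q := ⟨Q⟩)
    (TapeCat.arrow (seq (inj P n) s) (.seq j hs))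
  refine ⟨d, (TapeCat.column_represents hd h).symm.trans ?_⟩
  change semₗ U (seq (inj P n) s) _ = _
  rw [semₗ_seq, semₗ_single, Tok.start, sem_inj hn, one_smul, semₗ_single, one_smul]
  rfl

/-- Every family of subdistributions is the random walk of a tape. -/
theorem exists_sem_eq (P Q : List C) (d : ℕ → ∀ U : C, SubDist (Tok U))
    (hd : ∀ n U, P[n]? = some U → (d n U).val ∈ wires U Q) :
    ∃ s, HasType s P Q ∧ ∀ n U, P[n]? = some U → sem U s (Tok.start U n) = (d n U).val := by
  have key : ∀ n, ∃ t : Term C, ∀ U, P[n]? = some U →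
      HasType t [U] Q ∧ semₗ U t (Finsupp.single (Tok.start U 0) 1) = (d n U).val := by
    intro n
    rcases hU : P[n]? with _ | U
    · exact ⟨idZero, by simp⟩
    obtain ⟨f, hf⟩ := SubDist.exists_represents (d n U) (TapeCat.generator ⟨Q⟩)
    have e := TapeCat.column_represents (Q := ⟨Q⟩) (hd n U hU) hf
    obtain ⟨t, ht, rfl⟩ := TapeCat.exists_arrow f
    refine ⟨t, fun V hV => ?_⟩
    obtain rfl : U = V := by simpa using hV
    exact ⟨ht, e⟩
  choose t ht using key
  obtain ⟨s, hs, h⟩ := exists_of_inj Q t fun n U hn => (ht n U hn).1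
  refine ⟨s, hs, fun n U hn => ?_⟩
  have e := (h n U hn).semₗ_eq (TapeCat.start_mem U)
  rw [semₗ_seq, semₗ_single, Tok.start, sem_inj hn, one_smul, semₗ_single, one_smul] at e
  exact e.trans (ht n U hn).2

end Term

end NormalForm

/-! ### Tapes form a convex biproduct category -/

section TapeBiproducts

variable {C : Type u} [Category.{v} C]

namespace Term

/-- The first projection `P ⊕ Q → P`. -/
def fst (P Q : List C) : Term C := par (idW P) (discardW Q)

/-- The second projection `P ⊕ Q → Q`. -/
def snd (P Q : List C) : Term C := par (discardW P) (idW Q)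

theorem hasType_fst (P Q : List C) : HasType (fst P Q) (P ++ Q) P :=
  (HasType.par (hasType_idW P) (hasType_discardW Q)).of_eq rfl (List.append_nil P)

theorem hasType_snd (P Q : List C) : HasType (snd P Q) (P ++ Q) Q :=
  .par (Q₁ := []) (hasType_discardW P) (hasType_idW Q)

theorem semₗ_inl {X : C} {P : List C} (Q : List C) {a : TokSpace X} (ha : a ∈ wires X P) :
    semₗ X (inl P Q) a = a := by
  rw [inl, semₗ_par_left (hasType_idW P) ha, semₗ_idW ha]

theorem semₗ_inr {X : C} (P : List C) {Q : List C} {b : TokSpace X} (hb : b ∈ wires X Q) :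
    semₗ X (inr P Q) b = shift X P.length b := by
  have h := semₗ_par_shift (X := X) (t := idW Q) (hasType_cobangW P) b
  rwa [List.length_nil, shift_zero, semₗ_idW hb] at h

theorem semₗ_fst {X : C} {P : List C} (Q : List C) {a : TokSpace X} (ha : a ∈ wires X P)
    (b : TokSpace X) : semₗ X (fst P Q) (a + shift X P.length b) = a := by
  rw [fst, semₗ_par (hasType_idW P) (hasType_discardW Q) ha, semₗ_idW ha, semₗ_discardW, map_zero,
    _root_.add_zero]

theorem semₗ_snd {X : C} {P Q : List C} {a b : TokSpace X} (ha : a ∈ wires X P)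
    (hb : b ∈ wires X Q) : semₗ X (snd P Q) (a + shift X P.length b) = b := by
  rw [snd, semₗ_par (hasType_discardW P) (hasType_idW Q) ha, semₗ_idW hb, semₗ_discardW,
    List.length_nil, shift_zero, _root_.zero_add]

end Term

namespace TapeCat

/-- The random walk of an arrow of `T(C)`, as a linear map. -/
def walk (X : C) {P Q : TapeCat C} : (P ⟶ Q) → (wires X P.word →ₗ[ℝ] wires X Q.word) :=
  Quotient.lift (fun s => (Term.semₗ X s.1).restrict fun _ hv => s.2.semₗ_mem hv) fun _ _ h =>
    LinearMap.ext fun v => Subtype.ext (Term.Eqv.semₗ_eq h v.2)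

theorem walk_arrow (X : C) {P Q : TapeCat C} {s : Term C} (hs : Term.HasType s P.word Q.word)
    (v : wires X P.word) : (walk X (arrow s hs) v : TokSpace X) = Term.semₗ X s v := rfl

theorem walk_id (X : C) (P : TapeCat C) (v : wires X P.word) : walk X (𝟙 P) v = v :=
  Subtype.ext (Term.semₗ_idW v.2)

theorem walk_comp (X : C) {P Q R : TapeCat C} (f : P ⟶ Q) (g : Q ⟶ R) (v : wires X P.word) :
    walk X (f ≫ g) v = walk X g (walk X f v) := by
  obtain ⟨s, hs, rfl⟩ := exists_arrow f
  obtain ⟨t, ht, rfl⟩ := exists_arrow g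
  exact Subtype.ext (Term.semₗ_seq (X := X) s t v.1)

theorem walk_star (X : C) (P Q : TapeCat C) : walk X (PCA.star : P ⟶ Q) = 0 :=
  LinearMap.ext fun _ => Subtype.ext (Term.semₗ_star _ _ _)

theorem walk_add (X : C) {P Q : TapeCat C} (p : OI) (f g : P ⟶ Q) :
    walk X (PCA.add p f g) = p.1 • walk X f + (1 - p.1) • walk X g := by
  obtain ⟨s, hs, rfl⟩ := exists_arrow f
  obtain ⟨t, ht, rfl⟩ := exists_arrow g
  exact LinearMap.ext fun v => Subtype.ext (Term.semₗ_add p hs ht v.2)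

theorem walk_addI (X : C) {P Q : TapeCat C} {p : ℝ} (h0 : 0 ≤ p) (h1 : p ≤ 1) (f g : P ⟶ Q) :
    walk X (PCA.addI p f g) = p • walk X f + (1 - p) • walk X g := by
  unfold PCA.addI
  split_ifs with h h'
  · exact walk_add X _ f g
  · obtain rfl : p = 0 := le_antisymm h' h0
    simp
  · obtain rfl : p = 1 := by
      by_contra hne
      exact h ⟨not_le.1 h', lt_of_le_of_ne h1 hne⟩
    simp

theorem walk_smul (X : C) {P Q : TapeCat C} {p : ℝ} (h0 : 0 ≤ p) (h1 : p ≤ 1) (f : P ⟶ Q) :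
    walk X (PCA.smul p f) = p • walk X f := by
  rw [PCA.smul, walk_addI X h0 h1, walk_star, smul_zero, _root_.add_zero]

/-- The random walk semantics is faithful. -/
theorem hom_ext_walk {P Q : TapeCat C} {f g : P ⟶ Q} (h : ∀ X v, walk X f v = walk X g v) :
    f = g := by
  obtain ⟨s, hs, rfl⟩ := exists_arrow f
  obtain ⟨t, ht, rfl⟩ := exists_arrow g
  refine arrow_eq (Term.eqv_of_sem hs ht fun n U hn => ?_)
  have e := congrArg Subtype.val
    (h U ⟨Finsupp.single (Tok.start U n) 1, Finsupp.single_mem_supported ℝ 1 hn⟩)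
  rw [walk_arrow, walk_arrow] at e
  simpa using e

/-- The sum of two words. -/
def sum (P Q : TapeCat C) : TapeCat C := ⟨P.word ++ Q.word⟩

/-- The first injection. -/
def inl (P Q : TapeCat C) : P ⟶ sum P Q := arrow (Term.inl P.word Q.word) (Term.hasType_inl _ _)

/-- The second injection. -/
def inr (P Q : TapeCat C) : Q ⟶ sum P Q := arrow (Term.inr P.word Q.word) (Term.hasType_inr _ _)

/-- The first projection. -/
def fst (P Q : TapeCat C) : sum P Q ⟶ P := arrow (Term.fst P.word Q.word) (Term.hasType_fst _ _)

/-- The second projection. -/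
def snd (P Q : TapeCat C) : sum P Q ⟶ Q := arrow (Term.snd P.word Q.word) (Term.hasType_snd _ _)

theorem walk_inl {X : C} {P : TapeCat C} (Q : TapeCat C) (v : wires X P.word) :
    (walk X (inl P Q) v : TokSpace X) = v := Term.semₗ_inl Q.word v.2

theorem walk_inr {X : C} (P : TapeCat C) {Q : TapeCat C} (v : wires X Q.word) :
    (walk X (inr P Q) v : TokSpace X) = shift X P.word.length v := Term.semₗ_inr P.word v.2

theorem walk_fst {X : C} {P Q : TapeCat C} (v : wires X (sum P Q).word) {a b : TokSpace X}
    (ha : a ∈ wires X P.word) (h : (v : TokSpace X) = a + shift X P.word.length b) :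
    (walk X (fst P Q) v : TokSpace X) = a :=
  (congrArg (Term.semₗ X (Term.fst P.word Q.word)) h).trans (Term.semₗ_fst Q.word ha b)

theorem walk_snd {X : C} {P Q : TapeCat C} (v : wires X (sum P Q).word) {a b : TokSpace X}
    (ha : a ∈ wires X P.word) (hb : b ∈ wires X Q.word)
    (h : (v : TokSpace X) = a + shift X P.word.length b) :
    (walk X (snd P Q) v : TokSpace X) = b :=
  (congrArg (Term.semₗ X (Term.snd P.word Q.word)) h).trans (Term.semₗ_snd ha hb)

theorem inl_fst (P Q : TapeCat C) : inl P Q ≫ fst P Q = 𝟙 P :=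
  hom_ext_walk fun X v => Subtype.ext <| by
    rw [walk_comp, walk_id, walk_fst (b := 0) _ v.2 (by rw [walk_inl, map_zero, _root_.add_zero])]

theorem inl_snd (P Q : TapeCat C) : inl P Q ≫ snd P Q = PCA.star :=
  hom_ext_walk fun X v => Subtype.ext <| by
    rw [walk_comp, walk_star,
      walk_snd (b := 0) _ v.2 (zero_mem _) (by rw [walk_inl, map_zero, _root_.add_zero])]
    rfl

theorem inr_fst (P Q : TapeCat C) : inr P Q ≫ fst P Q = PCA.star :=
  hom_ext_walk fun X v => Subtype.ext <| by
    rw [walk_comp, walk_star,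
      walk_fst (a := 0) _ (zero_mem _) (by rw [walk_inr, _root_.zero_add])]
    rfl

theorem inr_snd (P Q : TapeCat C) : inr P Q ≫ snd P Q = 𝟙 Q :=
  hom_ext_walk fun X v => Subtype.ext <| by
    rw [walk_comp, walk_id,
      walk_snd (a := 0) _ (zero_mem _) v.2 (by rw [walk_inr, _root_.zero_add])]

theorem isZero_nil : Limits.IsZero (⟨[]⟩ : TapeCat C) where
  unique_to Q := ⟨{
    default := arrow (Term.cobangW Q.word) (Term.hasType_cobangW _)
    uniq := fun f => by
      obtain ⟨s, hs, rfl⟩ := exists_arrow f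
      exact arrow_eq ((Term.Eqv.id_seq hs).symm.trans (.cobang_nat hs)) }⟩
  unique_from P := ⟨{
    default := arrow (Term.discardW P.word) (Term.hasType_discardW _)
    uniq := fun f => by
      obtain ⟨s, hs, rfl⟩ := exists_arrow f
      exact arrow_eq ((Term.Eqv.seq_id hs).symm.trans (.discard_nat hs)) }⟩

theorem exists_desc {P Q R : TapeCat C} (f : P ⟶ R) (g : Q ⟶ R) :
    ∃ h : sum P Q ⟶ R, inl P Q ≫ h = f ∧ inr P Q ≫ h = g := by
  obtain ⟨s, hs, rfl⟩ := exists_arrow f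
  obtain ⟨t, ht, rfl⟩ := exists_arrow g
  exact ⟨arrow (Term.copair R.word s t) (Term.hasType_copair hs ht),
    arrow_eq (Term.inl_copair hs ht), arrow_eq (Term.inr_copair hs ht)⟩

theorem sum_hom_ext {P Q R : TapeCat C} {f g : sum P Q ⟶ R} (hl : inl P Q ≫ f = inl P Q ≫ g)
    (hr : inr P Q ≫ f = inr P Q ≫ g) : f = g := by
  obtain ⟨s, hs, rfl⟩ := exists_arrow f
  obtain ⟨t, ht, rfl⟩ := exists_arrow g
  exact arrow_eq (Term.eqv_of_inl_inr hs ht (eqv_of_arrow_eq hl) (eqv_of_arrow_eq hr))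

/-- The word `P ⊕ Q` is a coproduct of `P` and `Q`. -/
def isColimitSum (P Q : TapeCat C) : Limits.IsColimit (Limits.BinaryCofan.mk (inl P Q) (inr P Q)) :=
  Limits.BinaryCofan.IsColimit.mk _ (fun f g => (exists_desc f g).choose)
    (fun f g => (exists_desc f g).choose_spec.1) (fun f g => (exists_desc f g).choose_spec.2)
    fun f g _ hl hr => sum_hom_ext (hl.trans (exists_desc f g).choose_spec.1.symm)
      (hr.trans (exists_desc f g).choose_spec.2.symm)

/-- The tokens on `P ⊕ Q` are determined by their images under the two projections. -/
theorem wires_sum_ext {X : C} {P Q : TapeCat C} {v w : wires X (sum P Q).word}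
    (hf : walk X (fst P Q) v = walk X (fst P Q) w) (hs : walk X (snd P Q) v = walk X (snd P Q) w) :
    v = w := by
  obtain ⟨a, ha, b, hb, h⟩ := exists_wires_append v.2
  obtain ⟨a', ha', b', hb', h'⟩ := exists_wires_append w.2
  have h1 := congrArg Subtype.val hf
  have h2 := congrArg Subtype.val hs
  rw [walk_fst v ha h, walk_fst w ha' h'] at h1
  rw [walk_snd v ha hb h, walk_snd w ha' hb' h'] at h2
  refine Subtype.ext (h.trans ?_)
  rw [h1, h2]
  exact h'.symm

theorem convexProduct_hom_ext {A P Q : TapeCat C} {h k : A ⟶ sum P Q}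
    (hf : h ≫ fst P Q = k ≫ fst P Q) (hs : h ≫ snd P Q = k ≫ snd P Q) : h = k :=
  hom_ext_walk fun X v => wires_sum_ext (by rw [← walk_comp, ← walk_comp, hf])
    (by rw [← walk_comp, ← walk_comp, hs])

/-- With the projections, `P ⊕ Q` is a convex product: the pairing of `p₁ · f` and `p₂ · g` is the
convex sum of `f ; ι₁` and `g ; ι₂`, and it is unique because its random walk is. -/
theorem isConvexProduct_sum (P Q : TapeCat C) : IsConvexProduct (fst P Q) (snd P Q) := by
  intro p₁ p₂ h1 h2 h12 A f g
  have hp1 : p₁ ≤ 1 := by linarith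
  have hp2 : p₂ ≤ 1 := by linarith
  have hq : 0 ≤ p₂ / (1 - p₁) := div_nonneg h2 (by linarith)
  have hq' : p₂ / (1 - p₁) ≤ 1 := div_le_one_of_le₀ (by linarith) (by linarith)
  have hmul : (1 - p₁) * (p₂ / (1 - p₁)) = p₂ := by
    rcases hp1.eq_or_lt with rfl | h
    · have : p₂ = 0 := by linarith
      simp [this]
    · exact mul_div_cancel₀ _ (by linarith)
  have e1 : PCA.addI p₁ (f ≫ inl P Q) (PCA.smul (p₂ / (1 - p₁)) (g ≫ inr P Q)) ≫ fst P Q =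
      PCA.smul p₁ f := by
    refine hom_ext_walk fun X v => ?_
    rw [walk_comp, walk_addI X h1 hp1, walk_smul X hq hq', walk_smul X h1 hp1]
    simp only [LinearMap.add_apply, LinearMap.smul_apply, map_add, map_smul, ← walk_comp,
      Category.assoc, inl_fst, inr_fst, Category.comp_id, PCAEnriched.comp_star, walk_star,
      LinearMap.zero_apply, smul_zero, _root_.add_zero]
  have e2 : PCA.addI p₁ (f ≫ inl P Q) (PCA.smul (p₂ / (1 - p₁)) (g ≫ inr P Q)) ≫ snd P Q =
      PCA.smul p₂ g := by
    refine hom_ext_walk fun X v => ?_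
    rw [walk_comp, walk_addI X h1 hp1, walk_smul X hq hq', walk_smul X h2 hp2]
    simp only [LinearMap.add_apply, LinearMap.smul_apply, map_add, map_smul, ← walk_comp,
      Category.assoc, inl_snd, inr_snd, Category.comp_id, PCAEnriched.comp_star, walk_star,
      LinearMap.zero_apply, smul_zero, _root_.zero_add, smul_smul, hmul]
  exact ⟨_, ⟨e1, e2⟩, fun k hk =>
    convexProduct_hom_ext (hk.1.trans e1.symm) (hk.2.trans e2.symm)⟩

theorem isConvexBiproductCategory (C : Type u) [Category.{v} C] :
    IsConvexBiproductCategory (TapeCat C) where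
  exists_zero := ⟨_, isZero_nil⟩
  exists_convexBiproduct P Q := ⟨sum P Q, inl P Q, inr P Q, fst P Q, snd P Q, ⟨isColimitSum P Q⟩,
    isConvexProduct_sum P Q, inl_fst P Q, inl_snd P Q, inr_fst P Q, inr_snd P Q⟩

end TapeCat

end TapeBiproducts

/-! ### Matrices and random walks -/

section MatrixWalks

theorem getElem?_map_obj {C : Type u} {P : List (Plus C)} {n : ℕ} {U : C}
    (h : (P.map Plus.obj)[n]? = some U) : ∃ i : Fin P.length, (i : ℕ) = n ∧ (P.get i).obj = U := by
  obtain ⟨hn, h⟩ := List.getElem?_eq_some_iff.1 h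
  exact ⟨⟨n, by simpa using hn⟩, rfl, by simpa using h⟩

theorem map_obj_getElem? {C : Type u} (P : List (Plus C)) (i : Fin P.length) :
    (P.map Plus.obj)[(i : ℕ)]? = some (P.get i).obj := by simp

variable {C : Type u} [Category.{v} C]

/-- A combination of arrows `X → V`, as a combination of tokens on the wire `j`. -/
def onWire (X : C) (j : ℕ) (V : C) : ((X ⟶ V) →₀ ℝ) →ₗ[ℝ] TokSpace X :=
  Finsupp.lmapDomain ℝ ℝ fun g => (j, ⟨V, g⟩)

@[simp]
theorem onWire_single {X : C} (j : ℕ) {V : C} (g : X ⟶ V) (a : ℝ) :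
    onWire X j V (Finsupp.single g a) = Finsupp.single (j, ⟨V, g⟩) a := by
  simp [onWire, Finsupp.lmapDomain_apply]

theorem mass_onWire {X : C} (j : ℕ) {V : C} (w : (X ⟶ V) →₀ ℝ) :
    mass _ (onWire X j V w) = mass _ w := by
  induction w using Finsupp.induction_linear with
  | zero => simp
  | add v v' h h' => simp only [map_add, h, h']
  | single k a => simp [mass]

theorem onWire_apply_self {X : C} (j : ℕ) {V : C} (w : (X ⟶ V) →₀ ℝ) (g : X ⟶ V) :
    onWire X j V w (j, ⟨V, g⟩) = w g :=
  Finsupp.mapDomain_apply (fun a b h => by simpa using h) w g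

theorem onWire_apply_of_ne {X : C} {j n : ℕ} (h : n ≠ j) {V : C} (w : (X ⟶ V) →₀ ℝ)
    (f : Σ Y : C, X ⟶ Y) : onWire X j V w (n, f) = 0 :=
  Finsupp.mapDomain_of_notMem_range w _ (by rintro ⟨g, hg⟩; exact h (congrArg Prod.fst hg).symm)

/-- A family of combinations of arrows `X → Qⱼ`, as a combination of tokens on `Q`. -/
def onWires (X : C) (Q : List (Plus C)) :
    (∀ j : Fin Q.length, (X ⟶ (Q.get j).obj) →₀ ℝ) →ₗ[ℝ] TokSpace X :=
  ∑ j : Fin Q.length, (onWire X j (Q.get j).obj) ∘ₗ LinearMap.proj j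

theorem onWires_apply {X : C} (Q : List (Plus C))
    (w : ∀ j : Fin Q.length, (X ⟶ (Q.get j).obj) →₀ ℝ) :
    onWires X Q w = ∑ j : Fin Q.length, onWire X j (Q.get j).obj (w j) := by
  simp [onWires]

theorem onWires_apply_apply {X : C} (Q : List (Plus C))
    (w : ∀ j : Fin Q.length, (X ⟶ (Q.get j).obj) →₀ ℝ) (j : Fin Q.length)
    (g : X ⟶ (Q.get j).obj) : onWires X Q w (j, ⟨_, g⟩) = w j g := by
  rw [onWires_apply, Finsupp.finsetSum_apply, Finset.sum_eq_single j, onWire_apply_self]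
  · exact fun k _ hk => onWire_apply_of_ne (fun h => hk (Fin.ext h.symm)) _ _
  · simp

theorem onWires_injective (X : C) (Q : List (Plus C)) : Function.Injective (onWires X Q) := by
  intro w w' h
  funext j
  ext g
  rw [← onWires_apply_apply Q w, h, onWires_apply_apply]

theorem exists_onWires {X : C} {Q : List (Plus C)} {v : TokSpace X}
    (hv : v ∈ wires X (Q.map Plus.obj)) : ∃ w, v = onWires X Q w := by
  have h : wires X (Q.map Plus.obj) ≤ LinearMap.range (onWires X Q) := by
    rw [wires, Finsupp.supported_eq_span_single, Submodule.span_le]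
    rintro _ ⟨⟨n, Y, f⟩, hk, rfl⟩
    obtain ⟨hn, h⟩ := List.getElem?_eq_some_iff.1 hk
    have hn' : n < Q.length := by simpa using hn
    obtain rfl : (Q.get ⟨n, hn'⟩).obj = Y := by simpa using h
    classical
    refine ⟨Pi.single ⟨n, hn'⟩ (Finsupp.single f 1), ?_⟩
    rw [onWires_apply, Finset.sum_eq_single ⟨n, hn'⟩]
    · simp
    · intro j _ hj
      rw [Pi.single_eq_of_ne hj, map_zero]
    · simp
  obtain ⟨w, hw⟩ := h hv
  exact ⟨w, hw.symm⟩

theorem onWires_mem {X : C} (Q : List (Plus C))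
    (w : ∀ j : Fin Q.length, (X ⟶ (Q.get j).obj) →₀ ℝ) :
    onWires X Q w ∈ wires X (Q.map Plus.obj) := by
  rw [onWires_apply]
  refine Submodule.sum_mem _ fun j _ => ?_
  induction w j using Finsupp.induction_linear with
  | zero => simp
  | add v v' h h' => rw [map_add]; exact add_mem h h'
  | single g a =>
    rw [onWire_single]
    exact Finsupp.single_mem_supported ℝ a (by simp [Tok.On])

theorem precomp_onWire {X Y V : C} (g : X ⟶ Y) (k : ℕ) (w : (Y ⟶ V) →₀ ℝ) :
    Term.precomp g (onWire Y k V w) = onWire X k V (convolveₗ _ _ _ (Finsupp.single g 1) w) := by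
  induction w using Finsupp.induction_linear with
  | zero => simp
  | add v v' h h' => simp only [map_add, h, h']
  | single h a => rw [onWire_single, convolveₗ_single, onWire_single]; simp

/-- Every nonnegative combination is a scalar multiple of a subdistribution. -/
theorem exists_eq_mass_smul {S : Type w} {d : S →₀ ℝ} (hd : ∀ x, 0 ≤ d x) :
    0 ≤ mass S d ∧ ∃ f : SubDist S, d = mass S d • f.val := by
  have h0 : 0 ≤ mass S d := by
    rw [mass_apply]; exact Finset.sum_nonneg fun x _ => hd x
  refine ⟨h0, ?_⟩
  rcases h0.eq_or_lt with h | h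
  · refine ⟨PCA.star, ?_⟩
    rw [← h, zero_smul]
    rw [mass_apply, Finsupp.sum, eq_comm, Finset.sum_eq_zero_iff_of_nonneg fun x _ => hd x] at h
    ext x
    by_contra hx
    exact hx (h x (Finsupp.mem_support_iff.2 hx))
  · refine ⟨⟨(mass S d)⁻¹ • d, fun x => ?_, ?_⟩, ?_⟩
    · exact mul_nonneg (inv_nonneg.2 h0) (hd x)
    · rw [← mass_apply, map_smul, smul_eq_mul, inv_mul_cancel₀ h.ne']
    · rw [smul_smul, mul_inv_cancel₀ h.ne', one_smul]

/-- The tape `s` and the matrix `M` agree: the random walk of `s` that starts on the wire `i` is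
distributed according to the `i`-th column of `M`. -/
def Agree {P Q : List (Plus C)} (s : Term C) (M : PreMat P Q) : Prop :=
  ∀ i : Fin P.length, Term.sem (P.get i).obj s (Tok.start _ i) =
    onWires (P.get i).obj Q fun j => M.val j i

theorem Agree.equiv {P Q : List (Plus C)} {s : Term C} {M N : PreMat P Q} (hM : Agree s M)
    (hN : Agree s N) : M ≈ N :=
  (PreMat.equiv_iff M N).2 fun j i =>
    congrFun (onWires_injective _ _ ((hM i).symm.trans (hN i))) j

theorem Agree.of_equiv {P Q : List (Plus C)} {s : Term C} {M N : PreMat P Q} (hM : Agree s M)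
    (h : M ≈ N) : Agree s N := fun i => (hM i).trans <| by
  congr 1
  funext j
  exact (PreMat.equiv_iff M N).1 h j i

theorem Agree.eqv {P Q : List (Plus C)} {s t : Term C} {M : PreMat P Q}
    (hs : Term.HasType s (P.map Plus.obj) (Q.map Plus.obj))
    (ht : Term.HasType t (P.map Plus.obj) (Q.map Plus.obj)) (hM : Agree s M) (hN : Agree t M) :
    Term.Eqv (P.map Plus.obj) (Q.map Plus.obj) s t := by
  refine Term.eqv_of_sem hs ht fun n U hn => ?_
  obtain ⟨i, rfl, rfl⟩ := getElem?_map_obj hn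
  exact (hM i).trans (hN i).symm

theorem Agree.of_eqv {P Q : List (Plus C)} {s t : Term C} {M : PreMat P Q} (hM : Agree s M)
    (h : Term.Eqv (P.map Plus.obj) (Q.map Plus.obj) s t) : Agree t M := fun i => by
  have e := h.semₗ_eq (X := (P.get i).obj) (v := Finsupp.single (Tok.start _ i) 1)
    (Finsupp.single_mem_supported ℝ 1 (map_obj_getElem? P i))
  rw [Term.semₗ_single, Term.semₗ_single, one_smul, one_smul] at e
  exact e.symm.trans (hM i)

theorem agree_id (P : List (Plus C)) : Agree (Term.idW (P.map Plus.obj)) (PreMat.id P) := by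
  intro i
  rw [Term.sem_idW _ (by simp [Tok.start]), onWires_apply, Finset.sum_eq_single i,
    PreMat.id_val_self, onWire_single]
  · rfl
  · intro j _ hj
    rw [PreMat.id_val_ne _ hj.symm, map_zero]
  · simp

theorem agree_star (P Q : List (Plus C)) :
    Agree (Term.star (P.map Plus.obj) (Q.map Plus.obj)) (PreMat.star P Q) := by
  intro i
  have h := Term.semₗ_star (P.map Plus.obj) (Q.map Plus.obj)
    (Finsupp.single (Tok.start (P.get i).obj i) 1)
  rw [Term.semₗ_single, one_smul] at h
  rw [h, onWires_apply]
  simp [PreMat.star_val]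

theorem Agree.add (p : OI) {P Q : List (Plus C)} {s t : Term C} {M N : PreMat P Q}
    (hs : Term.HasType s (P.map Plus.obj) (Q.map Plus.obj))
    (ht : Term.HasType t (P.map Plus.obj) (Q.map Plus.obj)) (hM : Agree s M) (hN : Agree t N) :
    Agree (Term.add p (P.map Plus.obj) (Q.map Plus.obj) s t) (PreMat.add p M N) := by
  intro i
  have h := Term.semₗ_add (X := (P.get i).obj) p hs ht (v := Finsupp.single (Tok.start _ i) 1)
    (Finsupp.single_mem_supported ℝ 1 (map_obj_getElem? P i))
  rw [Term.semₗ_single, Term.semₗ_single, Term.semₗ_single, one_smul, one_smul, one_smul] at h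
  rw [h, hM i, hN i, ← map_smul, ← map_smul, ← map_add]
  congr 1
  funext j
  exact (PreMat.add_val p M N j i).symm

/-- A tape acts on the tokens of a wire by convolution with the matrix entries. -/
theorem Agree.semₗ_onWire {P Q : List (Plus C)} {t : Term C} {N : PreMat P Q} (hN : Agree t N)
    {X : C} (j : Fin P.length) (w : (X ⟶ (P.get j).obj) →₀ ℝ) :
    Term.semₗ X t (onWire X j _ w) = onWires X Q fun k => convolveₗ _ _ _ w (N.val k j) := by
  simp only [onWires_apply]
  induction w using Finsupp.induction_linear with
  | zero => simp
  | add v v' h h' => simp only [map_add, h, h', LinearMap.add_apply, Finset.sum_add_distrib]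
  | single g a =>
    have e := Term.sem_precomp g t (Tok.start (P.get j).obj j)
    have e' : ((Tok.start (P.get j).obj j).1, ⟨(Tok.start (P.get j).obj j).2.1,
        g ≫ (Tok.start (P.get j).obj j).2.2⟩) = ((j, ⟨(P.get j).obj, g⟩) : Tok X) := by
      simp [Tok.start]
    rw [e', hN j, onWires_apply, map_sum] at e
    rw [onWire_single, Term.semₗ_single, e, Finset.smul_sum]
    refine Finset.sum_congr rfl fun k _ => ?_
    rw [precomp_onWire, ← map_smul, ← LinearMap.smul_apply, ← map_smul, Finsupp.smul_single,
      smul_eq_mul, mul_one]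

theorem Agree.comp {P Q R : List (Plus C)} {s t : Term C} {M : PreMat P Q} {N : PreMat Q R}
    (hM : Agree s M) (hN : Agree t N) : Agree (Term.seq s t) (M.comp N) := by
  intro i
  rw [Term.sem_seq, hM i, onWires_apply, map_sum, Finset.sum_congr rfl fun j _ =>
    hN.semₗ_onWire j (M.val j i), ← map_sum]
  congr 1
  funext k
  rw [PreMat.comp_val, Finset.sum_apply]

/-- Every tape has a matrix: its random walk is split according to the output wires, and each part
is normalised. -/
theorem exists_preMat {P Q : List (Plus C)} {s : Term C}
    (hs : Term.HasType s (P.map Plus.obj) (Q.map Plus.obj)) : ∃ M : PreMat P Q, Agree s M := by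
  have key : ∀ i : Fin P.length, ∃ (p : Fin Q.length → ℝ)
      (f : ∀ j, SubDist ((P.get i).obj ⟶ (Q.get j).obj)), (∀ j, 0 ≤ p j) ∧ ∑ j, p j ≤ 1 ∧
      Term.sem (P.get i).obj s (Tok.start _ i) =
        onWires (P.get i).obj Q fun j => p j • (f j).val := by
    intro i
    obtain ⟨d, hd⟩ := Term.exists_subDist hs (map_obj_getElem? P i)
    obtain ⟨w, hw⟩ := exists_onWires (hs.sem_mem (X := (P.get i).obj)
      (k := Tok.start _ i) (map_obj_getElem? P i))
    have hdw : d.val = onWires _ Q w := hd.trans hw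
    have hpos : ∀ j g, 0 ≤ w j g := fun j g => by
      rw [← onWires_apply_apply Q w, ← hdw]; exact d.nonneg _
    choose hm f hf using fun j => exists_eq_mass_smul (hpos j)
    refine ⟨fun j => mass _ (w j), f, hm, ?_, ?_⟩
    · have := d.mass_le
      rw [hdw, onWires_apply, map_sum] at this
      simpa only [mass_onWire] using this
    · rw [hw]
      congr 1
      funext j
      exact hf j
  choose p f hp hsum h using key
  exact ⟨⟨fun j i => p i j, fun j i => f i j, fun j i => hp i j, hsum⟩, h⟩

/-- Every matrix is the matrix of a tape. -/
theorem exists_term {P Q : List (Plus C)} (M : PreMat P Q) :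
    ∃ s, Term.HasType s (P.map Plus.obj) (Q.map Plus.obj) ∧ Agree s M := by
  classical
  have key : ∀ i : Fin P.length, ∃ d : SubDist (Tok (P.get i).obj),
      d.val = onWires (P.get i).obj Q fun j => M.val j i := by
    intro i
    refine ⟨⟨onWires (P.get i).obj Q fun j => M.val j i, ?_, ?_⟩, rfl⟩
    · intro k
      rw [onWires_apply, Finsupp.finsetSum_apply]
      refine Finset.sum_nonneg fun j _ => ?_
      by_cases hk : k ∈ Set.range
          fun g : (P.get i).obj ⟶ (Q.get j).obj => ((j, ⟨_, g⟩) : Tok (P.get i).obj)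
      · obtain ⟨g, rfl⟩ := hk
        rw [onWire_apply_self]
        exact mul_nonneg (M.nonneg j i) ((M.f j i).nonneg g)
      · exact (Finsupp.mapDomain_of_notMem_range _ _ hk).ge
    · rw [← mass_apply, onWires_apply, map_sum]
      refine (Finset.sum_le_sum fun j _ => ?_).trans (M.sum_le i)
      rw [mass_onWire, PreMat.val, map_smul, smul_eq_mul]
      exact mul_le_of_le_one_right (M.nonneg j i) (SubDist.mass_le (M.f j i))
  choose d hd using key
  -- extended by zero to all numbers of wires and all objects
  let d' : ℕ → ∀ U : C, SubDist (Tok U) := fun n U =>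
    if h : ∃ i : Fin P.length, (i : ℕ) = n ∧ (P.get i).obj = U then h.choose_spec.2 ▸ d h.choose
    else PCA.star
  have hd' : ∀ i : Fin P.length, d' i (P.get i).obj = d i := by
    intro i
    have h : ∃ k : Fin P.length, (k : ℕ) = i ∧ (P.get k).obj = (P.get i).obj := ⟨i, rfl, rfl⟩
    have e : ∀ (k : Fin P.length) (hk : k = i) (hU : (P.get k).obj = (P.get i).obj),
        (hU ▸ d k : SubDist (Tok (P.get i).obj)) = d i := by
      rintro k rfl _; rfl
    exact (dif_pos h).trans (e _ (Fin.ext h.choose_spec.1) _)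
  obtain ⟨s, hs, h⟩ := Term.exists_sem_eq (P.map Plus.obj) (Q.map Plus.obj) d' (by
    intro n U hn
    obtain ⟨i, rfl, rfl⟩ := getElem?_map_obj hn
    rw [hd', hd]
    exact onWires_mem _ _)
  exact ⟨s, hs, fun i => (h i _ (map_obj_getElem? P i)).trans (by rw [hd', hd])⟩

end MatrixWalks

/-! ### The functor from matrices to tapes -/

namespace StMat

/-- The underlying word of objects of `C`. -/
def tapeObj {C : Type u} (P : StMat (Plus C)) : TapeCat C := ⟨P.word.map Plus.obj⟩

theorem tapeObj_bijective {C : Type u} :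
    Function.Bijective (tapeObj : StMat (Plus C) → TapeCat C) := by
  constructor
  · rintro ⟨P⟩ ⟨Q⟩ h
    have h' : P.map Plus.obj = Q.map Plus.obj := congrArg TapeCat.word h
    have hinj : Function.Injective (Plus.obj : Plus C → C) := by
      rintro ⟨a⟩ ⟨b⟩ rfl; rfl
    rw [List.map_injective_iff.2 hinj h']
  · rintro ⟨P⟩
    refine ⟨⟨P.map Plus.mk⟩, ?_⟩
    simp [tapeObj, Function.comp_def]

variable {C : Type u} [Category.{v} C]

/-- A tape and a matrix correspond to each other if their representatives agree. -/
def Corresponds {P Q : StMat (Plus C)} (m : P ⟶ Q) (f : tapeObj P ⟶ tapeObj Q) : Prop :=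
  ∃ (M : PreMat P.word Q.word) (s : Term C) (hs : _),
    m = Quotient.mk _ M ∧ f = TapeCat.arrow s hs ∧ Agree s M

theorem exists_corresponds {P Q : StMat (Plus C)} (m : P ⟶ Q) : ∃ f, Corresponds m f := by
  induction m using Quotient.inductionOn with | _ M
  obtain ⟨s, hs, h⟩ := exists_term M
  exact ⟨TapeCat.arrow s hs, M, s, hs, rfl, rfl, h⟩

theorem exists_corresponds' {P Q : StMat (Plus C)} (f : tapeObj P ⟶ tapeObj Q) :
    ∃ m : P ⟶ Q, Corresponds m f := by
  obtain ⟨s, hs, rfl⟩ := TapeCat.exists_arrow f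
  obtain ⟨M, h⟩ := exists_preMat hs
  exact ⟨Quotient.mk _ M, M, s, hs, rfl, rfl, h⟩

theorem Corresponds.unique {P Q : StMat (Plus C)} {m : P ⟶ Q} {f g : tapeObj P ⟶ tapeObj Q}
    (hf : Corresponds m f) (hg : Corresponds m g) : f = g := by
  obtain ⟨M, s, hs, rfl, rfl, h⟩ := hf
  obtain ⟨N, t, ht, e, rfl, h'⟩ := hg
  have h2 : M ≈ N := Quotient.exact e
  exact TapeCat.arrow_eq ((h.of_equiv h2).eqv hs ht h')

theorem Corresponds.unique' {P Q : StMat (Plus C)} {m n : P ⟶ Q} {f : tapeObj P ⟶ tapeObj Q}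
    (hm : Corresponds m f) (hn : Corresponds n f) : m = n := by
  obtain ⟨M, s, hs, rfl, rfl, h⟩ := hm
  obtain ⟨N, t, ht, rfl, e, h'⟩ := hn
  exact Quotient.sound ((h.of_eqv (TapeCat.eqv_of_arrow_eq e)).equiv h')

theorem Corresponds.comp {P Q R : StMat (Plus C)} {m : P ⟶ Q} {n : Q ⟶ R}
    {f : tapeObj P ⟶ tapeObj Q} {g : tapeObj Q ⟶ tapeObj R} (hm : Corresponds m f)
    (hn : Corresponds n g) : Corresponds (m ≫ n) (f ≫ g) := by
  obtain ⟨M, s, hs, rfl, rfl, h⟩ := hm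
  obtain ⟨N, t, ht, rfl, rfl, h'⟩ := hn
  exact ⟨M.comp N, .seq s t, .seq hs ht, rfl, rfl, h.comp h'⟩

theorem corresponds_id (P : StMat (Plus C)) : Corresponds (𝟙 P) (𝟙 (tapeObj P)) :=
  ⟨PreMat.id _, Term.idW _, Term.hasType_idW _, rfl, rfl, agree_id _⟩

theorem corresponds_star (P Q : StMat (Plus C)) :
    Corresponds (PCA.star : P ⟶ Q) (PCA.star : tapeObj P ⟶ tapeObj Q) :=
  ⟨PreMat.star _ _, Term.star _ _, Term.hasType_star _ _, rfl, rfl, agree_star _ _⟩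

theorem Corresponds.add (p : OI) {P Q : StMat (Plus C)} {m n : P ⟶ Q}
    {f g : tapeObj P ⟶ tapeObj Q} (hm : Corresponds m f) (hn : Corresponds n g) :
    Corresponds (PCA.add p m n) (PCA.add p f g) := by
  obtain ⟨M, s, hs, rfl, rfl, h⟩ := hm
  obtain ⟨N, t, ht, rfl, rfl, h'⟩ := hn
  exact ⟨PreMat.add p M N, _, Term.hasType_add p hs ht, rfl, rfl, h.add p hs ht h'⟩

/-- The functor `StMat(C⁺) → T(C)` that sends a matrix to the tape with the same random walk. -/
def toTape (C : Type u) [Category.{v} C] : StMat (Plus C) ⥤ TapeCat C where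
  obj := tapeObj
  map m := (exists_corresponds m).choose
  map_id P := (exists_corresponds (𝟙 P)).choose_spec.unique (corresponds_id P)
  map_comp m n := (exists_corresponds (m ≫ n)).choose_spec.unique
    ((exists_corresponds m).choose_spec.comp (exists_corresponds n).choose_spec)

theorem corresponds_toTape {P Q : StMat (Plus C)} (m : P ⟶ Q) :
    Corresponds m ((toTape C).map m) := (exists_corresponds m).choose_spec

instance : (toTape C).Faithful where
  map_injective {_ _ m n} h :=
    (corresponds_toTape m).unique' (h.symm ▸ corresponds_toTape n : Corresponds n _)

instance : (toTape C).Full where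
  map_surjective f := by
    obtain ⟨m, hm⟩ := exists_corresponds' f
    exact ⟨m, (corresponds_toTape m).unique hm⟩

theorem toTape_star (P Q : StMat (Plus C)) : (toTape C).map (PCA.star : P ⟶ Q) = PCA.star :=
  (corresponds_toTape _).unique (corresponds_star P Q)

theorem toTape_add {P Q : StMat (Plus C)} (p : OI) (m n : P ⟶ Q) :
    (toTape C).map (PCA.add p m n) = PCA.add p ((toTape C).map m) ((toTape C).map n) :=
  (corresponds_toTape _).unique ((corresponds_toTape m).add p (corresponds_toTape n))

end StMat

/-! ### Isomorphisms of convex biproduct categories -/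

section Transfer

/-- A fully faithful functor that is bijective on objects has a strict inverse. -/
theorem exists_strict_inverse {D : Type u} [Category.{v} D] {E : Type u'} [Category.{v'} E]
    (G : D ⥤ E) [G.Full] [G.Faithful] (hobj : Function.Bijective G.obj) :
    ∃ F : E ⥤ D, F ⋙ G = 𝟭 E ∧ G ⋙ F = 𝟭 D := by
  choose o ho using hobj.2
  let F : E ⥤ D :=
    { obj := o
      map := fun f => G.preimage (eqToHom (ho _) ≫ f ≫ eqToHom (ho _).symm)
      map_id := fun X => G.map_injective (by simp)
      map_comp := fun f g => G.map_injective (by simp) }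
  have hF : ∀ {X Y : E} (f : X ⟶ Y), G.map (F.map f) = eqToHom (ho X) ≫ f ≫ eqToHom (ho Y).symm :=
    fun f => G.map_preimage _
  refine ⟨F, CategoryTheory.Functor.ext ho fun X Y f => hF f,
    CategoryTheory.Functor.ext (fun X => hobj.1 (ho _)) fun X Y f => G.map_injective ?_⟩
  simp [hF, eqToHom_map]

variable {D : Type u} [Category.{v} D] [PCAEnriched D]
  {E : Type u'} [Category.{v'} E] [PCAEnriched E] (G : D ⥤ E)

theorem map_smul_of_map_add (hstar : ∀ X Y : D, G.map (PCA.star : X ⟶ Y) = PCA.star)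
    (hadd : ∀ {X Y : D} (p : OI) (f g : X ⟶ Y),
      G.map (PCA.add p f g) = PCA.add p (G.map f) (G.map g))
    (p : ℝ) {X Y : D} (f : X ⟶ Y) :
    G.map (PCA.smul p f) = PCA.smul p (G.map f) := by
  unfold PCA.smul PCA.addI
  split_ifs
  · rw [hadd, hstar]
  · exact hstar _ _
  · rfl

variable [G.Full] [G.Faithful]

/-- A fully faithful PCA-enriched functor that is surjective on objects reflects the property of
being a convex biproduct category. -/
theorem IsConvexBiproductCategory.of_fullyFaithful [IsConvexBiproductCategory E]
    (hobj : Function.Surjective G.obj)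
    (hstar : ∀ X Y : D, G.map (PCA.star : X ⟶ Y) = PCA.star)
    (hadd : ∀ {X Y : D} (p : OI) (f g : X ⟶ Y),
      G.map (PCA.add p f g) = PCA.add p (G.map f) (G.map g)) :
    IsConvexBiproductCategory D where
  exists_zero := by
    obtain ⟨Z, hZ⟩ := IsConvexBiproductCategory.exists_zero (C := E)
    obtain ⟨Z, rfl⟩ := hobj Z
    refine ⟨Z, ⟨fun Y => ⟨⟨⟨G.preimage (hZ.to_ _)⟩, fun f => ?_⟩⟩,
      fun Y => ⟨⟨⟨G.preimage (hZ.from_ _)⟩, fun f => ?_⟩⟩⟩⟩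
    · exact G.map_injective (hZ.eq_of_src _ _)
    · exact G.map_injective (hZ.eq_of_tgt _ _)
  exists_convexBiproduct X₁ X₂ := by
    obtain ⟨Z, ι₁, ι₂, π₁, π₂, ⟨hι⟩, hπ, h11, h12, h21, h22⟩ :=
      IsConvexBiproductCategory.exists_convexBiproduct (G.obj X₁) (G.obj X₂)
    obtain ⟨Z, rfl⟩ := hobj Z
    obtain ⟨ι₁, rfl⟩ := G.map_surjective ι₁
    obtain ⟨ι₂, rfl⟩ := G.map_surjective ι₂
    obtain ⟨π₁, rfl⟩ := G.map_surjective π₁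
    obtain ⟨π₂, rfl⟩ := G.map_surjective π₂
    refine ⟨Z, ι₁, ι₂, π₁, π₂, ⟨?_⟩, ?_, ?_, ?_, ?_, ?_⟩
    · exact Limits.isColimitOfReflects G
        ((Limits.isColimitMapCoconeBinaryCofanEquiv G ι₁ ι₂).symm hι)
    · intro p₁ p₂ h1 h2 h12 A f g
      obtain ⟨k, ⟨hk1, hk2⟩, huniq⟩ := hπ p₁ p₂ h1 h2 h12 (G.obj A) (G.map f) (G.map g)
      obtain ⟨k, rfl⟩ := G.map_surjective k
      rw [← G.map_comp, ← map_smul_of_map_add G hstar hadd] at hk1 hk2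
      refine ⟨k, ⟨G.map_injective hk1, G.map_injective hk2⟩, fun l hl => G.map_injective ?_⟩
      refine huniq _ ⟨?_, ?_⟩
      · rw [← G.map_comp, hl.1, map_smul_of_map_add G hstar hadd]
      · rw [← G.map_comp, hl.2, map_smul_of_map_add G hstar hadd]
    all_goals
      refine G.map_injective ?_
      first
        | rw [G.map_comp, h11, G.map_id]
        | rw [G.map_comp, h12, hstar]
        | rw [G.map_comp, h21, hstar]
        | rw [G.map_comp, h22, G.map_id]

/-- A fully faithful PCA-enriched functor that is bijective on objects is an isomorphism of convex
biproduct categories. -/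
theorem exists_cbIso [IsConvexBiproductCategory D] [IsConvexBiproductCategory E]
    (hobj : Function.Bijective G.obj)
    (hstar : ∀ X Y : D, G.map (PCA.star : X ⟶ Y) = PCA.star)
    (hadd : ∀ {X Y : D} (p : OI) (f g : X ⟶ Y),
      G.map (PCA.add p f g) = PCA.add p (G.map f) (G.map g)) : Nonempty (CBIso E D) := by
  obtain ⟨F, hFG, hGF⟩ := exists_strict_inverse G hobj
  let e : E ≌ D := CategoryTheory.Equivalence.mk F G (eqToIso hFG.symm) (eqToIso hGF)
  have hF : F.IsEquivalence := e.isEquivalence_functor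
  have hG : G.IsEquivalence := e.isEquivalence_inverse
  have hmap : ∀ {X Y : E} (f : X ⟶ Y), G.map (F.map f) =
      eqToHom (congrArg (fun K : E ⥤ E => K.obj X) hFG) ≫ f ≫
        eqToHom (congrArg (fun K : E ⥤ E => K.obj Y) hFG.symm) :=
    fun f => CategoryTheory.Functor.congr_hom hFG f
  refine ⟨⟨⟨F, fun X Y => G.map_injective ?_, fun p f g => G.map_injective ?_,
    ⟨fun _ => inferInstance⟩⟩,
    ⟨G, hstar, hadd, ⟨fun _ => inferInstance⟩⟩, hFG, hGF⟩⟩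
  · rw [hmap, hstar, PCAEnriched.star_comp, PCAEnriched.comp_star]
  · rw [hadd, hmap, hmap, hmap, PCAEnriched.add_comp, PCAEnriched.comp_add]

end Transfer

end ProbTape
end

theorem mainTheorem1 (C : Type u) [Category.{v} C] :
    ∃ (_ : ProbTape.IsConvexBiproductCategory (ProbTape.TapeCat C))
      (_ : ProbTape.IsConvexBiproductCategory (ProbTape.StMat (ProbTape.Plus C))),
      Nonempty (ProbTape.CBIso (ProbTape.TapeCat C) (ProbTape.StMat (ProbTape.Plus C))) := by
  have hT := ProbTape.TapeCat.isConvexBiproductCategory C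
  have hM := ProbTape.IsConvexBiproductCategory.of_fullyFaithful (ProbTape.StMat.toTape C)
    ProbTape.StMat.tapeObj_bijective.2 ProbTape.StMat.toTape_star ProbTape.StMat.toTape_add
  exact ⟨hT, hM, ProbTape.exists_cbIso (ProbTape.StMat.toTape C) ProbTape.StMat.tapeObj_bijective
    ProbTape.StMat.toTape_star ProbTape.StMat.toTape_add⟩
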